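/- All graphs are finite, simple and have at least one vertex; $\log$ is the natural logarithm. Let $W\colon[-1/e,\infty)\to[-1,\infty)$ and $W_{-1}\colon[-1/e,0)\to(-\infty,-1]$ be the two real branches of the inverse of $x\mapsto xe^x$, and let $K(y)=-W_{-1}(-1/(ey))$ for $y\ge 1$. Then $K$ maps $[1,\infty)$ into $[1,\infty)$, and $K(y)\sim\log y$ as $y\to\infty$. For a graph $H$ let $\alpha(H)$ be its independence number; the Hall ratio of $G$ is $\max\{|V(H)|/\alpha(H) : H\subseteq G\}$ over subgraphs $H$ with at least one vertex (and it is $0$ if $G$ has no vertex). Let $Z_G(x)=\sum_I x^{|I|}$, the sum being over all independent sets $I$ of $G$. The hard-core model on $G$ at fugacity $\lambda>0$ is the random independent set $\mathbf I$ with $\Pr(\mathbf I=I)=\lambda^{|I|}/Z_G(\lambda)$, and its occupancy fraction is $\mathbb E|\mathbf I|/|V(G)|$. A fractional colouring of $G$ assigns to the independent sets $I$ of $G$ pairwise disjoint (possibly empty) intervals $w(I)\subseteq[0,k)$, for some real $k$, such that $\sum_{I\ni v}|w(I)|=1$ for every vertex $v$; then $v$ is coloured with the set $\bigcup_{I\ni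 v}w(I)$. A cover of $G$ is a pair $\mathscr H=(L,H)$ of a graph $H$ and a map $L\colon V(G)\to 2^{V(H)}$ with finite values such that the sets $L(u)$ partition $V(H)$ (empty sets are allowed), each $H[L(u)]$ is complete, there are edges between $L(u)$ and $L(v)$ only if $u=v$ or $uv\in E(G)$, and for $uv\in E(G)$ the edges between $L(u)$ and $L(v)$ form a (possibly empty) matching. $G$ is $\mathscr H$-colourable if $H$ has an independent set of size $|V(G)|$, and the correspondence chromatic number $\chi_c(G)$ is the least $k$ such that $G$ is $\mathscr H$-colourable for every cover $\mathscr H$ with $|L(u)|=k$ for all $u$. **Theorem.** In each of the following statements, $G$ is a graph of maximum degree $\Delta$, $\rho_u\ge 1$ ($u\in V(G)$) are reals such that the neighbourhood of every $u$ induces a subgraph of Hall ratio at most $\rho_u$, and $\rho=\max_u\rho_u$. In (ii) and (iii), a first argument of the maximum that is undefined (because $\deg(u)=0$, or because its denominator is $0$) is read as $0$. (i) If $\Delta\ge 1$, then for every $\lambda>0$, with $k(x)=K(\rho x/\log(1+x))$, the occupancy fraction of the hard-core model on $G$ at fugacity $\lambda$ satisfies $$\frac{\mathbb E|\mathbf I|}{|V(G)|}=\frac1{|V(G)|}\frac{\lambda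 Z_G'(\lambda)}{Z_G(\lambda)}\ \ge\ \max_{0\le x\le\lambda}\frac{W\big(k(x)\Delta x/(1+x)\big)}{k(x)\Delta},$$ where the expression at $x=0$ is read as its limit $0$, and the maximum is attained. (ii) For every $\varepsilon>0$ there is $\delta_0>1$, depending only on $\varepsilon$, such that every such $G$ has a fractional colouring in which each $u\in V(G)$ is coloured with a subset of $$\left[0,\ (1+\varepsilon)\max\left\{\frac{K(\rho_u)\deg(u)}{\log(K(\rho_u)\deg(u))},\ \frac{K(\rho_u)\delta_0}{\log(K(\rho_u)\delta_0)}\right\}\right).$$ (iii) For every $\varepsilon>0$ there are $\delta_0>1$ and an integer $\Delta_0\ge 2$, depending only on $\varepsilon$, such that the following holds for every such $G$ with $\Delta\ge\Delta_0$. Put $\delta=\delta_0\,\rho\log\Delta$. If $\mathscr H=(L,H)$ is a cover of $G$ such that for each $u\in V(G)$ $$|L(u)|\ \ge\ (1+\varepsilon)\max\left\{\frac{K(\rho_u)\deg(u)}{\log\left(\frac{K(\rho_u)\deg(u)}{\rho\log\Delta}\right)},\ \frac{K(\rho_u)\delta}{\log\left(\frac{K(\rho_u)\delta}{\rho\log\Delta}\right)}\right\},$$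 then $G$ is $\mathscr H$-colourable. In particular, $\chi_c(G)\le(1+o(1))\,K(\rho)\Delta/\log(K(\rho)\Delta/\rho)$ as $\Delta\to\infty$, uniformly in $\rho$: for every $\varepsilon>0$ there is $\Delta_0$ such that every such $G$ with $\Delta\ge\Delta_0$ and $K(\rho)\Delta/\rho>1$ satisfies $$\chi_c(G)\le(1+\varepsilon)\,\frac{K(\rho)\Delta}{\log(K(\rho)\Delta/\rho)}.$$ -/

import Mathlib

open Set Filter MeasureTheory

universe u v

noncomputable section

namespace LocalHall

/-! ### The Lambert function and `K` -/

/-- The principal branch `W : [-1/e, ∞) → [-1, ∞)` of the Lambert function: the inverse of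
`x ↦ x * exp x` on `[-1, ∞)`. -/
def lambertW (y : ℝ) : ℝ :=
  Function.invFunOn (fun x : ℝ => x * Real.exp x) (Ici (-1)) y

/-- The lower branch `W₋₁ : [-1/e, 0) → (-∞, -1]` of the Lambert function: the inverse of
`x ↦ x * exp x` on `(-∞, -1]`. -/
def lambertWLower (y : ℝ) : ℝ :=
  Function.invFunOn (fun x : ℝ => x * Real.exp x) (Iic (-1)) y

/-- `K(y) = -W₋₁(-1/(e y))`. -/
def K (y : ℝ) : ℝ := -lambertWLower (-1 / (Real.exp 1 * y))

/-! ### Hall ratio -/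

/-- The Hall ratio `max {|V(H)| / α(H) : H ⊆ G}` of a finite graph. The maximum is over the
finitely many subgraphs of `G`, not only the induced ones; the subgraph without vertices
contributes `0 / 0 = 0`, which does not affect the maximum. -/
def hallRatio {V : Type u} (G : SimpleGraph V) : ℝ :=
  ⨆ H : G.Subgraph, (Nat.card H.verts : ℝ) / (H.coe.indepNum : ℝ)

/-- Every neighbourhood `N(u)` induces a subgraph of Hall ratio at most `ρ u`, where `ρ u ≥ 1`. -/
def HasLocalHallRatioLE {V : Type u} (G : SimpleGraph V) (ρ : V → ℝ) : Prop :=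
  ∀ u, 1 ≤ ρ u ∧ hallRatio (G.induce (G.neighborSet u)) ≤ ρ u

/-! ### The hard-core model -/

open Classical in
/-- The collection of independent sets of a finite graph (the empty set included). -/
def indepSets {V : Type u} [Fintype V] (G : SimpleGraph V) : Finset (Finset V) :=
  Finset.univ.filter fun I => G.IsIndepSet (I : Set V)

/-- The partition function `Z_G(x) = ∑ x ^ |I|`, over the independent sets `I` of `G`. -/
def partitionFunction {V : Type u} [Fintype V] (G : SimpleGraph V) (x : ℝ) : ℝ :=
  ∑ I ∈ indepSets G, x ^ I.card

/-- The probability of the independent set `I` in the hard-core model at fugacity `x`. -/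
def hardCoreProb {V : Type u} [Fintype V] (G : SimpleGraph V) (x : ℝ) (I : Finset V) : ℝ :=
  x ^ I.card / partitionFunction G x

/-- The occupancy fraction `𝔼|𝐈| / |V(G)|` of the hard-core model at fugacity `x`. -/
def occupancyFraction {V : Type u} [Fintype V] (G : SimpleGraph V) (x : ℝ) : ℝ :=
  (∑ I ∈ indepSets G, hardCoreProb G x I * (I.card : ℝ)) / (Fintype.card V : ℝ)

/-! ### Fractional colouring -/

open Classical in
/-- A fractional `k`-colouring: pairwise disjoint (possibly empty) intervals `w I ⊆ [0, k)`
assigned to the independent sets `I`, such that for each vertex the lengths of the intervals of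
the independent sets containing it add up to `1`. -/
structure IsFractionalColouring {V : Type u} [Fintype V] (G : SimpleGraph V) (k : ℝ)
    (w : Finset V → Set ℝ) : Prop where
  interval : ∀ I ∈ indepSets G, (w I).OrdConnected ∧ w I ⊆ Ico 0 k
  disjoint : ∀ I ∈ indepSets G, ∀ J ∈ indepSets G, I ≠ J → Disjoint (w I) (w J)
  total : ∀ v : V, ∑ I ∈ (indepSets G).filter (fun I => v ∈ I), volume (w I) = 1

/-- The set of colours of a vertex in a fractional colouring. -/
def colourSet {V : Type u} [Fintype V] (G : SimpleGraph V) (w : Finset V → Set ℝ) (v : V) :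
    Set ℝ :=
  {t | ∃ I ∈ indepSets G, v ∈ I ∧ t ∈ w I}

/-! ### Correspondence colouring -/

/-- A cover `(L, H)` of the graph `G`, where `H` is a graph with vertex set `W`. -/
structure Cover {V : Type u} (G : SimpleGraph V) (W : Type v) where
  /-- The graph `H`. -/
  H : SimpleGraph W
  /-- The lists `L(u)`. -/
  L : V → Finset W
  partition : ∀ x : W, ∃! u : V, x ∈ L u
  complete : ∀ u : V, ∀ x ∈ L u, ∀ y ∈ L u, x ≠ y → H.Adj x y
  edges : ∀ u v : V, ∀ x ∈ L u, ∀ y ∈ L v, H.Adj x y → u = v ∨ G.Adj u v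
  matching : ∀ u v : V, G.Adj u v →
    ∀ x ∈ L u, ∀ y ∈ L v, ∀ z ∈ L v, H.Adj x y → H.Adj x z → y = z

/-- `G` is colourable from the cover: `H` has an independent set of size `|V(G)|`. -/
def Cover.Colourable {V : Type u} [Fintype V] {G : SimpleGraph V} {W : Type v}
    (C : Cover G W) : Prop :=
  ∃ I : Finset W, C.H.IsIndepSet (I : Set W) ∧ I.card = Fintype.card V

/-- `k`-fold covers. -/
def Cover.IsFold {V : Type u} {G : SimpleGraph V} {W : Type v} (C : Cover G W) (k : ℕ) : Prop :=
  ∀ u, (C.L u).card = k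

/-- The correspondence chromatic number: the least `k` such that `G` is colourable from every
`k`-fold cover (for finite `G`, greedy colouring shows that `k = Δ(G) + 1` qualifies, and the
vertex set of a `k`-fold cover is finite, so its universe is immaterial). -/
def corrChromaticNumber {V : Type u} [Fintype V] (G : SimpleGraph V) : ℕ :=
  sInf {k : ℕ | ∀ (W : Type u) (C : Cover G W), C.IsFold k → C.Colourable}

/-! ### The bounds in the statement -/

/-- `W(k(x) Δ x / (1 + x)) / (k(x) Δ)` with `k(x) = K(ρ x / log (1 + x))`. At `x = 0` its value is
`0`, whatever `k(0)` is. -/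
def occupancyBound (ρ Δ x : ℝ) : ℝ :=
  lambertW (K (ρ * x / Real.log (1 + x)) * Δ * x / (1 + x)) /
    (K (ρ * x / Real.log (1 + x)) * Δ)

end LocalHall

end

namespace LocalHall

/-! ### The functions `W` and `K` -/

/-! Everything rests on one inequality for a graph F of Hall ratio at most ρ
(`HallOn.log_partFun_mul_le`): at fugacity x, log Z ≤ K(y)·m, where m is the expected size of the
hard-core set and y = ρx/log(1+x). Let n = |F|. Jensen's inequality gives Z_F(xe^t) ≥ Z_F(x)e^{tm};
at fugacity m/n the left side is at most e^m, so log Z ≤ m + m log(nx/m). An independent set of size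
n/ρ gives n log(1+x) ≤ ρ log Z. Hence r = log Z/m satisfies r - log r ≤ 1 + log y, and K(y) is the
largest such r.

Conditionally on the set outside the closed neighbourhood of v, what remains is a hard-core model on
v and the free part F of N(v). A linear bound Z_F ≤ b + g·`sizeSum` therefore becomes a linear
inequality between Pr(v ∈ I) and 𝔼|I ∩ N(v)| (`local_occupancy`). Summing it over v, with b and g
from a tangent line to Z log Z, gives the occupancy fraction.

For fractional colouring, weight is added to independent sets at hard-core rates on the unsaturated
vertices. The local inequality forces u to be saturated by time β(u) + γ(u)deg(u), and sets ordered
by earliest deadline meet these deadlines.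

For correspondence colouring, a hard-core set on the cover graph is a partial colouring. The local
lemma avoids two events: an uncoloured vertex keeps few available colours (an exponential moment
bound, `sum_fewColours_le`), or an available colour keeps many available neighbours (probability
1/Z_F, with Z_F large by the Hall ratio). An independent transversal then completes the colouring;
lists longer than the degree are left for a final greedy step. -/

theorem continuousOn_Ici_of_monotoneOn_of_surjOn {g : ℝ → ℝ} {a b : ℝ}
    (hm : MonotoneOn g (Ici b)) (hg : MapsTo g (Ici b) (Ici a)) (hs : SurjOn g (Ici b) (Ici a)) :
    ContinuousOn g (Ici b) := by
  rw [continuousOn_iff_continuous_domRestrict]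
  have h1 : Monotone (hg.restrict g (Ici b) (Ici a)) := fun x y hxy => hm x.2 y.2 hxy
  have h2 : Function.Surjective (hg.restrict g (Ici b) (Ici a)) := by
    rintro ⟨y, hy⟩
    obtain ⟨x, hx, rfl⟩ := hs hy
    exact ⟨⟨x, hx⟩, rfl⟩
  exact continuous_subtype_val.comp (h1.continuous_of_surjective h2)

theorem mul_exp_strictMonoOn : StrictMonoOn (fun x : ℝ => x * Real.exp x) (Ici 0) := by
  intro x hx y hy hxy
  have hx : 0 ≤ x := hx
  have := Real.exp_lt_exp.2 hxy
  have := Real.exp_pos x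
  simp only
  nlinarith

theorem lambertW_spec {y : ℝ} (hy : 0 ≤ y) :
    0 ≤ lambertW y ∧ lambertW y * Real.exp (lambertW y) = y := by
  have hex : ∃ x ∈ Ici (-1 : ℝ), (fun x : ℝ => x * Real.exp x) x = y := by
    have hc : ContinuousOn (fun x : ℝ => x * Real.exp x) (Icc 0 y) := by fun_prop
    have := intermediate_value_Icc hy hc
    have hy' : y ∈ Icc ((fun x : ℝ => x * Real.exp x) 0) ((fun x : ℝ => x * Real.exp x) y) := by
      refine ⟨by simpa using hy, ?_⟩
      have := Real.one_le_exp hy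
      simp only
      nlinarith
    obtain ⟨x, hx, hxy⟩ := this hy'
    exact ⟨x, by simp only [mem_Ici]; linarith [hx.1], hxy⟩
  have h := Function.invFunOn_eq hex
  change lambertW y * Real.exp (lambertW y) = y at h
  refine ⟨?_, h⟩
  by_contra hneg
  have := mul_neg_of_neg_of_pos (not_le.1 hneg) (Real.exp_pos (lambertW y))
  linarith

theorem lambertW_mul_exp {x : ℝ} (hx : 0 ≤ x) : lambertW (x * Real.exp x) = x := by
  obtain ⟨h1, h2⟩ := lambertW_spec (y := x * Real.exp x) (by positivity)
  exact mul_exp_strictMonoOn.injOn h1 hx h2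

theorem lambertW_zero : lambertW 0 = 0 := by
  simpa using lambertW_mul_exp le_rfl

theorem le_mul_exp_imp_lambertW_le {x y : ℝ} (hx : 0 ≤ x) (hy : 0 ≤ y)
    (h : y ≤ x * Real.exp x) : lambertW y ≤ x := by
  obtain ⟨h1, h2⟩ := lambertW_spec hy
  exact (mul_exp_strictMonoOn.le_iff_le h1 hx).1 (by simpa only [h2] using h)

theorem continuousOn_lambertW : ContinuousOn lambertW (Ici 0) := by
  refine continuousOn_Ici_of_monotoneOn_of_surjOn (a := 0) ?_ (fun y hy => (lambertW_spec hy).1) ?_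
  · intro x hx y hy hxy
    refine le_mul_exp_imp_lambertW_le (lambertW_spec hy).1 hx ?_
    rw [(lambertW_spec hy).2]
    exact hxy
  · intro x hx
    exact ⟨x * Real.exp x, mul_nonneg hx (Real.exp_pos x).le, lambertW_mul_exp hx⟩

theorem sub_log_strictMonoOn : StrictMonoOn (fun t : ℝ => t - Real.log t) (Ici 1) := by
  intro x hx y hy hxy
  have hx : 1 ≤ x := hx
  have hx0 : 0 < x := by linarith
  have h1 : 0 < y / x := div_pos (by linarith) hx0
  have h3 : y / x ≠ 1 := by
    rw [Ne, div_eq_one_iff_eq hx0.ne']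
    exact hxy.ne'
  have h2 : Real.log (y / x) < y / x - 1 := Real.log_lt_sub_one_of_pos h1 h3
  rw [Real.log_div (by linarith) hx0.ne'] at h2
  have h4 : y / x - 1 ≤ y - x := by
    rw [div_sub_one hx0.ne', div_le_iff₀ hx0]
    nlinarith
  simp only
  linarith

/-- Taking logarithms in Ke^{-K} = 1/(ey) turns the lower Lambert branch into the equation t - log t
= 1 + log y on [1, ∞), where the left side is increasing. Later facts about `K` are read off from
this form. -/
theorem K_spec {y : ℝ} (hy : 1 ≤ y) : 1 ≤ K y ∧ K y - Real.log (K y) = 1 + Real.log y := by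
  have hy0 : 0 < y := by linarith
  have hex : ∃ x ∈ Iic (-1 : ℝ),
      (fun x : ℝ => x * Real.exp x) x = -1 / (Real.exp 1 * y) := by
    -- The endpoint 4y is large enough because log y ≤ y - 1 and log 4 ≤ 2.
    have hc : ContinuousOn (fun t : ℝ => t - Real.log t) (Icc 1 (4 * y)) :=
      continuousOn_id.sub (Real.continuousOn_log.mono fun x hx => by
        have := hx.1
        simp only [mem_compl_iff, mem_singleton_iff]
        linarith)
    have hlog4 : Real.log 4 ≤ 2 := by
      have := Real.log_two_lt_d9
      rw [show (4 : ℝ) = 2 ^ 2 by norm_num, Real.log_pow]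
      push_cast
      linarith
    have hlogy := Real.log_le_sub_one_of_pos hy0
    have hy' : 1 + Real.log y ∈ Icc ((fun t : ℝ => t - Real.log t) 1)
        ((fun t : ℝ => t - Real.log t) (4 * y)) := by
      refine ⟨by simpa using Real.log_nonneg hy, ?_⟩
      simp only
      rw [Real.log_mul (by norm_num) hy0.ne']
      linarith
    obtain ⟨t, ht, hty⟩ := intermediate_value_Icc (by linarith) hc hy'
    have ht0 : 0 < t := by linarith [ht.1]
    refine ⟨-t, by simpa using ht.1, ?_⟩
    simp only at hty ⊢
    have h1 : Real.exp (-t) = (Real.exp 1 * y)⁻¹ * t⁻¹ := by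
      rw [show -t = -(1 + Real.log y) - Real.log t by linarith, Real.exp_sub, Real.exp_neg,
        Real.exp_add, Real.exp_log hy0, Real.exp_log ht0, div_eq_mul_inv]
    rw [h1]
    field_simp
  have h := Function.invFunOn_eq hex
  have hmem := Function.invFunOn_mem hex
  change lambertWLower (-1 / (Real.exp 1 * y)) * Real.exp (lambertWLower (-1 / (Real.exp 1 * y)))
    = -1 / (Real.exp 1 * y) at h
  have h1 : 1 ≤ K y := by
    have : lambertWLower (-1 / (Real.exp 1 * y)) ≤ -1 := hmem
    unfold K
    linarith
  refine ⟨h1, ?_⟩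
  have h2 : K y * Real.exp (-K y) = (Real.exp 1 * y)⁻¹ := by
    unfold K
    rw [neg_neg, neg_mul, h]
    field_simp
  have h3 := congrArg Real.log h2
  rw [Real.log_mul (by linarith) (Real.exp_pos _).ne', Real.log_exp, Real.log_inv,
    Real.log_mul (Real.exp_pos _).ne' hy0.ne', Real.log_exp] at h3
  linarith

theorem one_le_K {y : ℝ} (hy : 1 ≤ y) : 1 ≤ K y := (K_spec hy).1

theorem le_K_of_sub_log_le {y t : ℝ} (hy : 1 ≤ y) (ht : t - Real.log t ≤ 1 + Real.log y) :
    t ≤ K y := by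
  obtain ⟨h1, h2⟩ := K_spec hy
  by_cases h : 1 ≤ t
  · exact (sub_log_strictMonoOn.le_iff_le h h1).1 (by simpa only [h2] using ht)
  · linarith

theorem K_le_of_le_sub_log {y t : ℝ} (hy : 1 ≤ y) (h : 1 ≤ t)
    (ht : 1 + Real.log y ≤ t - Real.log t) : K y ≤ t := by
  obtain ⟨h1, h2⟩ := K_spec hy
  exact (sub_log_strictMonoOn.le_iff_le h1 h).1 (by simpa only [h2] using ht)

theorem K_mono {x y : ℝ} (hx : 1 ≤ x) (hxy : x ≤ y) : K x ≤ K y := by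
  refine le_K_of_sub_log_le (hx.trans hxy) ?_
  rw [(K_spec hx).2]
  gcongr

theorem continuousOn_K : ContinuousOn K (Ici 1) := by
  refine continuousOn_Ici_of_monotoneOn_of_surjOn (a := 1) (fun x hx y _ h => K_mono hx h)
    (fun y hy => one_le_K hy) ?_
  intro t ht
  have ht : 1 ≤ t := ht
  have h1 : Real.log t ≤ t - 1 := Real.log_le_sub_one_of_pos (by linarith)
  have hy : 1 ≤ Real.exp (t - Real.log t - 1) := Real.one_le_exp (by linarith)
  refine ⟨_, hy, ?_⟩
  refine sub_log_strictMonoOn.injOn (one_le_K hy) ht ?_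
  rw [(K_spec hy).2, Real.log_exp]
  ring

theorem tendsto_K_atTop : Tendsto K atTop atTop := by
  refine tendsto_atTop_mono' _ ?_ (tendsto_atTop_add_const_left _ 1 Real.tendsto_log_atTop)
  filter_upwards [eventually_ge_atTop 1] with y hy
  obtain ⟨h1, h2⟩ := K_spec hy
  linarith [Real.log_nonneg h1]

theorem K_isEquivalent_log : Asymptotics.IsEquivalent atTop K Real.log := by
  refine Asymptotics.IsEquivalent.symm ?_
  have h : (fun t : ℝ => -(1 + Real.log t)) =o[atTop] (fun t : ℝ => t) := by
    refine Asymptotics.IsLittleO.neg_left (Asymptotics.IsLittleO.add ?_ Real.isLittleO_log_id_atTop)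
    exact Asymptotics.isLittleO_const_id_atTop 1
  refine (h.comp_tendsto tendsto_K_atTop).congr' ?_ EventuallyEq.rfl
  filter_upwards [eventually_ge_atTop 1] with y hy
  have := (K_spec hy).2
  simp only [Function.comp, Pi.sub_apply]
  linarith

/-- Passing from K(y) to (1+η)K(y) raises t - log t by ηK(y) - log(1+η), which is at least η -
log(1+η) because K(y) ≥ 1. This pays for log c, uniformly in y. -/
theorem K_mul_le {c y η : ℝ} (hη : 0 ≤ η) (hc : 1 ≤ c)
    (hcη : Real.log c ≤ η - Real.log (1 + η)) (hy : 1 ≤ y) : K (c * y) ≤ (1 + η) * K y := by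
  obtain ⟨h1, h2⟩ := K_spec hy
  have hcy : 1 ≤ c * y := by nlinarith
  refine K_le_of_le_sub_log hcy (by nlinarith) ?_
  rw [Real.log_mul (by linarith) (by linarith), Real.log_mul (by linarith) (by linarith)]
  nlinarith

/-- By the equation for `K`, log K - log y = 1 - K + 2 log K, and 2 log K ≤ K. -/
theorem log_K_mul_div_le {y Δ : ℝ} (hy : 1 ≤ y) (hΔ : 0 < Δ) :
    Real.log (K y * Δ / y) ≤ Real.log Δ + 1 := by
  obtain ⟨h1, h2⟩ := K_spec hy
  rw [Real.log_div (by positivity) (by positivity), Real.log_mul (by positivity) (by positivity)]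
  have h3 : Real.log (K y / 2) ≤ K y / 2 - 1 := Real.log_le_sub_one_of_pos (by positivity)
  rw [Real.log_div (by positivity) (by norm_num)] at h3
  have := Real.log_two_lt_d9
  linarith

theorem div_log_one_add_le {x : ℝ} (hx : 0 < x) : x / Real.log (1 + x) ≤ 1 + x := by
  have h := Real.one_sub_inv_le_log_of_pos (x := 1 + x) (by linarith)
  have hl : 0 < Real.log (1 + x) := Real.log_pos (by linarith)
  rw [div_le_iff₀ hl]
  have : (1 + x) * (1 - (1 + x)⁻¹) = x := by field_simp; ring
  nlinarith

theorem one_le_div_log_one_add {x : ℝ} (hx : 0 < x) : 1 ≤ x / Real.log (1 + x) := by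
  have hl : 0 < Real.log (1 + x) := Real.log_pos (by linarith)
  rw [le_div_iff₀ hl]
  have := Real.log_le_sub_one_of_pos (x := 1 + x) (by linarith)
  linarith

/-! ### Weighted sums over independent sets -/

section HardCore

variable {X : Type*} (Γ : SimpleGraph X)

open Classical in
/-- The independent subsets of a finite set `A` of vertices. -/
noncomputable def indepIn (A : Finset X) : Finset (Finset X) :=
  A.powerset.filter fun I => Γ.IsIndepSet (I : Set X)

open Classical in
/-- The vertices of `N` without a neighbour in `J`. -/
noncomputable def free (J N : Finset X) : Finset X :=
  N.filter fun y => ∀ z ∈ J, ¬Γ.Adj y z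

/-- The partition function of the subgraph induced by `A`. -/
noncomputable def partFun (A : Finset X) (x : ℝ) : ℝ :=
  ∑ I ∈ indepIn Γ A, x ^ I.card

/-- The sum of the sizes of the independent subsets of `A`, weighted as in the hard-core model. -/
noncomputable def sizeSum (A : Finset X) (x : ℝ) : ℝ :=
  ∑ I ∈ indepIn Γ A, x ^ I.card * I.card

/-- Every subset of `N` contains an independent set with at least a `1 / ρ` fraction of its
vertices. -/
def HallOn (ρ : ℝ) (N : Finset X) : Prop :=
  ∀ S ⊆ N, ∃ I ∈ indepIn Γ S, (S.card : ℝ) ≤ ρ * I.card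

variable {Γ}

theorem mem_indepIn {A I : Finset X} :
    I ∈ indepIn Γ A ↔ I ⊆ A ∧ Γ.IsIndepSet (I : Set X) := by
  simp [indepIn]

theorem mem_free {J N : Finset X} {y : X} :
    y ∈ free Γ J N ↔ y ∈ N ∧ ∀ z ∈ J, ¬Γ.Adj y z := by
  simp [free]

theorem free_subset (J N : Finset X) : free Γ J N ⊆ N := fun _ hy => (mem_free.1 hy).1

theorem empty_mem_indepIn (A : Finset X) : ∅ ∈ indepIn Γ A := by
  simp [mem_indepIn, SimpleGraph.IsIndepSet]

theorem indepIn_mono {A B : Finset X} (h : A ⊆ B) : indepIn Γ A ⊆ indepIn Γ B := fun _ hI =>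
  mem_indepIn.2 ⟨(mem_indepIn.1 hI).1.trans h, (mem_indepIn.1 hI).2⟩

theorem HallOn.mono {ρ : ℝ} {A B : Finset X} (h : HallOn Γ ρ B) (hAB : A ⊆ B) : HallOn Γ ρ A :=
  fun S hS => h S (hS.trans hAB)

theorem HallOn.mono_right {ρ ρ' : ℝ} {A : Finset X} (h : HallOn Γ ρ A) (hρ : ρ ≤ ρ') :
    HallOn Γ ρ' A := by
  intro S hS
  obtain ⟨I, hI, h1⟩ := h S hS
  exact ⟨I, hI, h1.trans (by gcongr)⟩

theorem isIndepSet_coe_iff {I : Finset X} :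
    Γ.IsIndepSet (I : Set X) ↔ ∀ x ∈ I, ∀ y ∈ I, ¬Γ.Adj x y := by
  constructor
  · intro h x hx y hy hxy
    exact h hx hy hxy.ne hxy
  · intro h x hx y hy _
    exact h x hx y hy

/-- Splitting independent sets along `N`: first the part outside `N`, then the part inside. -/
theorem sum_indepIn_split [DecidableEq X] {A N : Finset X} (hN : N ⊆ A) (f : Finset X → ℝ) :
    ∑ I ∈ indepIn Γ A, f I =
      ∑ J ∈ indepIn Γ (A \ N), ∑ T ∈ indepIn Γ (free Γ J N), f (J ∪ T) := by
  rw [Finset.sum_sigma']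
  refine Finset.sum_bij' (fun I _ => (⟨I \ N, I ∩ N⟩ : (_ : Finset X) × Finset X))
    (fun p _ => p.1 ∪ p.2) ?_ ?_ ?_ ?_ ?_
  · intro I hI
    obtain ⟨h1, h2⟩ := mem_indepIn.1 hI
    rw [isIndepSet_coe_iff] at h2
    simp only [Finset.mem_sigma, mem_indepIn, isIndepSet_coe_iff]
    refine ⟨⟨Finset.sdiff_subset_sdiff h1 le_rfl, ?_⟩, ?_, ?_⟩
    · intro x hx y hy
      exact h2 x (Finset.mem_sdiff.1 hx).1 y (Finset.mem_sdiff.1 hy).1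
    · intro x hx
      rw [Finset.mem_inter] at hx
      exact mem_free.2 ⟨hx.2, fun z hz => h2 x hx.1 z (Finset.mem_sdiff.1 hz).1⟩
    · intro x hx y hy
      exact h2 x (Finset.mem_inter.1 hx).1 y (Finset.mem_inter.1 hy).1
  · rintro ⟨J, T⟩ hp
    simp only [Finset.mem_sigma, mem_indepIn, isIndepSet_coe_iff] at hp
    obtain ⟨⟨h1, h2⟩, h3, h4⟩ := hp
    simp only [mem_indepIn, isIndepSet_coe_iff, Finset.mem_union]
    refine ⟨Finset.union_subset (h1.trans Finset.sdiff_subset)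
      ((h3.trans (free_subset J N)).trans hN), ?_⟩
    rintro x (hx | hx) y (hy | hy)
    · exact h2 x hx y hy
    · exact fun h => (mem_free.1 (h3 hy)).2 x hx h.symm
    · exact (mem_free.1 (h3 hx)).2 y hy
    · exact h4 x hx y hy
  · intro I _
    exact Finset.sdiff_union_inter I N
  · rintro ⟨J, T⟩ hp
    simp only [Finset.mem_sigma, mem_indepIn] at hp
    obtain ⟨⟨h1, -⟩, h3, -⟩ := hp
    have hJ : ∀ x ∈ J, x ∉ N := fun x hx => (Finset.mem_sdiff.1 (h1 hx)).2
    have hT : ∀ x ∈ T, x ∈ N := fun x hx => free_subset J N (h3 hx)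
    have e1 : (J ∪ T) \ N = J := by
      ext x
      simp only [Finset.mem_sdiff, Finset.mem_union]
      grind
    have e2 : (J ∪ T) ∩ N = T := by
      ext x
      simp only [Finset.mem_inter, Finset.mem_union]
      grind
    simp only [e1, e2]
  · intro I _
    simp only [Finset.sdiff_union_inter I N]

theorem disjoint_of_mem_split [DecidableEq X] {A N J T : Finset X}
    (hJ : J ∈ indepIn Γ (A \ N)) (hT : T ∈ indepIn Γ (free Γ J N)) : Disjoint J T := by
  rw [Finset.disjoint_left]
  intro x hx hx'
  exact (Finset.mem_sdiff.1 ((mem_indepIn.1 hJ).1 hx)).2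
    (free_subset J N ((mem_indepIn.1 hT).1 hx'))

theorem one_le_partFun (A : Finset X) {x : ℝ} (hx : 0 ≤ x) : 1 ≤ partFun Γ A x := by
  have := Finset.single_le_sum (f := fun I : Finset X => x ^ I.card)
    (fun _ _ => pow_nonneg hx _) (empty_mem_indepIn (Γ := Γ) A)
  simpa [partFun] using this

theorem partFun_pos (A : Finset X) {x : ℝ} (hx : 0 ≤ x) : 0 < partFun Γ A x :=
  lt_of_lt_of_le one_pos (one_le_partFun A hx)

theorem sizeSum_nonneg (A : Finset X) {x : ℝ} (hx : 0 ≤ x) : 0 ≤ sizeSum Γ A x :=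
  Finset.sum_nonneg fun I _ => by positivity

theorem partFun_mono (A : Finset X) {x y : ℝ} (hx : 0 ≤ x) (hxy : x ≤ y) :
    partFun Γ A x ≤ partFun Γ A y := by
  unfold partFun
  gcongr

/-- Jensen's inequality for the change of fugacity. -/
theorem partFun_mul_exp_ge (A : Finset X) {x : ℝ} (hx : 0 < x) (t : ℝ) :
    partFun Γ A x * Real.exp (t * (sizeSum Γ A x / partFun Γ A x)) ≤
      partFun Γ A (x * Real.exp t) := by
  have hZ := partFun_pos (Γ := Γ) A hx.le
  set m := sizeSum Γ A x / partFun Γ A x with hm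
  have hm' : sizeSum Γ A x = m * partFun Γ A x := by rw [hm]; field_simp
  have h1 : ∀ I ∈ indepIn Γ A, x ^ I.card * (Real.exp (t * m) * (1 + (t * I.card - t * m))) ≤
      (x * Real.exp t) ^ I.card := by
    intro I _
    rw [mul_pow, ← Real.exp_nat_mul]
    refine mul_le_mul_of_nonneg_left ?_ (pow_nonneg hx.le _)
    have h2 : (I.card : ℝ) * t = t * m + (t * I.card - t * m) := by ring
    rw [h2, Real.exp_add]
    refine mul_le_mul_of_nonneg_left ?_ (Real.exp_pos _).le
    linarith [Real.add_one_le_exp (t * (I.card : ℝ) - t * m)]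
  have h3 := Finset.sum_le_sum h1
  have h4 : ∑ I ∈ indepIn Γ A, x ^ I.card * (Real.exp (t * m) * (1 + (t * I.card - t * m))) =
      Real.exp (t * m) * ((1 - t * m) * partFun Γ A x + t * sizeSum Γ A x) := by
    unfold partFun sizeSum
    rw [Finset.mul_sum, Finset.mul_sum, ← Finset.sum_add_distrib, Finset.mul_sum]
    exact Finset.sum_congr rfl fun I _ => by ring
  rw [h4, hm'] at h3
  calc _ = Real.exp (t * m) * ((1 - t * m) * partFun Γ A x + t * (m * partFun Γ A x)) := by ring
    _ ≤ _ := h3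

/-- The expected size of the hard-core model is nondecreasing in the fugacity. -/
theorem sizeSum_div_partFun_mono (A : Finset X) {x y : ℝ} (hx : 0 < x) (hxy : x ≤ y) :
    sizeSum Γ A x / partFun Γ A x ≤ sizeSum Γ A y / partFun Γ A y := by
  rcases hxy.eq_or_lt with rfl | hlt
  · exact le_rfl
  have hy : 0 < y := hx.trans hlt
  have ht : 0 < Real.log (y / x) := Real.log_pos (by rwa [one_lt_div hx])
  have e : Real.exp (Real.log (y / x)) = y / x := Real.exp_log (by positivity)
  have h1 := partFun_mul_exp_ge (Γ := Γ) A hx (Real.log (y / x))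
  have h2 := partFun_mul_exp_ge (Γ := Γ) A hy (-Real.log (y / x))
  rw [Real.exp_neg, e, inv_div, mul_div_cancel₀ _ hy.ne'] at h2
  rw [e, mul_div_cancel₀ _ hx.ne'] at h1
  have hZx := partFun_pos (Γ := Γ) A hx.le
  have hZy := partFun_pos (Γ := Γ) A hy.le
  have h3 := mul_le_mul_of_nonneg_right h2
    (Real.exp_pos (Real.log (y / x) * (sizeSum Γ A x / partFun Γ A x))).le
  have h4 := h3.trans h1
  rw [mul_assoc, ← Real.exp_add] at h4
  have h5 : Real.exp (-Real.log (y / x) * (sizeSum Γ A y / partFun Γ A y) +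
      Real.log (y / x) * (sizeSum Γ A x / partFun Γ A x)) ≤ 1 := by
    by_contra hc
    rw [not_le] at hc
    nlinarith
  rw [Real.exp_le_one_iff] at h5
  nlinarith

theorem partFun_le_exp (A : Finset X) {x : ℝ} (hx : 0 ≤ x) :
    partFun Γ A x ≤ Real.exp (x * A.card) := by
  classical
  calc partFun Γ A x ≤ ∑ I ∈ A.powerset, x ^ I.card :=
        Finset.sum_le_sum_of_subset_of_nonneg (Finset.filter_subset _ _)
          fun I _ _ => pow_nonneg hx _
    _ = (x + 1) ^ A.card := by
        have := Finset.sum_pow_mul_eq_add_pow x 1 A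
        simpa using this
    _ ≤ Real.exp x ^ A.card := by
        gcongr
        exact Real.add_one_le_exp x
    _ = _ := by rw [← Real.exp_nat_mul, mul_comm]

theorem pow_card_le_partFun {A I : Finset X} (hI : I ∈ indepIn Γ A) {x : ℝ} (hx : 0 ≤ x) :
    (1 + x) ^ I.card ≤ partFun Γ A x := by
  classical
  calc (1 + x) ^ I.card = ∑ J ∈ I.powerset, x ^ J.card := by
        have := Finset.sum_pow_mul_eq_add_pow x 1 I
        rw [add_comm]
        simpa using this.symm
    _ ≤ _ := by
        refine Finset.sum_le_sum_of_subset_of_nonneg ?_ fun I _ _ => pow_nonneg hx _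
        intro J hJ
        rw [Finset.mem_powerset] at hJ
        rw [mem_indepIn] at hI ⊢
        exact ⟨hJ.trans hI.1, hI.2.mono (by exact_mod_cast hJ)⟩

theorem HallOn.card_mul_log_le {ρ : ℝ} {A : Finset X} (h : HallOn Γ ρ A)
    (hρ : 1 ≤ ρ) {x : ℝ} (hx : 0 < x) :
    A.card * Real.log (1 + x) ≤ ρ * Real.log (partFun Γ A x) := by
  obtain ⟨I, hI, hc⟩ := h A le_rfl
  have hl : 0 < Real.log (1 + x) := Real.log_pos (by linarith)
  have h1 := Real.log_le_log (by positivity) (pow_card_le_partFun hI hx.le)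
  rw [Real.log_pow] at h1
  calc A.card * Real.log (1 + x) ≤ ρ * I.card * Real.log (1 + x) := by gcongr
    _ = ρ * (I.card * Real.log (1 + x)) := by ring
    _ ≤ _ := by gcongr

theorem partFun_empty (x : ℝ) : partFun Γ ∅ x = 1 := by
  have : indepIn Γ ∅ = {∅} := by
    ext I
    simp only [mem_indepIn, Finset.subset_empty, Finset.mem_singleton]
    exact ⟨fun h => h.1, fun h => ⟨h, by simp [h, SimpleGraph.IsIndepSet]⟩⟩
  simp [partFun, this]

theorem sizeSum_pos {A : Finset X} (hA : A.Nonempty) {x : ℝ} (hx : 0 < x) :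
    0 < sizeSum Γ A x := by
  obtain ⟨a, ha⟩ := hA
  have hmem : {a} ∈ indepIn Γ A := by
    rw [mem_indepIn, isIndepSet_coe_iff]
    simpa using ha
  have := Finset.single_le_sum (f := fun I : Finset X => x ^ I.card * (I.card : ℝ))
    (fun I _ => by positivity) hmem
  simp only [Finset.card_singleton, pow_one, Nat.cast_one, mul_one] at this
  exact lt_of_lt_of_le hx this

/-- In a graph of Hall ratio at most `ρ`, the expected size of the hard-core model is at least the
logarithm of the partition function divided by `K`. -/
theorem HallOn.log_partFun_mul_le {ρ y : ℝ} {A : Finset X} (h : HallOn Γ ρ A)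
    (hρ : 1 ≤ ρ) {x : ℝ} (hx : 0 < x) (hy : ρ * x / Real.log (1 + x) ≤ y) :
    Real.log (partFun Γ A x) * partFun Γ A x ≤ K y * sizeSum Γ A x := by
  rcases A.eq_empty_or_nonempty with rfl | hA
  · have h1 := sizeSum_nonneg (Γ := Γ) ∅ hx.le
    rw [partFun_empty]
    have hy1 : 1 ≤ y := by
      refine le_trans ?_ hy
      rw [mul_div_assoc]
      have := one_le_div_log_one_add hx
      nlinarith
    have := one_le_K hy1
    simp only [Real.log_one, zero_mul]
    positivity
  have hl : 0 < Real.log (1 + x) := Real.log_pos (by linarith)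
  have hZ := partFun_pos (Γ := Γ) A hx.le
  set Z := partFun Γ A x with hZdef
  set s := sizeSum Γ A x / Z with hs
  have hs0 : 0 < s := div_pos (sizeSum_pos hA hx) hZ
  have hn : (0 : ℝ) < A.card := by exact_mod_cast hA.card_pos
  have hμ : 0 < s / A.card := div_pos hs0 hn
  have hy1 : 1 ≤ ρ * x / Real.log (1 + x) := by
    rw [mul_div_assoc]
    have := one_le_div_log_one_add hx
    nlinarith
  -- The fugacity is moved from x to the density s/|A|, at which the partition function is at most
  -- e^s.
  have hJ := partFun_mul_exp_ge (Γ := Γ) A hx (Real.log (s / A.card / x))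
  rw [Real.exp_log (by positivity), mul_div_cancel₀ _ hx.ne'] at hJ
  have hJ2 := hJ.trans (partFun_le_exp A hμ.le)
  rw [div_mul_cancel₀ _ hn.ne'] at hJ2
  have hJ3 := Real.log_le_log (by positivity) hJ2
  rw [Real.log_exp, Real.log_mul hZ.ne' (Real.exp_pos _).ne', Real.log_exp] at hJ3
  have hcard := h.card_mul_log_le hρ hx
  set L := Real.log Z with hL
  have hLpos : 0 < L := by
    by_contra hneg
    have : 0 < A.card * Real.log (1 + x) := by positivity
    nlinarith
  -- The ratio r = L/s satisfies r ≤ 1 + log(x|A|/s), and the Hall bound x|A| ≤ yL turns this into r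
  -- - log r ≤ 1 + log y.
  have key : L / s ≤ K y := by
    have hyy : 1 ≤ y := hy1.trans hy
    refine le_K_of_sub_log_le hyy ?_
    have h1 : L / s ≤ 1 - Real.log (s / A.card / x) := by
      rw [div_le_iff₀ hs0]
      change L + Real.log (s / A.card / x) * s ≤ s at hJ3
      linarith
    have h2 : x * A.card ≤ y * L := by
      have : ρ * x / Real.log (1 + x) * L ≤ y * L := by gcongr
      refine le_trans ?_ this
      rw [div_mul_eq_mul_div, le_div_iff₀ hl]
      nlinarith
    have h3 : -Real.log (s / A.card / x) ≤ Real.log (y * (L / s)) := by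
      rw [← Real.log_inv]
      refine Real.log_le_log (by positivity) ?_
      rw [div_div, inv_div, ← mul_div_assoc]
      exact div_le_div_of_nonneg_right (by linarith) hs0.le
    rw [Real.log_mul (by linarith) (by positivity)] at h3
    linarith
  rw [div_le_iff₀ hs0, hs] at key
  calc L * Z ≤ K y * (sizeSum Γ A x / Z) * Z := by gcongr
    _ = _ := by field_simp

end HardCore

/-! ### Local occupancy and the occupancy fraction -/

/-- A maximum independent set of the subgraph induced by `S` is the witness. `HallOn` passes to
subsets, which is what conditioning requires. -/
theorem hallOn_of_hallRatio_le {V : Type*} [Finite V] {G : SimpleGraph V} {s : Set V} {ρ : ℝ}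
    (h : hallRatio (G.induce s) ≤ ρ) {N : Finset V} (hN : (N : Set V) ⊆ s) : HallOn G ρ N := by
  classical
  intro S hS
  rcases S.eq_empty_or_nonempty with rfl | ⟨a, ha⟩
  · exact ⟨∅, empty_mem_indepIn _, by simp⟩
  let H : (G.induce s).Subgraph := (⊤ : (G.induce s).Subgraph).induce {x | x.1 ∈ S}
  have hsub : ∀ x ∈ S, x ∈ s := fun x hx => hN (hS hx)
  have hcard : Nat.card H.verts = S.card := by
    rw [← Nat.card_eq_finsetCard S]
    refine Nat.card_congr ⟨fun x => ⟨x.1.1, x.2⟩, fun x => ⟨⟨x.1, hsub x.1 x.2⟩, x.2⟩, ?_, ?_⟩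
    · intro x; rfl
    · intro x; rfl
  have hle : (Nat.card H.verts : ℝ) / (H.coe.indepNum : ℝ) ≤ ρ :=
    (le_ciSup (f := fun H : (G.induce s).Subgraph =>
      (Nat.card H.verts : ℝ) / (H.coe.indepNum : ℝ)) (Set.finite_range _).bddAbove H).trans h
  have hpos : 0 < H.coe.indepNum := by
    have h1 : H.coe.IsIndepSet (({⟨⟨a, hsub a ha⟩, ha⟩} : Finset H.verts) : Set H.verts) := by
      simp [SimpleGraph.IsIndepSet]
    have := h1.card_le_indepNum
    rwa [Finset.card_singleton] at this
  obtain ⟨t, ht⟩ := H.coe.exists_isNIndepSet_indepNum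
  have hinj : Function.Injective (fun x : H.verts => x.1.1) := fun x y hxy =>
    Subtype.ext (Subtype.ext hxy)
  refine ⟨t.map ⟨_, hinj⟩, ?_, ?_⟩
  · rw [mem_indepIn, isIndepSet_coe_iff]
    refine ⟨?_, ?_⟩
    · intro x hx
      obtain ⟨y, -, rfl⟩ := Finset.mem_map.1 hx
      exact y.2
    · intro x hx y hy hxy
      obtain ⟨x, hx', rfl⟩ := Finset.mem_map.1 hx
      obtain ⟨y, hy', rfl⟩ := Finset.mem_map.1 hy
      refine (isIndepSet_coe_iff.1 ht.isIndepSet) x hx' y hy' ?_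
      exact ⟨x.2, y.2, hxy⟩
  · rw [Finset.card_map, ht.card_eq, ← hcard]
    rwa [div_le_iff₀ (by exact_mod_cast hpos)] at hle

section Local

variable {X : Type*} {Γ : SimpleGraph X}

theorem indepIn_singleton [DecidableEq X] (v : X) : indepIn Γ {v} = {∅, {v}} := by
  ext I
  simp only [mem_indepIn, Finset.mem_insert, Finset.mem_singleton, Finset.subset_singleton_iff,
    and_iff_left_iff_imp]
  rintro (rfl | rfl) <;> simp [SimpleGraph.IsIndepSet]

theorem indepIn_empty : indepIn Γ ∅ = {∅} := by
  ext I
  simp only [mem_indepIn, Finset.subset_empty, Finset.mem_singleton, and_iff_left_iff_imp]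
  rintro rfl
  simp [SimpleGraph.IsIndepSet]

/-- Local occupancy: a bound for the partition functions of the subgraphs of the neighbourhood of
`v` gives a linear inequality between the probability of `v` and the expected number of neighbours
of `v` in the hard-core model. -/
theorem local_occupancy [DecidableEq X] {A N : Finset X} {v : X} (hv : v ∈ A)
    (hN : ∀ y, y ∈ N ↔ y ∈ A ∧ Γ.Adj v y) {x b g : ℝ} (hx : 0 < x)
    (h : ∀ F ⊆ N, partFun Γ F x ≤ b + g * sizeSum Γ F x) :
    partFun Γ A x ≤ ∑ I ∈ indepIn Γ A,
      x ^ I.card * (b * (1 + x) / x * (if v ∈ I then 1 else 0) + g * (I ∩ N).card) := by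
  have hb : 1 ≤ b := by
    have := h ∅ (Finset.empty_subset _)
    simpa [partFun, sizeSum, indepIn_empty] using this
  have hvN : v ∉ N := fun hv' => ((hN v).1 hv').2.ne rfl
  set f : Finset X → ℝ := fun I =>
    x ^ I.card * (b * (1 + x) / x * (if v ∈ I then 1 else 0) + g * (I ∩ N).card) - x ^ I.card
    with hf
  suffices hs : 0 ≤ ∑ I ∈ indepIn Γ A, f I by
    rw [hf, Finset.sum_sub_distrib] at hs
    unfold partFun
    linarith
  -- Independent sets are grouped by their trace J outside N ∪ {v}. For fixed J the remaining
  -- choices are v alone, which blocks all of N, or an independent set T in the free part F of N.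
  -- The claim for J becomes Z_F ≤ b(1+x) - x + g·`sizeSum`, which follows from `h` because b ≥ 1.
  rw [sum_indepIn_split (N := N) (fun y hy => ((hN y).1 hy).1),
    sum_indepIn_split (N := {v}) (Finset.singleton_subset_iff.2 (Finset.mem_sdiff.2 ⟨hv, hvN⟩))]
  refine Finset.sum_nonneg fun J hJ => ?_
  obtain ⟨hJ1, hJ2⟩ := mem_indepIn.1 hJ
  have hJv : v ∉ J := fun hv' => by
    have := hJ1 hv'
    simp at this
  have hJA : ∀ z ∈ J, z ∈ A ∧ z ∉ N := fun z hz => by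
    have := hJ1 hz
    simp only [Finset.mem_sdiff] at this
    exact this.1
  have hfree : free Γ J {v} = {v} := by
    ext y
    simp only [mem_free, Finset.mem_singleton, and_iff_left_iff_imp]
    rintro rfl z hz hadj
    exact (hJA z hz).2 ((hN z).2 ⟨(hJA z hz).1, hadj⟩)
  have hfree2 : free Γ (J ∪ {v}) N = ∅ := by
    rw [Finset.eq_empty_iff_forall_notMem]
    intro y hy
    obtain ⟨h1, h2⟩ := mem_free.1 hy
    exact h2 v (by simp) ((hN y).1 h1).2.symm
  rw [hfree, indepIn_singleton, Finset.sum_pair (Finset.singleton_ne_empty v).symm, hfree2,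
    indepIn_empty, Finset.sum_singleton, Finset.union_empty, Finset.union_empty]
  have hJN : ∀ T : Finset X, T ⊆ N → (J ∪ T) ∩ N = T := fun T hT => by
    ext z
    simp only [Finset.mem_inter, Finset.mem_union]
    constructor
    · rintro ⟨h1 | h1, h2⟩
      · exact absurd h2 (hJA z h1).2
      · exact h1
    · exact fun h1 => ⟨Or.inr h1, hT h1⟩
  have e1 : f (J ∪ {v}) = x ^ J.card * (b * (1 + x) - x) := by
    have h1 : (J ∪ {v}) ∩ N = ∅ := by
      rw [Finset.eq_empty_iff_forall_notMem]
      intro z hz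
      simp only [Finset.mem_inter, Finset.mem_union, Finset.mem_singleton] at hz
      rcases hz with ⟨h1 | rfl, h2⟩
      · exact (hJA z h1).2 h2
      · exact hvN h2
    have h2 : (J ∪ {v}).card = J.card + 1 := by
      rw [Finset.card_union_of_disjoint (by simpa using hJv), Finset.card_singleton]
    simp only [hf, h1, h2, pow_succ]
    simp
    field_simp
  have e2 : ∀ T ∈ indepIn Γ (free Γ J N),
      f (J ∪ T) = x ^ J.card * (g * (x ^ T.card * T.card) - x ^ T.card) := by
    intro T hT
    obtain ⟨hT1, -⟩ := mem_indepIn.1 hT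
    have hTN : T ⊆ N := hT1.trans (free_subset J N)
    have hd : Disjoint J T := by
      rw [Finset.disjoint_left]
      exact fun z hz hz' => (hJA z hz).2 (hTN hz')
    have hv' : v ∉ J ∪ T := by
      rw [Finset.mem_union, not_or]
      exact ⟨hJv, fun h => hvN (hTN h)⟩
    simp only [hf, hJN T hTN, Finset.card_union_of_disjoint hd, pow_add, if_neg hv']
    ring
  rw [Finset.sum_congr rfl e2, e1, ← Finset.mul_sum, ← mul_add]
  refine mul_nonneg (by positivity) ?_
  rw [Finset.sum_sub_distrib, ← Finset.mul_sum]
  have h3 := h (free Γ J N) (free_subset J N)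
  unfold partFun sizeSum at h3
  nlinarith

end Local

section Occupancy

variable {V : Type u} [Fintype V] {G : SimpleGraph V}

theorem indepSets_eq : indepSets G = indepIn G Finset.univ := by
  ext I
  simp [indepSets, mem_indepIn]

theorem partitionFunction_eq (x : ℝ) : partitionFunction G x = partFun G Finset.univ x := by
  simp [partitionFunction, partFun, indepSets_eq]

theorem occupancyFraction_eq (x : ℝ) :
    occupancyFraction G x =
      sizeSum G Finset.univ x / partFun G Finset.univ x / (Fintype.card V : ℝ) := by
  unfold occupancyFraction hardCoreProb
  congr 1
  rw [indepSets_eq, partitionFunction_eq]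
  unfold sizeSum
  rw [Finset.sum_div]
  exact Finset.sum_congr rfl fun I _ => by ring

theorem mul_deriv_partitionFunction (x : ℝ) :
    x * deriv (partitionFunction G) x = sizeSum G Finset.univ x := by
  have h : HasDerivAt (partitionFunction G)
      (∑ I ∈ indepSets G, (I.card : ℝ) * x ^ (I.card - 1)) x := by
    unfold partitionFunction
    exact HasDerivAt.fun_sum fun I _ => hasDerivAt_pow _ _
  rw [h.deriv, indepSets_eq, sizeSum, Finset.mul_sum]
  refine Finset.sum_congr rfl fun I _ => ?_
  rcases Nat.eq_zero_or_pos I.card with h0 | h0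
  · simp [h0]
  · obtain ⟨m, hm⟩ := Nat.exists_eq_succ_of_ne_zero h0.ne'
    rw [hm, Nat.succ_sub_one, pow_succ]
    ring

theorem sum_card_inter_neighborFinset_le [DecidableEq V] [DecidableRel G.Adj] (I : Finset V) :
    ∑ v : V, (I ∩ G.neighborFinset v).card ≤ G.maxDegree * I.card := by
  calc ∑ v : V, (I ∩ G.neighborFinset v).card
      = ∑ v : V, ∑ i ∈ I, if G.Adj v i then 1 else 0 := by
        refine Finset.sum_congr rfl fun v _ => ?_
        rw [Finset.sum_boole, Nat.cast_id]
        congr 1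
        ext y
        simp
    _ = ∑ i ∈ I, G.degree i := by
        rw [Finset.sum_comm]
        refine Finset.sum_congr rfl fun i _ => ?_
        rw [Finset.sum_boole, Nat.cast_id, ← SimpleGraph.card_neighborFinset_eq_degree]
        congr 1
        ext y
        simp [G.adj_comm]
    _ ≤ ∑ _i ∈ I, G.maxDegree := Finset.sum_le_sum fun i _ => G.degree_le_maxDegree i
    _ = _ := by simp [mul_comm]

/-- Sum `local_occupancy` over all v: an element i of I is counted deg(i) ≤ Δ times as a neighbour.
-/
theorem card_mul_partFun_le [DecidableRel G.Adj] {x b g : ℝ} (hx : 0 < x) (hg : 0 ≤ g)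
    (h : ∀ v, ∀ F ⊆ G.neighborFinset v, partFun G F x ≤ b + g * sizeSum G F x) :
    (Fintype.card V : ℝ) * partFun G Finset.univ x ≤
      (b * (1 + x) / x + g * G.maxDegree) * sizeSum G Finset.univ x := by
  classical
  have h1 : ∀ v : V, partFun G Finset.univ x ≤ _ := fun v =>
    local_occupancy (N := G.neighborFinset v) (Finset.mem_univ v) (by simp) hx (h v)
  have h2 := Finset.sum_le_sum fun v (_ : v ∈ Finset.univ) => h1 v
  rw [Finset.sum_const, Finset.card_univ, nsmul_eq_mul, Finset.sum_comm] at h2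
  refine h2.trans ?_
  unfold sizeSum
  rw [Finset.mul_sum]
  refine Finset.sum_le_sum fun I _ => ?_
  rw [← Finset.mul_sum, Finset.sum_add_distrib, ← Finset.mul_sum, ← Finset.mul_sum,
    Finset.sum_boole]
  have h3 : ((∑ v : V, (I ∩ G.neighborFinset v).card : ℕ) : ℝ) ≤ G.maxDegree * I.card := by
    exact_mod_cast sum_card_inter_neighborFinset_le I
  have h4 : (Finset.univ.filter fun v => v ∈ I) = I := by ext; simp
  rw [h4]
  push_cast at h3
  calc _ ≤ x ^ I.card * (b * (1 + x) / x * I.card + g * (G.maxDegree * I.card)) := by gcongr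
    _ = _ := by ring

theorem occupancyBound_zero (ρ Δ : ℝ) : occupancyBound ρ Δ 0 = 0 := by
  simp [occupancyBound, lambertW_zero]

theorem one_le_mul_div_log {ρ x : ℝ} (hρ : 1 ≤ ρ) (hx : 0 < x) :
    1 ≤ ρ * x / Real.log (1 + x) := by
  rw [mul_div_assoc]
  have := one_le_div_log_one_add hx
  nlinarith

theorem occupancyBound_le [Nonempty V] [DecidableRel G.Adj] {ρ : ℝ} (hρ : 1 ≤ ρ)
    (h : ∀ v, HallOn G ρ (G.neighborFinset v)) (hΔ : 1 ≤ G.maxDegree) {x : ℝ} (hx : 0 < x) :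
    occupancyBound ρ G.maxDegree x ≤ occupancyFraction G x := by
  have hΔ' : (1 : ℝ) ≤ G.maxDegree := by exact_mod_cast hΔ
  rw [occupancyFraction_eq, occupancyBound]
  set k := K (ρ * x / Real.log (1 + x)) with hk
  have hk1 : 1 ≤ k := one_le_K (one_le_mul_div_log hρ hx)
  have hpos : 0 < k * G.maxDegree * x / (1 + x) := by positivity
  obtain ⟨hw, hwe⟩ := lambertW_spec hpos.le
  set w := lambertW (k * G.maxDegree * x / (1 + x)) with hw'
  have hw0 : 0 < w := by
    rcases hw.eq_or_lt with h0 | h0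
    · rw [← h0, zero_mul] at hwe
      linarith
    · exact h0
  have hloc : ∀ v, ∀ F ⊆ G.neighborFinset v,
      partFun G F x ≤ Real.exp w / (1 + w) + k / (1 + w) * sizeSum G F x := by
    intro v F hF
    have h1 := ((h v).mono hF).log_partFun_mul_le hρ hx le_rfl
    rw [← hk] at h1
    have hZ := partFun_pos (Γ := G) F hx.le
    -- Z log Z lies above its tangent at Z = e^w.
    have h2 : partFun G F x * (1 + w - Real.log (partFun G F x)) ≤ Real.exp w := by
      have h3 := Real.add_one_le_exp (w - Real.log (partFun G F x))
      rw [Real.exp_sub, Real.exp_log hZ, le_div_iff₀ hZ] at h3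
      linarith
    rw [← mul_div_right_comm, ← add_div, le_div_iff₀ (by positivity)]
    linarith
  have hmain := card_mul_partFun_le hx (by positivity : 0 ≤ k / (1 + w)) hloc
  have hn : (0 : ℝ) < Fintype.card V := by exact_mod_cast Fintype.card_pos
  have hZ := partFun_pos (Γ := G) Finset.univ hx.le
  -- The equation we^w = kΔx/(1+x) is what makes the two terms add up to kΔ/w.
  have e : Real.exp w / (1 + w) * (1 + x) / x + k / (1 + w) * G.maxDegree =
      k * G.maxDegree / w := by
    have : Real.exp w = k * G.maxDegree * x / (1 + x) / w := by
      rw [← hwe]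
      field_simp
    rw [this]
    field_simp
  rw [e, div_mul_eq_mul_div, le_div_iff₀ hw0] at hmain
  rw [div_div, div_le_div_iff₀ (by positivity) (by positivity)]
  linarith

theorem continuousOn_occupancyBound {ρ Δ lam : ℝ} (hρ : 1 ≤ ρ) (hΔ : 1 ≤ Δ) :
    ContinuousOn (occupancyBound ρ Δ) (Icc 0 lam) := by
  -- The difference quotient of log at 1 fills the removable singularity of ρx/log(1+x) at 0 with
  -- the value ρ.
  set q : ℝ → ℝ := fun x => ρ / dslope Real.log 1 (1 + x) with hq
  have hval : ∀ x : ℝ, 0 < x → q x = ρ * x / Real.log (1 + x) := by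
    intro x hx
    have hl : 0 < Real.log (1 + x) := Real.log_pos (by linarith)
    rw [hq]
    simp only
    rw [dslope_of_ne _ (by linarith : (1 + x : ℝ) ≠ 1), slope_def_field, Real.log_one, sub_zero]
    simp only [add_sub_cancel_left]
    field_simp
  have hds0 : dslope Real.log 1 (1 + 0) = 1 := by
    rw [add_zero, dslope_same]
    simp
  have hq0 : q 0 = ρ := by
    simp only [hq, hds0, div_one]
  have hq1 : ∀ x ∈ Icc 0 lam, 1 ≤ q x := by
    intro x hx
    rcases hx.1.eq_or_lt with rfl | h0
    · rw [hq0]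
      exact hρ
    · rw [hval x h0]
      exact one_le_mul_div_log hρ h0
  have hqc : ContinuousOn q (Icc 0 lam) := by
    have h1 : ContinuousOn (dslope Real.log 1) (Ioi 0) :=
      (continuousOn_dslope (Ioi_mem_nhds one_pos)).2
        ⟨Real.continuousOn_log.mono fun x hx => ne_of_gt hx, Real.differentiableAt_log one_ne_zero⟩
    have h2 : ContinuousOn (fun x : ℝ => dslope Real.log 1 (1 + x)) (Icc 0 lam) :=
      h1.comp (by fun_prop) fun x hx => by
        have := hx.1
        simp only [mem_Ioi]
        linarith
    refine continuousOn_const.div h2 ?_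
    intro x hx h0
    have := hq1 x hx
    simp only [hq, h0, div_zero] at this
    linarith
  have hKc : ContinuousOn (fun x => K (q x)) (Icc 0 lam) := continuousOn_K.comp hqc hq1
  have hK1 : ∀ x ∈ Icc 0 lam, 1 ≤ K (q x) := fun x hx => one_le_K (hq1 x hx)
  have hc : ContinuousOn (fun x => lambertW (K (q x) * Δ * x / (1 + x)) / (K (q x) * Δ))
      (Icc 0 lam) := by
    refine ContinuousOn.div (continuousOn_lambertW.comp ?_ ?_) (hKc.mul continuousOn_const) ?_
    · refine ContinuousOn.div ((hKc.mul continuousOn_const).mul continuousOn_id) (by fun_prop) ?_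
      intro x hx
      linarith [hx.1]
    · intro x hx
      have h1 := hK1 x hx
      have h2 := hx.1
      simp only [mem_Ici]
      positivity
    · intro x hx
      have h1 := hK1 x hx
      positivity
  refine hc.congr ?_
  intro x hx
  rcases hx.1.eq_or_lt with rfl | h0
  · simp [occupancyBound_zero, lambertW_zero]
  · simp only [occupancyBound, hval x h0]

theorem HasLocalHallRatioLE.hallOn {ρu : V → ℝ} [DecidableRel G.Adj]
    (h : HasLocalHallRatioLE G ρu) (v : V) : HallOn G (ρu v) (G.neighborFinset v) :=
  hallOn_of_hallRatio_le (h v).2 (by simp)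

theorem occupancyFraction_bound [DecidableRel G.Adj] (ρu : V → ℝ) (ρ : ℝ)
    (h : HasLocalHallRatioLE G ρu) (hρ : IsGreatest (range ρu) ρ) (hΔ : 1 ≤ G.maxDegree)
    (lam : ℝ) (hlam : 0 < lam) :
    occupancyFraction G lam = 1 / (Fintype.card V : ℝ) *
        (lam * deriv (partitionFunction G) lam / partitionFunction G lam) ∧
      ∃ m : ℝ, IsGreatest (occupancyBound ρ (G.maxDegree : ℝ) '' Icc 0 lam) m ∧
        m ≤ occupancyFraction G lam := by
  obtain ⟨u, hu⟩ := hρ.1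
  have : Nonempty V := ⟨u⟩
  have hρ1 : 1 ≤ ρ := hu ▸ (h u).1
  have hHall : ∀ v, HallOn G ρ (G.neighborFinset v) := fun v =>
    (h.hallOn v).mono_right (hρ.2 ⟨v, rfl⟩)
  refine ⟨?_, ?_⟩
  · rw [occupancyFraction_eq, mul_deriv_partitionFunction, partitionFunction_eq]
    ring
  have hcont := continuousOn_occupancyBound (lam := lam) hρ1
    (by exact_mod_cast hΔ : (1 : ℝ) ≤ G.maxDegree)
  obtain ⟨x, hx, hmax⟩ := isCompact_Icc.exists_isMaxOn (nonempty_Icc.2 hlam.le) hcont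
  refine ⟨_, ⟨⟨x, hx, rfl⟩, ?_⟩, ?_⟩
  · rintro _ ⟨y, hy, rfl⟩
    exact hmax hy
  · rcases hx.1.eq_or_lt with rfl | h0
    · rw [occupancyBound_zero, occupancyFraction_eq]
      have := sizeSum_nonneg (Γ := G) Finset.univ hlam.le
      have := partFun_pos (Γ := G) Finset.univ hlam.le
      positivity
    · refine (occupancyBound_le hρ1 hHall hΔ h0).trans ?_
      rw [occupancyFraction_eq, occupancyFraction_eq]
      exact div_le_div_of_nonneg_right (sizeSum_div_partFun_mono _ h0 hx.2) (by positivity)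

end Occupancy

/-! ### Fractional colouring -/

/-- For every `ε` there are a fugacity `lam` and a loss `η` at which `K` is hardly changed. -/
theorem exists_fugacity {ε : ℝ} (hε : 0 < ε) : ∃ η lam : ℝ, 0 < η ∧ η < 1 / 2 ∧ 0 < lam ∧
    1 + η ≤ (1 + ε / 2) * (1 - η) ^ 2 ∧
    ∀ ρ : ℝ, 1 ≤ ρ → K ((1 + lam) * ρ) ≤ (1 + η) * K ρ := by
  have hη : 0 < ε / (6 + 2 * ε) := by positivity
  -- With this η, ε/2 = 3η + εη, so (1-η)² ≥ 1 - 2η suffices for the required inequality. The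
  -- fugacity below has log(1+lam) = η - log(1+η), the most that `K_mul_le` allows.
  set η := ε / (6 + 2 * ε) with hηdef
  have hη2 : η * (6 + 2 * ε) = ε := by rw [hηdef]; field_simp
  have hlog : Real.log (1 + η) < η := by
    have := Real.log_lt_sub_one_of_pos (x := 1 + η) (by positivity) (by linarith)
    linarith
  have hlam : 1 < Real.exp (η - Real.log (1 + η)) := Real.one_lt_exp_iff.2 (by linarith)
  refine ⟨η, Real.exp (η - Real.log (1 + η)) - 1, hη, ?_, by linarith,
    by nlinarith [mul_nonneg hε.le (sq_nonneg η), sq_nonneg η], ?_⟩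
  · rw [hηdef, div_lt_iff₀ (by positivity)]
    linarith
  · intro ρ hρ
    refine K_mul_le hη.le (by linarith) ?_ hρ
    rw [add_sub_cancel, Real.log_exp]

/-- Since x/log(1+x) ≤ 1 + x, one value of `K` serves all fugacities up to `lam`. This matters where
the fugacity itself is varied. -/
theorem HallOn.log_partFun_mul_le_of_fugacity {X : Type*} {Γ : SimpleGraph X} {ρ : ℝ}
    {A : Finset X} (h : HallOn Γ ρ A) (hρ : 1 ≤ ρ) {x lam : ℝ} (hx : 0 < x) (hxl : x ≤ lam) :
    Real.log (partFun Γ A x) * partFun Γ A x ≤ K ((1 + lam) * ρ) * sizeSum Γ A x := by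
  refine h.log_partFun_mul_le hρ hx ?_
  rw [mul_div_assoc]
  have := div_log_one_add_le hx
  nlinarith

section Fractional

variable {V : Type u} [Fintype V] {G : SimpleGraph V}

open Classical in
/-- Given weights on the independent sets such that those with an early deadline have a small total
weight, the independent sets can be assigned disjoint intervals that meet their deadlines. -/
theorem exists_isFractionalColouring_of_weights (b : V → ℝ) (w : Finset V → ℝ)
    (hw : ∀ I, 0 ≤ w I) (h1 : ∀ v, ∑ I ∈ indepSets G, (if v ∈ I then w I else 0) = 1)
    (h2 : ∀ v, ∑ I ∈ indepSets G, (if ∃ u ∈ I, b u ≤ b v then w I else 0) ≤ b v) :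
    ∃ (k : ℝ) (c : Finset V → Set ℝ), IsFractionalColouring G k c ∧
      ∀ u, colourSet G c u ⊆ Ico 0 (b u) := by
  -- Earliest deadline first: nonempty sets are laid end to end by their smallest `b`, ties being
  -- broken by an enumeration. If I attains its minimum at v₀, every set placed up to and including
  -- I contains some u with b u ≤ b v₀, so `h2` at v₀ bounds the end of the interval of I.
  let dl : Finset V → ℝ := fun I => if h : I.Nonempty then I.inf' h b else 0
  have hdl : ∀ (I : Finset V) (h : I.Nonempty), dl I = I.inf' h b := fun I h => dif_pos h
  let key : Finset V → ℝ ×ₗ Fin (Fintype.card (Finset V)) := fun I =>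
    toLex (dl I, Fintype.equivFin _ I)
  have hkey : Function.Injective key := fun I J h => by
    have := congrArg (fun p => (ofLex p).2) h
    exact (Fintype.equivFin (Finset V)).injective this
  let S : Finset (Finset V) := (indepSets G).filter fun I => I.Nonempty
  let st : Finset V → ℝ := fun I => ∑ J ∈ S.filter (fun J => key J < key I), w J
  have hst0 : ∀ I, 0 ≤ st I := fun I => Finset.sum_nonneg fun J _ => hw J
  have hle : ∀ I ∈ S, ∀ J, key I < key J → st I + w I ≤ st J := by
    intro I hI J hIJ
    have hnot : I ∉ S.filter (fun J => key J < key I) := by simp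
    have : st I + w I = ∑ J ∈ insert I (S.filter (fun J => key J < key I)), w J := by
      rw [Finset.sum_insert hnot, add_comm]
    rw [this]
    refine Finset.sum_le_sum_of_subset_of_nonneg ?_ fun J _ _ => hw J
    intro J' hJ'
    rw [Finset.mem_insert, Finset.mem_filter] at hJ'
    rw [Finset.mem_filter]
    rcases hJ' with rfl | ⟨h3, h4⟩
    · exact ⟨hI, hIJ⟩
    · exact ⟨h3, h4.trans hIJ⟩
  have hend : ∀ I ∈ S, ∀ v ∈ I, st I + w I ≤ b v := by
    intro I hI v hv
    have hne : I.Nonempty := ⟨v, hv⟩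
    obtain ⟨v₀, hv₀, hmin⟩ := Finset.exists_mem_eq_inf' hne b
    have hb : b v₀ ≤ b v := by
      rw [← hmin]
      exact Finset.inf'_le _ hv
    refine le_trans ?_ ((h2 v₀).trans hb)
    have hnot : I ∉ S.filter (fun J => key J < key I) := by simp
    have : st I + w I = ∑ J ∈ insert I (S.filter (fun J => key J < key I)), w J := by
      rw [Finset.sum_insert hnot, add_comm]
    rw [this, ← Finset.sum_filter]
    refine Finset.sum_le_sum_of_subset_of_nonneg ?_ fun J _ _ => hw J
    intro J hJ
    rw [Finset.mem_insert, Finset.mem_filter] at hJ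
    rw [Finset.mem_filter]
    rcases hJ with rfl | ⟨h3, h4⟩
    · exact ⟨(Finset.mem_filter.1 hI).1, v₀, hv₀, le_rfl⟩
    · obtain ⟨h5, h6⟩ := Finset.mem_filter.1 h3
      have h7 : dl J ≤ dl I := (Prod.Lex.le_iff'.1 h4.le).1
      rw [hdl J h6, hdl I hne, hmin] at h7
      obtain ⟨u, hu, hu'⟩ := Finset.exists_mem_eq_inf' h6 b
      exact ⟨h5, u, hu, hu' ▸ h7⟩
  let c : Finset V → Set ℝ := fun I => if I.Nonempty then Ico (st I) (st I + w I) else ∅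
  have hc : ∀ I, I.Nonempty → c I = Ico (st I) (st I + w I) := fun I h => if_pos h
  have hc' : ∀ I, ¬I.Nonempty → c I = ∅ := fun I h => if_neg h
  refine ⟨∑ J ∈ indepSets G, w J, c, ⟨?_, ?_, ?_⟩, ?_⟩
  · intro I hI
    by_cases hne : I.Nonempty
    · rw [hc I hne]
      refine ⟨ordConnected_Ico, Ico_subset_Ico (hst0 I) ?_⟩
      have hnot : I ∉ S.filter (fun J => key J < key I) := by simp
      have : st I + w I = ∑ J ∈ insert I (S.filter (fun J => key J < key I)), w J := by
        rw [Finset.sum_insert hnot, add_comm]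
      rw [this]
      refine Finset.sum_le_sum_of_subset_of_nonneg ?_ fun J _ _ => hw J
      intro J hJ
      rw [Finset.mem_insert, Finset.mem_filter] at hJ
      rcases hJ with rfl | ⟨h3, -⟩
      · exact hI
      · exact (Finset.mem_filter.1 h3).1
    · rw [hc' I hne]
      exact ⟨ordConnected_empty, empty_subset _⟩
  · intro I hI J hJ hIJ
    by_cases hIne : I.Nonempty
    · by_cases hJne : J.Nonempty
      · rw [hc I hIne, hc J hJne]
        rcases lt_or_gt_of_ne (hkey.ne hIJ) with hlt | hlt
        · have := hle I (Finset.mem_filter.2 ⟨hI, hIne⟩) J hlt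
          rw [Set.disjoint_left]
          intro x hx hx'
          linarith [hx.2, hx'.1]
        · have := hle J (Finset.mem_filter.2 ⟨hJ, hJne⟩) I hlt
          rw [Set.disjoint_left]
          intro x hx hx'
          linarith [hx'.2, hx.1]
      · rw [hc' J hJne]
        exact Set.disjoint_empty _
    · rw [hc' I hIne]
      exact Set.empty_disjoint _
  · intro v
    rw [Finset.sum_filter]
    have : ∀ I ∈ indepSets G, (if v ∈ I then volume (c I) else 0) =
        ENNReal.ofReal (if v ∈ I then w I else 0) := by
      intro I _
      by_cases hv : v ∈ I
      · rw [if_pos hv, if_pos hv, hc I ⟨v, hv⟩, Real.volume_Ico, add_sub_cancel_left]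
      · rw [if_neg hv, if_neg hv, ENNReal.ofReal_zero]
    rw [Finset.sum_congr rfl this, ← ENNReal.ofReal_sum_of_nonneg, h1, ENNReal.ofReal_one]
    intro I _
    split_ifs
    · exact hw I
    · exact le_rfl
  · rintro u t ⟨I, hI, hu, ht⟩
    rw [hc I ⟨u, hu⟩] at ht
    exact ⟨(hst0 I).trans ht.1, ht.2.trans_le (hend I (Finset.mem_filter.2 ⟨hI, ⟨u, hu⟩⟩) u hu)⟩

open Classical in
/-- The greedy fractional colouring algorithm: increase the weights of the independent sets of the
subgraph of unsaturated vertices at rates given by `p`, until all vertices are saturated. -/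
theorem exists_greedy_weights [DecidableRel G.Adj] (β γ : V → ℝ) (hβ : ∀ u, 0 ≤ β u)
    (hγ : ∀ u, 0 ≤ γ u) (p : Finset V → Finset V → ℝ) (hp0 : ∀ S I, 0 ≤ p S I)
    (hpS : ∀ S I, p S I ≠ 0 → I ⊆ S) (hp1 : ∀ S, ∑ I ∈ indepSets G, p S I = 1)
    (hp : ∀ S, ∀ u ∈ S, 1 ≤ ∑ I ∈ indepSets G,
      p S I * (β u * (if u ∈ I then 1 else 0) + γ u * (I ∩ G.neighborFinset u).card)) :
    ∃ w : Finset V → ℝ, (∀ I, 0 ≤ w I) ∧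
      (∀ v, ∑ I ∈ indepSets G, (if v ∈ I then w I else 0) = 1) ∧
      ∀ v, ∑ I ∈ indepSets G,
        (if ∃ u ∈ I, β u + γ u * G.degree u ≤ β v + γ v * G.degree v then w I else 0) ≤
          β v + γ v * G.degree v := by
  set b : V → ℝ := fun u => β u + γ u * G.degree u with hb
  have hb0 : ∀ u, 0 ≤ b u := fun u =>
    add_nonneg (hβ u) (mul_nonneg (hγ u) (Nat.cast_nonneg _))
  let φ : V → Finset V → ℝ := fun u I =>
    β u * (if u ∈ I then 1 else 0) + γ u * (I ∩ G.neighborFinset u).card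
  let m : (Finset V → ℝ) → V → ℝ := fun w v => ∑ I ∈ indepSets G, if v ∈ I then w I else 0
  have hφ : ∀ w u, ∑ I ∈ indepSets G, w I * φ u I =
      β u * m w u + γ u * ∑ x ∈ G.neighborFinset u, m w x := by
    intro w u
    simp only [φ, m]
    rw [Finset.sum_comm, Finset.mul_sum, Finset.mul_sum, ← Finset.sum_add_distrib]
    refine Finset.sum_congr rfl fun I _ => ?_
    have : ∑ x ∈ G.neighborFinset u, (if x ∈ I then w I else 0) =
        (I ∩ G.neighborFinset u).card * w I := by
      rw [← Finset.sum_filter, Finset.sum_const, nsmul_eq_mul, Finset.inter_comm,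
        ← Finset.filter_mem_eq_inter]
    rw [this]
    split_ifs <;> ring
  have hmle : ∀ w u, (∀ v, m w v ≤ 1) → ∑ I ∈ indepSets G, w I * φ u I ≤ b u := by
    intro w u h
    rw [hφ, hb]
    have h1 : ∑ x ∈ G.neighborFinset u, m w x ≤ G.degree u := by
      calc ∑ x ∈ G.neighborFinset u, m w x ≤ ∑ _x ∈ G.neighborFinset u, (1 : ℝ) :=
            Finset.sum_le_sum fun x _ => h x
        _ = _ := by simp
    have h2 := mul_le_mul_of_nonneg_left h1 (hγ u)
    have h3 := mul_le_mul_of_nonneg_left (h u) (hβ u)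
    simp only
    linarith
  -- Induction on the number of unsaturated vertices S. The total weight is the elapsed time; for u
  -- in S it is at most ∑ w·φ u, which is at most b u while no vertex is oversaturated. So once the
  -- time exceeds b v, no u with b u ≤ b v is left in S, and the sets containing such u gain no
  -- further weight.
  have hmain : ∀ (n : ℕ) (S : Finset V) (w : Finset V → ℝ), S.card = n → (∀ I, 0 ≤ w I) →
      (∀ v, m w v ≤ 1) → (∀ v, v ∉ S → m w v = 1) →
      (∀ u ∈ S, ∑ I ∈ indepSets G, w I ≤ ∑ I ∈ indepSets G, w I * φ u I) →
      (∀ v, ∑ I ∈ indepSets G, (if ∃ u ∈ I, b u ≤ b v then w I else 0) ≤ b v) →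
      ∃ w : Finset V → ℝ, (∀ I, 0 ≤ w I) ∧ (∀ v, m w v = 1) ∧
        ∀ v, ∑ I ∈ indepSets G, (if ∃ u ∈ I, b u ≤ b v then w I else 0) ≤ b v := by
    intro n
    induction n using Nat.strong_induction_on with
    | _ n ih =>
      intro S w hcard hw0 hw1 hwS hwt hwd
      rcases S.eq_empty_or_nonempty with rfl | ⟨u₀, hu₀⟩
      · exact ⟨w, hw0, fun v => hwS v (Finset.notMem_empty v), hwd⟩
      have hmp0 : ∀ v, 0 ≤ m (p S) v := fun v => Finset.sum_nonneg fun I _ => by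
        split_ifs
        · exact hp0 S I
        · exact le_rfl
      have hmpS : ∀ v, v ∉ S → m (p S) v = 0 := by
        intro v hv
        refine Finset.sum_eq_zero fun I _ => ?_
        split_ifs with h
        · by_contra hne
          exact hv (hpS S I hne h)
        · rfl
      have hex : (S.filter fun v => 0 < m (p S) v).Nonempty := by
        by_contra hne
        rw [Finset.not_nonempty_iff_eq_empty, Finset.filter_eq_empty_iff] at hne
        have hall : ∀ v, m (p S) v = 0 := fun v => by
          by_cases hv : v ∈ S
          · exact le_antisymm (not_lt.1 (hne hv)) (hmp0 v)
          · exact hmpS v hv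
        have h1 : 1 ≤ ∑ I ∈ indepSets G, p S I * φ u₀ I := hp S u₀ hu₀
        rw [hφ] at h1
        simp only [hall, Finset.sum_const_zero, mul_zero, add_zero] at h1
        linarith
      -- The rates stay constant until the first growing vertex v₀ is saturated, after time τ.
      obtain ⟨v₀, hv₀, hmin⟩ := Finset.exists_min_image _
        (fun v => (1 - m w v) / m (p S) v) hex
      obtain ⟨hv₀S, hv₀p⟩ := Finset.mem_filter.1 hv₀
      set τ := (1 - m w v₀) / m (p S) v₀ with hτ
      have hτ0 : 0 ≤ τ := div_nonneg (by linarith [hw1 v₀]) hv₀p.le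
      let w' : Finset V → ℝ := fun I => w I + τ * p S I
      have hm' : ∀ v, m w' v = m w v + τ * m (p S) v := by
        intro v
        simp only [m, w']
        rw [Finset.mul_sum, ← Finset.sum_add_distrib]
        refine Finset.sum_congr rfl fun I _ => ?_
        split_ifs <;> ring
      have ht' : ∑ I ∈ indepSets G, w' I = ∑ I ∈ indepSets G, w I + τ := by
        simp only [w']
        rw [Finset.sum_add_distrib, ← Finset.mul_sum, hp1, mul_one]
      have hφ' : ∀ u, ∑ I ∈ indepSets G, w' I * φ u I =
          ∑ I ∈ indepSets G, w I * φ u I + τ * ∑ I ∈ indepSets G, p S I * φ u I := by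
        intro u
        simp only [w']
        rw [Finset.mul_sum, ← Finset.sum_add_distrib]
        exact Finset.sum_congr rfl fun I _ => by ring
      have hw'0 : ∀ I, 0 ≤ w' I := fun I => add_nonneg (hw0 I) (mul_nonneg hτ0 (hp0 S I))
      have hw'1 : ∀ v, m w' v ≤ 1 := by
        intro v
        rw [hm']
        by_cases hv : v ∈ S ∧ 0 < m (p S) v
        · have := hmin v (Finset.mem_filter.2 hv)
          rw [le_div_iff₀ hv.2] at this
          linarith
        · have h0 : m (p S) v = 0 := by
            by_cases hvS : v ∈ S
            · exact le_antisymm (not_lt.1 fun h => hv ⟨hvS, h⟩) (hmp0 v)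
            · exact hmpS v hvS
          rw [h0, mul_zero, add_zero]
          exact hw1 v
      have hv₀' : m w' v₀ = 1 := by
        rw [hm', hτ, div_mul_cancel₀ _ hv₀p.ne']
        ring
      have hwt' : ∀ u ∈ S, ∑ I ∈ indepSets G, w' I ≤ ∑ I ∈ indepSets G, w' I * φ u I := by
        intro u hu
        rw [ht', hφ']
        have h1 : 1 ≤ ∑ I ∈ indepSets G, p S I * φ u I := hp S u hu
        have := mul_le_mul_of_nonneg_left h1 hτ0
        linarith [hwt u hu]
      refine ih (S.filter fun v => m w' v ≠ 1).card ?_ (S.filter fun v => m w' v ≠ 1) w' rfl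
        hw'0 hw'1 ?_ ?_ ?_
      · rw [← hcard]
        refine Finset.card_lt_card (Finset.filter_ssubset.2 ⟨v₀, hv₀S, ?_⟩)
        simpa using hv₀'
      · intro v hv
        by_cases hvS : v ∈ S
        · by_contra hne
          exact hv (Finset.mem_filter.2 ⟨hvS, hne⟩)
        · rw [hm', hmpS v hvS, mul_zero, add_zero, hwS v hvS]
      · intro u hu
        exact hwt' u (Finset.mem_filter.1 hu).1
      · intro v
        by_cases hlt : ∑ I ∈ indepSets G, w' I ≤ b v
        · refine le_trans (Finset.sum_le_sum fun I _ => ?_) hlt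
          split_ifs
          · exact le_rfl
          · exact hw'0 I
        · refine le_trans (Finset.sum_le_sum fun I _ => ?_) (hwd v)
          split_ifs with h
          · obtain ⟨u, hu, hub⟩ := h
            have : p S I = 0 := by
              by_contra hne
              have h3 := hwt' u (hpS S I hne hu)
              have h4 := hmle w' u hw'1
              linarith
            simp [w', this]
          · exact le_rfl
  refine hmain _ Finset.univ (fun _ => 0) rfl (fun _ => le_rfl) ?_ ?_ ?_ ?_
  · intro v
    simp [m]
  · intro v hv
    exact absurd (Finset.mem_univ v) hv
  · intro u _
    simp
  · intro v
    simpa using hb0 v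

/-- Either Z ≤ e^L, or log Z > L and dividing the hypothesis by L bounds Z. This is a cruder
substitute for the tangent line, sufficient up to a factor 1 + ε. -/
theorem partFun_le_of_log_le {X : Type*} {Γ : SimpleGraph X} {F : Finset X} {x κ L : ℝ}
    (hx : 0 ≤ x) (hκ : 0 ≤ κ) (hL : 0 < L)
    (h : Real.log (partFun Γ F x) * partFun Γ F x ≤ κ * sizeSum Γ F x) :
    partFun Γ F x ≤ Real.exp L + κ / L * sizeSum Γ F x := by
  have hZ := partFun_pos (Γ := Γ) F hx
  have hs := sizeSum_nonneg (Γ := Γ) F hx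
  by_cases hc : Real.log (partFun Γ F x) ≤ L
  · have h1 : partFun Γ F x ≤ Real.exp L := by
      rwa [← Real.log_le_iff_le_exp hZ]
    have : 0 ≤ κ / L * sizeSum Γ F x := by positivity
    linarith
  · have h1 : partFun Γ F x ≤ κ / L * sizeSum Γ F x := by
      rw [div_mul_eq_mul_div, le_div_iff₀ hL]
      nlinarith
    linarith [Real.exp_pos L]

/-- Fractional colouring from local bounds on the Hall ratio, with a free parameter `L`. -/
theorem exists_isFractionalColouring_of_hallOn [DecidableRel G.Adj] {lam : ℝ} (hlam : 0 < lam)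
    (ρ L : V → ℝ) (hρ : ∀ u, 1 ≤ ρ u) (hL : ∀ u, 0 < L u)
    (h : ∀ u, HallOn G (ρ u) (G.neighborFinset u)) :
    ∃ (k : ℝ) (c : Finset V → Set ℝ), IsFractionalColouring G k c ∧
      ∀ u, colourSet G c u ⊆ Ico 0 (Real.exp (L u) * (1 + lam) / lam +
        K ((1 + lam) * ρ u) / L u * G.degree u) := by
  classical
  have hK : ∀ u, 0 ≤ K ((1 + lam) * ρ u) := fun u => by
    have := one_le_K (y := (1 + lam) * ρ u) (by nlinarith [hρ u])
    linarith
  let p : Finset V → Finset V → ℝ := fun S I =>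
    if I ∈ indepIn G S then lam ^ I.card / partFun G S lam else 0
  have hsub : ∀ S, indepIn G S ⊆ indepSets G := fun S => by
    rw [indepSets_eq]
    exact indepIn_mono (Finset.subset_univ S)
  have hsum : ∀ S (f : Finset V → ℝ), ∑ I ∈ indepSets G, p S I * f I =
      (∑ I ∈ indepIn G S, lam ^ I.card * f I) / partFun G S lam := by
    intro S f
    rw [Finset.sum_div, ← Finset.sum_subset (hsub S)]
    · refine Finset.sum_congr rfl fun I hI => ?_
      simp only [p, if_pos hI]
      ring
    · intro I _ hI
      simp only [p, if_neg hI, zero_mul]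
  have hp0 : ∀ S I, 0 ≤ p S I := by
    intro S I
    simp only [p]
    split_ifs
    · exact div_nonneg (by positivity) (partFun_pos S hlam.le).le
    · exact le_rfl
  have hpS : ∀ S I, p S I ≠ 0 → I ⊆ S := by
    intro S I hne
    by_contra hI
    exact hne (if_neg fun h => hI (mem_indepIn.1 h).1)
  have hp1 : ∀ S, ∑ I ∈ indepSets G, p S I = 1 := by
    intro S
    have := hsum S fun _ => 1
    simp only [mul_one] at this
    rw [this]
    exact div_self (partFun_pos S hlam.le).ne'
  obtain ⟨w, hw0, hw1, hw2⟩ := exists_greedy_weights (G := G)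
    (fun u => Real.exp (L u) * (1 + lam) / lam) (fun u => K ((1 + lam) * ρ u) / L u)
    (fun u => by positivity) (fun u => div_nonneg (hK u) (hL u).le) p hp0 hpS hp1 (by
      intro S u hu
      rw [hsum S, le_div_iff₀ (partFun_pos S hlam.le), one_mul]
      refine (local_occupancy (N := S ∩ G.neighborFinset u) hu (by simp) hlam
        (b := Real.exp (L u)) (g := K ((1 + lam) * ρ u) / L u) ?_).trans ?_
      · intro F hF
        exact partFun_le_of_log_le hlam.le (hK u) (hL u)
          (((h u).mono (hF.trans Finset.inter_subset_right)).log_partFun_mul_le_of_fugacity (hρ u)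
            hlam le_rfl)
      · refine Finset.sum_le_sum fun I _ => ?_
        have hg := div_nonneg (hK u) (hL u).le
        have hcard : (I ∩ (S ∩ G.neighborFinset u)).card ≤ (I ∩ G.neighborFinset u).card :=
          Finset.card_le_card (Finset.inter_subset_inter le_rfl Finset.inter_subset_right)
        gcongr)
  exact exists_isFractionalColouring_of_weights _ w hw0 hw1 hw2

theorem eventually_mul_le_exp (c : ℝ) {η : ℝ} (hη : 0 < η) :
    ∃ L₀ : ℝ, 1 ≤ L₀ ∧ ∀ L, L₀ ≤ L → c * L ≤ Real.exp (η * L) := by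
  have h := (isLittleO_pow_exp_pos_mul_atTop 1 hη).bound (c := (|c| + 1)⁻¹) (by positivity)
  obtain ⟨L₀, hL₀⟩ := eventually_atTop.1 h
  refine ⟨max 1 L₀, le_max_left _ _, fun L hL => ?_⟩
  have h1 := hL₀ L ((le_max_right _ _).trans hL)
  have h2 : 1 ≤ L := (le_max_left _ _).trans hL
  rw [pow_one, Real.norm_eq_abs, Real.norm_eq_abs, Real.abs_exp, abs_of_pos (by linarith),
    inv_mul_eq_div, le_div_iff₀ (by positivity)] at h1
  nlinarith [le_abs_self c]

/-- Let D be the maximum of deg(u) and δ₀, and L = (1-η)log(KD). Then e^L = (KD)^{1-η} is negligible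
against KD/log(KD), and the term with the degree is within 1 + ε/2 of it. Since D equals one of the
two values, no monotonicity of t/log t is needed to reach the stated maximum. -/
theorem exists_local_fractional_colouring (ε : ℝ) (hε : 0 < ε) : ∃ δ₀ : ℝ, 1 < δ₀ ∧
    ∀ (V : Type u) [Fintype V] (G : SimpleGraph V) [DecidableRel G.Adj] (ρu : V → ℝ),
      HasLocalHallRatioLE G ρu →
      ∃ (k : ℝ) (w : Finset V → Set ℝ), IsFractionalColouring G k w ∧
        ∀ u : V, colourSet G w u ⊆
          Ico 0 ((1 + ε) * max
            (K (ρu u) * (G.degree u : ℝ) / Real.log (K (ρu u) * (G.degree u : ℝ)))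
            (K (ρu u) * δ₀ / Real.log (K (ρu u) * δ₀))) := by
  obtain ⟨η, lam, hη, hη2, hlam, hηε, hKle⟩ := exists_fugacity hε
  obtain ⟨L₀, hL₀1, hL₀⟩ := eventually_mul_le_exp ((1 + lam) / lam * (2 / ε)) hη
  refine ⟨Real.exp L₀, Real.one_lt_exp_iff.2 (by linarith), ?_⟩
  intro V _ G _ ρu h
  have hK1 : ∀ u, 1 ≤ K (ρu u) := fun u => one_le_K (h u).1
  let D : V → ℝ := fun u => max (G.degree u : ℝ) (Real.exp L₀)
  have hD : ∀ u, Real.exp L₀ ≤ K (ρu u) * D u := fun u => by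
    have h1 : Real.exp L₀ ≤ D u := le_max_right _ _
    nlinarith [hK1 u, Real.exp_pos L₀]
  have hD0 : ∀ u, 0 < K (ρu u) * D u := fun u => (Real.exp_pos _).trans_le (hD u)
  have hlog : ∀ u, L₀ ≤ Real.log (K (ρu u) * D u) := fun u => by
    rw [Real.le_log_iff_exp_le (hD0 u)]
    exact hD u
  obtain ⟨k, c, hc, hcu⟩ := exists_isFractionalColouring_of_hallOn (G := G) hlam ρu
    (fun u => (1 - η) * Real.log (K (ρu u) * D u)) (fun u => (h u).1)
    (fun u => mul_pos (by linarith) (by linarith [hlog u])) h.hallOn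
  refine ⟨k, c, hc, fun u => (hcu u).trans (Ico_subset_Ico_right ?_)⟩
  have hbound : Real.exp ((1 - η) * Real.log (K (ρu u) * D u)) * (1 + lam) / lam +
      K ((1 + lam) * ρu u) / ((1 - η) * Real.log (K (ρu u) * D u)) * G.degree u ≤
      (1 + ε) * (K (ρu u) * D u / Real.log (K (ρu u) * D u)) := by
    set Λ := Real.log (K (ρu u) * D u) with hΛ
    have hΛ1 : L₀ ≤ Λ := hlog u
    have hΛ0 : 0 < Λ := by linarith
    have hexp : K (ρu u) * D u = Real.exp Λ := (Real.exp_log (hD0 u)).symm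
    have h1 := hL₀ Λ hΛ1
    have e1 : Real.exp ((1 - η) * Λ) * (1 + lam) / lam ≤ ε / 2 * (K (ρu u) * D u / Λ) := by
      rw [hexp, ← mul_div_assoc, le_div_iff₀ hΛ0]
      have e2 : Real.exp Λ = Real.exp ((1 - η) * Λ) * Real.exp (η * Λ) := by
        rw [← Real.exp_add]
        ring_nf
      rw [e2]
      calc Real.exp ((1 - η) * Λ) * (1 + lam) / lam * Λ
          = ε / 2 * (Real.exp ((1 - η) * Λ) * ((1 + lam) / lam * (2 / ε) * Λ)) := by
            field_simp
        _ ≤ _ := by gcongr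
    have e3 : K ((1 + lam) * ρu u) / ((1 - η) * Λ) * G.degree u ≤
        (1 + ε / 2) * (K (ρu u) * D u / Λ) := by
      have hdeg : (G.degree u : ℝ) ≤ D u := le_max_left _ _
      have h3 := hKle (ρu u) (h u).1
      have h1η : 0 < 1 - η := by linarith
      have hKu := hK1 u
      rw [div_mul_eq_mul_div, ← mul_div_assoc, div_le_div_iff₀ (by positivity) hΛ0]
      have h4 : 1 + η ≤ (1 + ε / 2) * (1 - η) := by nlinarith
      calc K ((1 + lam) * ρu u) * G.degree u * Λ ≤ (1 + η) * K (ρu u) * D u * Λ := by gcongr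
        _ ≤ (1 + ε / 2) * (1 - η) * K (ρu u) * D u * Λ := by
            have := (hD0 u).le
            have h5 : 0 ≤ K (ρu u) * D u * Λ := by positivity
            nlinarith
        _ = _ := by ring
    calc _ ≤ ε / 2 * (K (ρu u) * D u / Λ) + (1 + ε / 2) * (K (ρu u) * D u / Λ) := add_le_add e1 e3
      _ = _ := by ring
  refine hbound.trans (mul_le_mul_of_nonneg_left ?_ (by linarith))
  rcases max_choice (G.degree u : ℝ) (Real.exp L₀) with hm | hm
  · have : D u = G.degree u := hm
    rw [this]
    exact le_max_left _ _
  · have : D u = Real.exp L₀ := hm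
    rw [this]
    exact le_max_right _ _

end Fractional

/-! ### The Lovász local lemma -/

section LocalLemma

open Classical in
/-- The symmetric lopsided Lovász local lemma for a finite weighted sample space. -/
theorem lovasz_local_lemma {Ω ι : Type*} (E : Finset Ω) (μ : Ω → ℝ) (hμ : ∀ ω ∈ E, 0 ≤ μ ω)
    (hE : 0 < ∑ ω ∈ E, μ ω) (I : Finset ι) (B : ι → Ω → Prop) (N : ι → Finset ι) {p d : ℝ}
    (hp0 : 0 ≤ p) (hp : p ≤ 1 / 4) (hpd : 4 * p * d ≤ 1)
    (hN : ∀ i ∈ I, ((N i).card : ℝ) ≤ d)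
    (h : ∀ i ∈ I, ∀ S ⊆ I, (∀ j ∈ S, j ∉ N i) →
      ∑ ω ∈ E.filter (fun ω => B i ω ∧ ∀ j ∈ S, ¬B j ω), μ ω ≤
        p * ∑ ω ∈ E.filter (fun ω => ∀ j ∈ S, ¬B j ω), μ ω) :
    ∃ ω ∈ E, ∀ i ∈ I, ¬B i ω := by
  let M : Finset ι → ℝ := fun S => ∑ ω ∈ E.filter (fun ω => ∀ j ∈ S, ¬B j ω), μ ω
  let Q : ι → Finset ι → ℝ := fun i S =>
    ∑ ω ∈ E.filter (fun ω => B i ω ∧ ∀ j ∈ S, ¬B j ω), μ ω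
  have hmono : ∀ i (S T : Finset ι), S ⊆ T → Q i T ≤ Q i S := by
    intro i S T hST
    refine Finset.sum_le_sum_of_subset_of_nonneg ?_ fun ω hω _ => hμ ω (Finset.mem_filter.1 hω).1
    intro ω hω
    rw [Finset.mem_filter] at hω ⊢
    exact ⟨hω.1, hω.2.1, fun j hj => hω.2.2 j (hST hj)⟩
  have hM0 : ∀ S, 0 ≤ M S := fun S =>
    Finset.sum_nonneg fun ω hω => hμ ω (Finset.mem_filter.1 hω).1
  have hins : ∀ j S, M (insert j S) = M S - Q j S := by
    intro j S
    have h1 := Finset.sum_filter_add_sum_filter_not (E.filter fun ω => ∀ j ∈ S, ¬B j ω)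
      (fun ω => B j ω) μ
    rw [Finset.filter_filter, Finset.filter_filter] at h1
    have h2 : Q j S = ∑ ω ∈ E.filter (fun ω => (∀ j ∈ S, ¬B j ω) ∧ B j ω), μ ω := by
      simp only [Q]
      refine Finset.sum_congr (Finset.filter_congr fun ω _ => and_comm) fun _ _ => rfl
    have h3 : M (insert j S) = ∑ ω ∈ E.filter (fun ω => (∀ j ∈ S, ¬B j ω) ∧ ¬B j ω), μ ω := by
      simp only [M]
      refine Finset.sum_congr (Finset.filter_congr fun ω _ => ?_) fun _ _ => rfl
      rw [Finset.forall_mem_insert, and_comm]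
    rw [h2, h3]
    simp only [M]
    linarith
  have hdrop : ∀ S T : Finset ι, M S - ∑ j ∈ T, Q j S ≤ M (T ∪ S) := by
    intro S T
    induction T using Finset.induction_on with
    | empty => simp
    | insert j T hj ih =>
      rw [Finset.sum_insert hj, Finset.insert_union, hins]
      have : Q j (T ∪ S) ≤ Q j S := hmono _ _ _ Finset.subset_union_right
      linarith
  -- Conditionally on avoiding S, each event has probability at most 2p. Adding back the at most d
  -- members of S in `N i` loses at most a fraction 2pd ≤ 1/2 of the mass, which is the source of
  -- the factor 2.
  have key : ∀ (n : ℕ) (S : Finset ι), S.card = n → S ⊆ I →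
      0 < M S ∧ ∀ i ∈ I, Q i S ≤ 2 * p * M S := by
    intro n
    induction n using Nat.strong_induction_on with
    | _ n ih =>
      intro S hcard hS
      have hpos : 0 < M S := by
        rcases S.eq_empty_or_nonempty with rfl | ⟨j, hj⟩
        · simpa [M] using hE
        · obtain ⟨h1, h2⟩ := ih (S.erase j).card
            (by rw [← hcard]; exact Finset.card_erase_lt_of_mem hj) _ rfl
            ((Finset.erase_subset j S).trans hS)
          rw [← Finset.insert_erase hj, hins]
          have := h2 j (hS hj)
          nlinarith
      refine ⟨hpos, fun i hi => ?_⟩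
      have hle := h i hi (S.filter fun j => j ∉ N i) ((Finset.filter_subset _ _).trans hS)
        (fun j hj => (Finset.mem_filter.1 hj).2)
      by_cases hall : ∀ j ∈ S, j ∉ N i
      · rw [Finset.filter_true_of_mem hall] at hle
        have : Q i S ≤ p * M S := hle
        nlinarith
      · set S₂ := S.filter fun j => j ∉ N i with hS₂
        have hlt : S₂.card < n := by
          rw [← hcard]
          push Not at hall
          obtain ⟨j, hj, hjN⟩ := hall
          exact Finset.card_lt_card (Finset.filter_ssubset.2 ⟨j, hj, by simpa using hjN⟩)
        obtain ⟨h1, h2⟩ := ih _ hlt S₂ rfl ((Finset.filter_subset _ _).trans hS)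
        have h3 : Q i S ≤ Q i S₂ := hmono _ _ _ (Finset.filter_subset _ _)
        have h4 := hdrop S₂ (S.filter fun j => j ∈ N i)
        rw [hS₂, Finset.filter_union_filter_not_eq, ← hS₂] at h4
        have h5 : ∑ j ∈ S.filter (fun j => j ∈ N i), Q j S₂ ≤ d * (2 * p * M S₂) := by
          calc ∑ j ∈ S.filter (fun j => j ∈ N i), Q j S₂
              ≤ ∑ _j ∈ S.filter (fun j => j ∈ N i), 2 * p * M S₂ :=
                Finset.sum_le_sum fun j hj => h2 j (hS (Finset.mem_filter.1 hj).1)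
            _ = (S.filter fun j => j ∈ N i).card * (2 * p * M S₂) := by
                rw [Finset.sum_const, nsmul_eq_mul]
            _ ≤ _ := by
                have : (S.filter fun j => j ∈ N i).card ≤ (N i).card :=
                  Finset.card_le_card fun j hj => (Finset.mem_filter.1 hj).2
                have h6 : ((S.filter fun j => j ∈ N i).card : ℝ) ≤ d :=
                  (by exact_mod_cast this : ((S.filter fun j => j ∈ N i).card : ℝ) ≤
                    (N i).card).trans (hN i hi)
                gcongr
        have h6 : Q i S₂ ≤ p * M S₂ := hle
        have h7 : d * (2 * p * M S₂) ≤ 1 / 2 * M S₂ := by nlinarith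
        nlinarith
  have := (key _ I rfl le_rfl).1
  obtain ⟨ω, hω⟩ : (E.filter fun ω => ∀ j ∈ I, ¬B j ω).Nonempty := by
    by_contra hne
    rw [Finset.not_nonempty_iff_eq_empty] at hne
    simp only [M, hne, Finset.sum_empty, lt_irrefl] at this
  rw [Finset.mem_filter] at hω
  exact ⟨ω, hω.1, hω.2⟩

/-- Independent transversals exist when the parts are large compared with the number of neighbours
of each vertex in the other parts. -/
theorem exists_indep_transversal {V X : Type*} [Fintype V] (H : SimpleGraph X) (π : X → V)
    (L : V → Finset X) (hπ : ∀ u, ∀ x ∈ L u, π x = u) {l : ℕ} (hl : 2 ≤ l)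
    (hL : ∀ u, l ≤ (L u).card)
    (hdeg : ∀ u, ∀ x ∈ L u, ∀ T : Finset X,
      (∀ y ∈ T, (∃ v, y ∈ L v) ∧ π y ≠ u ∧ H.Adj x y) → 100 * T.card ≤ l) :
    ∃ f : V → X, (∀ u, f u ∈ L u) ∧ ∀ u v, u ≠ v → ¬H.Adj (f u) (f v) := by
  classical
  -- The parts are trimmed to exactly l elements, so that a uniform choice contains both ends of a
  -- given edge with probability 1/l².
  choose L' hL'L hL'c using fun u => Finset.exists_subset_card_eq (hL u)
  have hπ' : ∀ u, ∀ x ∈ L' u, π x = u := fun u x hx => hπ u x (hL'L u hx)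
  let LL : Finset X := Finset.univ.biUnion L'
  have hLL : ∀ x, x ∈ LL ↔ x ∈ L' (π x) := by
    intro x
    simp only [LL, Finset.mem_biUnion, Finset.mem_univ, true_and]
    constructor
    · rintro ⟨u, hu⟩
      rwa [hπ' u x hu]
    · exact fun h => ⟨_, h⟩
  let I : Finset (X × X) := (LL ×ˢ LL).filter fun q => H.Adj q.1 q.2 ∧ π q.1 ≠ π q.2
  have hI : ∀ q ∈ I, q.1 ∈ L' (π q.1) ∧ q.2 ∈ L' (π q.2) ∧ H.Adj q.1 q.2 ∧ π q.1 ≠ π q.2 := by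
    intro q hq
    simp only [I, Finset.mem_filter, Finset.mem_product, hLL] at hq
    exact ⟨hq.1.1, hq.1.2, hq.2⟩
  let E := Fintype.piFinset L'
  let B : X × X → (V → X) → Prop := fun q f => f (π q.1) = q.1 ∧ f (π q.2) = q.2
  let A₁ : V → Finset (X × X) := fun w => I.filter fun q => π q.1 = w
  let A₂ : V → Finset (X × X) := fun w => I.filter fun q => π q.2 = w
  let N : X × X → Finset (X × X) := fun q => (A₁ (π q.1) ∪ A₂ (π q.1)) ∪ (A₁ (π q.2) ∪ A₂ (π q.2))
  have hA₁ : ∀ w, 100 * (A₁ w).card ≤ l * l := by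
    intro w
    have hsub : A₁ w ⊆ (L' w).biUnion fun x => (LL.filter fun y => H.Adj x y ∧ π y ≠ w).map
        ⟨fun y => (x, y), fun a b hab => (Prod.mk.inj hab).2⟩ := by
      intro q hq
      obtain ⟨hq1, hq2⟩ := Finset.mem_filter.1 hq
      obtain ⟨h1, h2, h3, h4⟩ := hI q hq1
      rw [hq2] at h1 h4
      refine Finset.mem_biUnion.2 ⟨q.1, h1, Finset.mem_map.2 ⟨q.2, ?_, rfl⟩⟩
      rw [Finset.mem_filter, hLL]
      exact ⟨h2, h3, h4.symm⟩
    calc 100 * (A₁ w).card ≤ 100 * ∑ x ∈ L' w, (LL.filter fun y => H.Adj x y ∧ π y ≠ w).card := by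
          refine Nat.mul_le_mul_left _ ((Finset.card_le_card hsub).trans ?_)
          refine Finset.card_biUnion_le.trans (le_of_eq ?_)
          exact Finset.sum_congr rfl fun x _ => Finset.card_map _
      _ = ∑ x ∈ L' w, 100 * (LL.filter fun y => H.Adj x y ∧ π y ≠ w).card := Finset.mul_sum _ _ _
      _ ≤ ∑ _x ∈ L' w, l := by
          refine Finset.sum_le_sum fun x hx => hdeg w x (hL'L w hx) _ fun y hy => ?_
          rw [Finset.mem_filter, hLL] at hy
          exact ⟨⟨_, hL'L _ hy.1⟩, hy.2.2, hy.2.1⟩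
      _ = l * l := by rw [Finset.sum_const, hL'c, smul_eq_mul]
  have hA₂ : ∀ w, 100 * (A₂ w).card ≤ l * l := by
    intro w
    have : (A₂ w).card ≤ (A₁ w).card := by
      refine Finset.card_le_card_of_injOn Prod.swap ?_ Prod.swap_injective.injOn
      intro q hq
      have hq := Finset.mem_coe.1 hq
      obtain ⟨hq1, hq2⟩ := Finset.mem_filter.1 hq
      obtain ⟨h1, h2, h3, h4⟩ := hI q hq1
      simp only [A₁, I, Finset.coe_filter, Finset.mem_filter, Finset.mem_product, hLL,
        Prod.fst_swap, Prod.snd_swap, mem_ofPred_eq]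
      exact ⟨⟨⟨h2, h1⟩, h3.symm, h4.symm⟩, hq2⟩
    exact (Nat.mul_le_mul_left _ this).trans (hA₁ w)
  have hl0 : (0 : ℝ) < l := by exact_mod_cast (by omega : 0 < l)
  have hl2 : (2 : ℝ) ≤ l := by exact_mod_cast hl
  -- The edges meeting the two parts of q form four families of at most l²/100 each, whence d =
  -- l²/25.
  obtain ⟨f, hf, hfB⟩ := lovasz_local_lemma E (fun _ => 1) (fun _ _ => zero_le_one) (by
      have : E.Nonempty := by
        refine Fintype.piFinset_nonempty.2 fun u => ?_
        rw [← Finset.card_pos, hL'c]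
        omega
      simpa using this) I B N (p := 1 / (l * l)) (d := l * l / 25) (by positivity) (by
      rw [div_le_div_iff₀ (by positivity) (by norm_num)]
      nlinarith) (by
      field_simp
      norm_num) (by
      intro q _
      have h1 := hA₁ (π q.1)
      have h2 := hA₂ (π q.1)
      have h3 := hA₁ (π q.2)
      have h4 := hA₂ (π q.2)
      have h5 : (N q).card ≤ ((A₁ (π q.1)).card + (A₂ (π q.1)).card) +
          ((A₁ (π q.2)).card + (A₂ (π q.2)).card) :=
        (Finset.card_union_le _ _).trans
          (Nat.add_le_add (Finset.card_union_le _ _) (Finset.card_union_le _ _))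
      have h6 : 25 * (N q).card ≤ l * l := by omega
      have h7 : (25 : ℝ) * (N q).card ≤ l * l := by exact_mod_cast h6
      linarith) (by
      intro q hq S hS hSN
      obtain ⟨h1, h2, h3, h4⟩ := hI q hq
      rw [Finset.sum_const, Finset.sum_const, nsmul_eq_mul, nsmul_eq_mul, mul_one, mul_one,
        div_mul_eq_mul_div, one_mul, le_div_iff₀ (by positivity)]
      -- Reassigning the two parts of q in all l² ways is injective on the choices containing q. It
      -- creates no event of S, because the edges in S avoid both parts.
      have hcard : ((E.filter fun f => B q f ∧ ∀ j ∈ S, ¬B j f) ×ˢ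
          (L' (π q.1) ×ˢ L' (π q.2))).card ≤ (E.filter fun f => ∀ j ∈ S, ¬B j f).card := by
        refine Finset.card_le_card_of_injOn
          (fun t => Function.update (Function.update t.1 (π q.1) t.2.1) (π q.2) t.2.2) ?_ ?_
        · rintro ⟨f, a, b⟩ ht
          simp only [Finset.coe_product, Finset.coe_filter, mem_prod, mem_ofPred_eq,
            Finset.mem_coe] at ht
          obtain ⟨⟨hfE, -, hfS⟩, ha, hb⟩ := ht
          simp only [Finset.coe_filter, mem_ofPred_eq]
          refine ⟨Fintype.mem_piFinset.2 fun w => ?_, fun j hj hBj => hfS j hj ?_⟩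
          · rcases eq_or_ne w (π q.2) with rfl | hw2
            · rwa [Function.update_self]
            rw [Function.update_of_ne hw2]
            rcases eq_or_ne w (π q.1) with rfl | hw1
            · rwa [Function.update_self]
            rw [Function.update_of_ne hw1]
            exact Fintype.mem_piFinset.1 hfE w
          · have hjN := hSN j hj
            have hjI := hS hj
            simp only [N, A₁, A₂, Finset.mem_union, Finset.mem_filter, hjI, true_and,
              not_or] at hjN
            obtain ⟨⟨n1, n2⟩, n3, n4⟩ := hjN
            obtain ⟨hB1, hB2⟩ := hBj
            rw [Function.update_of_ne n3, Function.update_of_ne n1] at hB1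
            rw [Function.update_of_ne n4, Function.update_of_ne n2] at hB2
            exact ⟨hB1, hB2⟩
        · rintro ⟨f, a, b⟩ ht ⟨f', a', b'⟩ ht' heq
          simp only [Finset.coe_product, Finset.coe_filter, mem_prod, mem_ofPred_eq,
            Finset.mem_coe] at ht ht'
          obtain ⟨⟨-, ⟨hf1, hf2⟩, -⟩, -⟩ := ht
          obtain ⟨⟨-, ⟨hf1', hf2'⟩, -⟩, -⟩ := ht'
          simp only at heq
          have e2 := congrFun heq (π q.2)
          rw [Function.update_self, Function.update_self] at e2
          have e1 := congrFun heq (π q.1)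
          rw [Function.update_of_ne h4, Function.update_of_ne h4, Function.update_self,
            Function.update_self] at e1
          have e3 : f = f' := by
            funext w
            rcases eq_or_ne w (π q.2) with rfl | hw2
            · rw [hf2, hf2']
            rcases eq_or_ne w (π q.1) with rfl | hw1
            · rw [hf1, hf1']
            have := congrFun heq w
            rwa [Function.update_of_ne hw2, Function.update_of_ne hw1,
              Function.update_of_ne hw2, Function.update_of_ne hw1] at this
          rw [e1, e2, e3]
      rw [Finset.card_product, Finset.card_product, hL'c, hL'c] at hcard
      have hcard' : ((E.filter fun f => B q f ∧ ∀ j ∈ S, ¬B j f).card : ℝ) * (l * l) ≤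
          (E.filter fun f => ∀ j ∈ S, ¬B j f).card := by exact_mod_cast hcard
      refine (le_of_eq ?_).trans (hcard'.trans (le_of_eq ?_)) <;> congr!)
  have hf' := Fintype.mem_piFinset.1 hf
  refine ⟨f, fun u => hL'L u (hf' u), fun u v huv hadj => ?_⟩
  have e1 : π (f u) = u := hπ' u _ (hf' u)
  have e2 : π (f v) = v := hπ' v _ (hf' v)
  refine hfB (f u, f v) ?_ ⟨by simp only [e1], by simp only [e2]⟩
  simp only [I, Finset.mem_filter, Finset.mem_product, hLL, e1, e2]
  exact ⟨⟨hf' u, hf' v⟩, hadj, huv⟩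

end LocalLemma

/-! ### Correspondence colouring -/

/-- A cover of `G`, given by a projection `π` of the vertices of `H`. -/
structure IsCover {V X : Type*} (G : SimpleGraph V) (H : SimpleGraph X) (π : X → V)
    (L : V → Finset X) : Prop where
  mem_iff : ∀ u x, x ∈ L u ↔ π x = u
  complete : ∀ x y, π x = π y → x ≠ y → H.Adj x y
  edges : ∀ x y, H.Adj x y → π x = π y ∨ G.Adj (π x) (π y)
  matching : ∀ x y z, H.Adj x y → H.Adj x z → π x ≠ π y → π y = π z → y = z

open Classical in
/-- The neighbours of `x` in `A` outside the part of `x`. -/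
noncomputable def crossNbrs {V X : Type*} (H : SimpleGraph X) (π : X → V) (A : Finset X) (x : X) :
    Finset X :=
  A.filter fun y => H.Adj x y ∧ π y ≠ π x

theorem mem_crossNbrs {V X : Type*} {H : SimpleGraph X} {π : X → V} {A : Finset X} {x y : X} :
    y ∈ crossNbrs H π A x ↔ y ∈ A ∧ H.Adj x y ∧ π y ≠ π x := by
  simp [crossNbrs]

theorem IsCover.adj_of_mem_crossNbrs {V X : Type*} {G : SimpleGraph V} {H : SimpleGraph X}
    {π : X → V} {L : V → Finset X} (hC : IsCover G H π L) {A : Finset X} {x y : X}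
    (hy : y ∈ crossNbrs H π A x) : G.Adj (π x) (π y) := by
  obtain ⟨-, h1, h2⟩ := mem_crossNbrs.1 hy
  exact (hC.edges x y h1).resolve_left fun h => h2 h.symm

theorem IsCover.disjoint_crossNbrs {V X : Type*} {G : SimpleGraph V} {H : SimpleGraph X}
    {π : X → V} {L : V → Finset X} (hC : IsCover G H π L) {A : Finset X} {x x' : X}
    (hπ : π x = π x') (hne : x ≠ x') : Disjoint (crossNbrs H π A x) (crossNbrs H π A x') := by
  rw [Finset.disjoint_left]
  intro y hy hy'
  obtain ⟨-, h1, h2⟩ := mem_crossNbrs.1 hy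
  obtain ⟨-, h3, -⟩ := mem_crossNbrs.1 hy'
  exact hne (hC.matching y x x' h1.symm h3.symm h2 hπ)

/-! ### Neighbourhoods in a cover and greedy extension -/

section Covers

variable {V X : Type*} [Fintype V] {G : SimpleGraph V}
  [DecidableRel G.Adj] {H : SimpleGraph X} {π : X → V} {L : V → Finset X}

/-- By the matching condition π is injective on the cross neighbours of x, and it maps edges among
them to edges of G. Hence independent sets of the neighbourhood in G pull back without loss of size.
-/
theorem IsCover.hallOn_crossNbrs (hC : IsCover G H π L) {A : Finset X} {x : X} {ρ : ℝ}
    (h : HallOn G ρ (G.neighborFinset (π x))) : HallOn H ρ (crossNbrs H π A x) := by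
  classical
  intro S hS
  have hinj : Set.InjOn π (S : Set X) := by
    intro y hy z hz hyz
    obtain ⟨-, h1, h2⟩ := mem_crossNbrs.1 (hS hy)
    obtain ⟨-, h3, -⟩ := mem_crossNbrs.1 (hS hz)
    exact hC.matching x y z h1 h3 h2.symm hyz
  have hsub : S.image π ⊆ G.neighborFinset (π x) := by
    intro v hv
    obtain ⟨y, hy, rfl⟩ := Finset.mem_image.1 hv
    simpa using hC.adj_of_mem_crossNbrs (hS hy)
  obtain ⟨I, hI, hcard⟩ := h _ hsub
  obtain ⟨hI1, hI2⟩ := mem_indepIn.1 hI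
  rw [isIndepSet_coe_iff] at hI2
  refine ⟨S.filter fun y => π y ∈ I, ?_, ?_⟩
  · rw [mem_indepIn, isIndepSet_coe_iff]
    refine ⟨Finset.filter_subset _ _, ?_⟩
    intro y hy z hz hyz
    obtain ⟨hy1, hy2⟩ := Finset.mem_filter.1 hy
    obtain ⟨hz1, hz2⟩ := Finset.mem_filter.1 hz
    rcases hC.edges y z hyz with h1 | h1
    · exact hyz.ne (hinj hy1 hz1 h1)
    · exact hI2 _ hy2 _ hz2 h1
  · have h1 : (S.filter fun y => π y ∈ I).image π = I := by
      ext v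
      simp only [Finset.mem_image, Finset.mem_filter]
      constructor
      · rintro ⟨y, ⟨-, h⟩, rfl⟩
        exact h
      · intro hv
        obtain ⟨y, hy, rfl⟩ := Finset.mem_image.1 (hI1 hv)
        exact ⟨y, ⟨hy, hv⟩, rfl⟩
    have h2 : I.card ≤ (S.filter fun y => π y ∈ I).card := by
      conv_lhs => rw [← h1]
      exact Finset.card_image_le
    have h3 : (S.image π).card = S.card := Finset.card_image_of_injOn hinj
    rw [h3] at hcard
    rcases Nat.eq_zero_or_pos I.card with h0 | h0
    · have h4 : (S.card : ℝ) ≤ 0 := by simpa [h0] using hcard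
      have h5 : S.card = 0 := by exact_mod_cast le_antisymm h4 (Nat.cast_nonneg _)
      have h6 := Finset.card_filter_le S fun y => π y ∈ I
      have h7 : (S.filter fun y => π y ∈ I).card = 0 := by omega
      rw [h5, h7]
      simp
    · have hρ : 0 ≤ ρ := by
        by_contra hneg
        have : ρ * I.card < 0 := mul_neg_of_neg_of_pos (not_le.1 hneg) (by exact_mod_cast h0)
        have : (0 : ℝ) ≤ S.card := Nat.cast_nonneg _
        linarith
      refine hcard.trans ?_
      gcongr

/-- The sets of cross neighbours of the colours of u are disjoint, and I meets each part at most
once since parts are complete. So π injects the counted elements into N(u). -/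
theorem IsCover.sum_card_inter_crossNbrs_le [DecidableEq X] (hC : IsCover G H π L) {A I : Finset X}
    (hI : H.IsIndepSet (I : Set X)) (u : V) :
    ∑ x ∈ L u, (I ∩ crossNbrs H π A x).card ≤ G.degree u := by
  rw [isIndepSet_coe_iff] at hI
  rw [← Finset.card_biUnion, ← SimpleGraph.card_neighborFinset_eq_degree]
  · refine Finset.card_le_card_of_injOn π ?_ ?_
    · intro y hy
      obtain ⟨x, hx, hy⟩ := Finset.mem_biUnion.1 (Finset.mem_coe.1 hy)
      have := hC.adj_of_mem_crossNbrs (Finset.mem_inter.1 hy).2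
      rw [(hC.mem_iff u x).1 hx] at this
      simpa using this
    · intro y hy z hz hyz
      obtain ⟨x, -, hy⟩ := Finset.mem_biUnion.1 (Finset.mem_coe.1 hy)
      obtain ⟨x', -, hz⟩ := Finset.mem_biUnion.1 (Finset.mem_coe.1 hz)
      by_contra hne
      exact hI y (Finset.mem_inter.1 hy).1 z (Finset.mem_inter.1 hz).1 (hC.complete y z hyz hne)
  · intro x hx x' hx' hne
    have h1 := (hC.mem_iff u x).1 hx
    have h2 := (hC.mem_iff u x').1 hx'
    exact (hC.disjoint_crossNbrs (h1.trans h2.symm) hne).mono Finset.inter_subset_right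
      Finset.inter_subset_right

/-- Parts larger than the degree can be coloured greedily. -/
theorem IsCover.exists_greedy_extension [Fintype X] (hC : IsCover G H π L) {I₀ : Finset X}
    (hI₀ : H.IsIndepSet (I₀ : Set X)) (T : Finset V) (hT : ∀ u ∈ T, G.degree u < (L u).card) :
    ∃ I : Finset X, I₀ ⊆ I ∧ H.IsIndepSet (I : Set X) ∧ ∀ u ∈ T, ∃ x ∈ L u, x ∈ I := by
  classical
  induction T using Finset.induction_on with
  | empty => exact ⟨I₀, le_rfl, hI₀, by simp⟩
  | insert u T _ ih =>
    obtain ⟨I, hI1, hI2, hI3⟩ := ih fun v hv => hT v (Finset.mem_insert_of_mem hv)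
    by_cases hu : ∃ x ∈ L u, x ∈ I
    · exact ⟨I, hI1, hI2, by simpa using ⟨hu, hI3⟩⟩
    have hex : ∃ x ∈ L u, I ∩ crossNbrs H π Finset.univ x = ∅ := by
      by_contra hne
      push Not at hne
      have h1 : ∑ _x ∈ L u, 1 ≤ ∑ x ∈ L u, (I ∩ crossNbrs H π Finset.univ x).card :=
        Finset.sum_le_sum fun x hx => Finset.card_pos.2 (hne x hx)
      have h2 := hC.sum_card_inter_crossNbrs_le (A := Finset.univ) hI2 u
      have h3 := hT u (Finset.mem_insert_self u T)
      rw [Finset.sum_const, smul_eq_mul, mul_one] at h1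
      omega
    obtain ⟨x, hx, hxI⟩ := hex
    have hno : ∀ z ∈ I, ¬H.Adj x z := by
      intro z hz hadj
      by_cases hπ : π z = π x
      · exact hu ⟨z, (hC.mem_iff u z).2 (hπ.trans ((hC.mem_iff u x).1 hx)), hz⟩
      · have : z ∈ I ∩ crossNbrs H π Finset.univ x :=
          Finset.mem_inter.2 ⟨hz, mem_crossNbrs.2 ⟨Finset.mem_univ z, hadj, hπ⟩⟩
        rw [hxI] at this
        exact Finset.notMem_empty z this
    refine ⟨insert x I, hI1.trans (Finset.subset_insert x I), ?_, ?_⟩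
    · rw [isIndepSet_coe_iff] at hI2 ⊢
      intro y hy z hz hadj
      rcases Finset.mem_insert.1 hy with hy | hy
      · rcases Finset.mem_insert.1 hz with hz | hz
        · exact hadj.ne (hy.trans hz.symm)
        · exact hno z hz (hy ▸ hadj)
      · rcases Finset.mem_insert.1 hz with hz | hz
        · exact hno y hy (hz ▸ hadj.symm)
        · exact hI2 y hy z hz hadj
    · intro v hv
      rcases Finset.mem_insert.1 hv with rfl | hv
      · exact ⟨x, hx, Finset.mem_insert_self x I⟩
      · obtain ⟨y, hy, hyI⟩ := hI3 v hv
        exact ⟨y, hy, Finset.mem_insert_of_mem hyI⟩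

end Covers

/-! ### Moments of products over disjoint neighbourhoods -/

section Moment

variable {X : Type*} [DecidableEq X] {Γ : SimpleGraph X}

/-- Products of functions of the traces on disjoint sets have the expected moments. -/
theorem sum_mul_prod_le {A : Finset X} {x c : ℝ} (hx : 0 ≤ x) (hc : 0 ≤ c) {ι : Type*}
    [DecidableEq ι] (S : Finset ι) (N : ι → Finset X) (hN : ∀ i ∈ S, N i ⊆ A)
    (hdisj : ∀ i ∈ S, ∀ j ∈ S, i ≠ j → Disjoint (N i) (N j)) (f g : Finset X → ℝ)
    (hf : ∀ I, 0 ≤ f I) (hg : ∀ I, 0 ≤ g I)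
    (hfN : ∀ i ∈ S, ∀ J T : Finset X, T ⊆ N i → f (J ∪ T) = f J)
    (hgN : ∀ i ∈ S, ∀ F ⊆ N i,
      ∑ T ∈ indepIn Γ F, x ^ T.card * g T ≤ c * partFun Γ F x) :
    ∑ I ∈ indepIn Γ A, x ^ I.card * (f I * ∏ i ∈ S, g (I ∩ N i)) ≤
      c ^ S.card * ∑ I ∈ indepIn Γ A, x ^ I.card * f I := by
  induction S using Finset.induction_on with
  | empty => simp
  | insert i S hi ih =>
    have ih := ih (fun j hj => hN j (Finset.mem_insert_of_mem hj))
      (fun j hj k hk => hdisj j (Finset.mem_insert_of_mem hj) k (Finset.mem_insert_of_mem hk))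
      (fun j hj => hfN j (Finset.mem_insert_of_mem hj))
      (fun j hj => hgN j (Finset.mem_insert_of_mem hj))
    have hi' := Finset.mem_insert_self i S
    rw [Finset.card_insert_of_notMem hi, pow_succ]
    -- Given the trace J outside N i, both f and the other factors are determined. The trace inside
    -- is hard-core on the free part of N i, so `hgN` must hold for every subset F of N i.
    have hsuff : ∑ I ∈ indepIn Γ A, x ^ I.card * (f I * ∏ j ∈ insert i S, g (I ∩ N j)) ≤
        c * ∑ I ∈ indepIn Γ A, x ^ I.card * (f I * ∏ j ∈ S, g (I ∩ N j)) := by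
      rw [sum_indepIn_split (hN i hi'), sum_indepIn_split (hN i hi'), Finset.mul_sum]
      refine Finset.sum_le_sum fun J hJ => ?_
      have hJN : ∀ z ∈ J, z ∉ N i := fun z hz =>
        (Finset.mem_sdiff.1 ((mem_indepIn.1 hJ).1 hz)).2
      have hT : ∀ T ∈ indepIn Γ (free Γ J (N i)), T ⊆ N i := fun T hT =>
        (mem_indepIn.1 hT).1.trans (free_subset _ _)
      have hother : ∀ T ∈ indepIn Γ (free Γ J (N i)), ∏ j ∈ S, g ((J ∪ T) ∩ N j) =
          ∏ j ∈ S, g (J ∩ N j) := by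
        intro T hT'
        refine Finset.prod_congr rfl fun j hj => ?_
        congr 1
        have hd := hdisj i hi' j (Finset.mem_insert_of_mem hj) fun h => hi (h ▸ hj)
        rw [Finset.union_inter_distrib_right,
          Finset.disjoint_iff_inter_eq_empty.1 (hd.mono_left (hT T hT')), Finset.union_empty]
      have hself : ∀ T ∈ indepIn Γ (free Γ J (N i)), (J ∪ T) ∩ N i = T := by
        intro T hT'
        rw [Finset.union_inter_distrib_right, Finset.inter_eq_left.2 (hT T hT'),
          Finset.disjoint_iff_inter_eq_empty.1 (Finset.disjoint_left.2 hJN), Finset.empty_union]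
      set P := ∏ j ∈ S, g (J ∩ N j) with hP
      have hP0 : 0 ≤ P := Finset.prod_nonneg fun j _ => hg _
      have e1 : ∀ T ∈ indepIn Γ (free Γ J (N i)),
          x ^ (J ∪ T).card * (f (J ∪ T) * ∏ j ∈ insert i S, g ((J ∪ T) ∩ N j)) =
            x ^ J.card * f J * P * (x ^ T.card * g T) := by
        intro T hT'
        rw [Finset.prod_insert hi, hother T hT', hself T hT', hfN i hi' J T (hT T hT'),
          Finset.card_union_of_disjoint (disjoint_of_mem_split hJ hT'), pow_add]
        ring
      have e2 : ∀ T ∈ indepIn Γ (free Γ J (N i)),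
          x ^ (J ∪ T).card * (f (J ∪ T) * ∏ j ∈ S, g ((J ∪ T) ∩ N j)) =
            x ^ J.card * f J * P * x ^ T.card := by
        intro T hT'
        rw [hother T hT', hfN i hi' J T (hT T hT'),
          Finset.card_union_of_disjoint (disjoint_of_mem_split hJ hT'), pow_add]
        ring
      rw [Finset.sum_congr rfl e1, Finset.sum_congr rfl e2, ← Finset.mul_sum, ← Finset.mul_sum]
      have h1 := hgN i hi' _ (free_subset (Γ := Γ) J (N i))
      have h2 : 0 ≤ x ^ J.card * f J * P := mul_nonneg (mul_nonneg (pow_nonneg hx _) (hf J)) hP0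
      calc _ ≤ x ^ J.card * f J * P * (c * partFun Γ (free Γ J (N i)) x) :=
            mul_le_mul_of_nonneg_left h1 h2
        _ = _ := by
            unfold partFun
            ring
    calc _ ≤ c * (c ^ S.card * ∑ I ∈ indepIn Γ A, x ^ I.card * f I) :=
          hsuff.trans (mul_le_mul_of_nonneg_left ih hc)
      _ = _ := by ring

end Moment

/-- Changing the fugacity by `exp (-b)` and discounting the empty set decreases the partition
function of a graph of bounded Hall ratio by a definite factor. -/
theorem partFun_mul_exp_neg_le {X : Type*} {Γ : SimpleGraph X} {F : Finset X} {x κ L θ s b : ℝ} (hx : 0 < x) (hκ : 0 < κ)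
    (hL : 0 < L) (hs : s = Real.exp (-L) / 2) (hθ : θ = s / L) (hθ1 : θ < 1)
    (hb : b = κ * θ / (1 - θ))
    (h : ∀ y, 0 < y → y ≤ x → Real.log (partFun Γ F y) * partFun Γ F y ≤ κ * sizeSum Γ F y) :
    partFun Γ F (x * Real.exp (-b)) - (1 - Real.exp (-1)) ≤ Real.exp (-s) * partFun Γ F x := by
  have hs0 : 0 < s := by
    rw [hs]
    positivity
  have hθ0 : 0 < θ := by
    rw [hθ]
    positivity
  have h1θ : 0 < 1 - θ := by linarith
  have hb0 : 0 < b := by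
    rw [hb]
    positivity
  have hy0 : 0 < x * Real.exp (-b) := by positivity
  have hyx : x * Real.exp (-b) ≤ x :=
    mul_le_of_le_one_right hx.le (Real.exp_le_one_iff.2 (by linarith))
  set Z := partFun Γ F x with hZ
  set Z' := partFun Γ F (x * Real.exp (-b)) with hZ'
  have hZ0 : 0 < Z := partFun_pos F hx.le
  have hZ'0 : 0 < Z' := partFun_pos F hy0.le
  have he1 : Real.exp (-1) ≤ 1 / 2 := by
    rw [Real.exp_neg, inv_le_comm₀ (Real.exp_pos 1) (by norm_num)]
    have := Real.exp_one_gt_d9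
    norm_num
    linarith
  -- If Z is large, raising the fugacity back by e^b gives (1 + b/κ) log Z' ≤ log Z. Here 1 + b/κ =
  -- 1/(1-θ), so log Z' is smaller than log Z by at least θL = s. If Z < e^L, then Z' ≤ Z and the
  -- loss (1 - e^{-s})Z ≤ sZ ≤ 1/2 is covered by the discount 1 - 1/e on the empty set.
  by_cases hc : L ≤ Real.log Z
  · have hJ := partFun_mul_exp_ge (Γ := Γ) F hy0 b
    rw [mul_assoc x, ← Real.exp_add, neg_add_cancel, Real.exp_zero, mul_one, ← hZ, ← hZ'] at hJ
    have hJ2 := Real.log_le_log (by positivity) hJ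
    rw [Real.log_mul hZ'0.ne' (Real.exp_pos _).ne', Real.log_exp] at hJ2
    have h3 : Real.log Z' / κ ≤ sizeSum Γ F (x * Real.exp (-b)) / Z' := by
      rw [div_le_div_iff₀ hκ hZ'0]
      have := h _ hy0 hyx
      rw [← hZ'] at this
      linarith
    have h4 : Real.log Z' + b * (Real.log Z' / κ) ≤ Real.log Z :=
      le_trans (by gcongr) hJ2
    have h5 : Real.log Z' + b * (Real.log Z' / κ) = Real.log Z' / (1 - θ) := by
      rw [hb]
      field_simp
      ring
    rw [h5, div_le_iff₀ h1θ] at h4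
    have h6 : θ * L = s := by
      rw [hθ]
      field_simp
    have h7 : Z' ≤ Real.exp (-s) * Z := by
      rw [← Real.log_le_log_iff hZ'0 (by positivity), Real.log_mul (Real.exp_pos _).ne' hZ0.ne',
        Real.log_exp]
      nlinarith
    linarith
  · have h1 : Z' ≤ Z := partFun_mono F hy0.le hyx
    have h2 : Z < Real.exp L := (Real.log_lt_iff_lt_exp hZ0).1 (not_le.1 hc)
    have h3 := Real.add_one_le_exp (-s)
    have h4 : s * Z ≤ 1 / 2 := by
      have h5 : Real.exp (-L) * Z ≤ 1 := by
        rw [Real.exp_neg, inv_mul_le_iff₀ (Real.exp_pos L), mul_one]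
        exact h2.le
      rw [hs]
      linarith
    nlinarith


/-! ### Bad events and their conditional probabilities -/

section BadEvents

variable {V X : Type*} [DecidableEq X] {H : SimpleGraph X} {π : X → V}

/-- The part of `u` is uncoloured, and fewer than `l` of its colours remain available. -/
def FewColours (H : SimpleGraph X) (π : X → V) (L : V → Finset X) (A : Finset X) (l : ℕ) (u : V)
    (I : Finset X) : Prop :=
  I ∩ L u = ∅ ∧ ((L u).filter fun x => I ∩ crossNbrs H π A x = ∅).card < l

/-- The colour `x` remains available, and too many of its neighbours remain available. -/
def ManyConflicts (H : SimpleGraph X) (π : X → V) (A : Finset X) (l : ℕ) (x : X)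
    (I : Finset X) : Prop :=
  I ∩ crossNbrs H π A x = ∅ ∧ l < 100 * (free H I (crossNbrs H π A x)).card

/-- Given the trace J outside the cross neighbours of x, the colour x stays available only if
nothing is chosen among them, with probability 1/Z_F for the free part F. The event also requires F
to be large, and then `hZ` applies. -/
theorem sum_manyConflicts_le {A : Finset X} {l : ℕ} {x : X} {lam q : ℝ} (hlam : 0 ≤ lam)
    (hq : 0 ≤ q)
    (hZ : ∀ F ⊆ crossNbrs H π A x, l < 100 * F.card → 1 ≤ q * partFun H F lam)
    (f : Finset X → ℝ) (hf : ∀ I, 0 ≤ f I)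
    (hfN : ∀ J T : Finset X, T ⊆ crossNbrs H π A x → f (J ∪ T) = f J)
    (B : Finset X → ℝ) (hB0 : ∀ I, ¬ManyConflicts H π A l x I → B I = 0) (hB1 : ∀ I, B I ≤ 1) :
    ∑ I ∈ indepIn H A, lam ^ I.card * (B I * f I) ≤
      q * ∑ I ∈ indepIn H A, lam ^ I.card * f I := by
  have hNA : crossNbrs H π A x ⊆ A := fun y hy => (mem_crossNbrs.1 hy).1
  rw [sum_indepIn_split hNA, sum_indepIn_split hNA, Finset.mul_sum]
  refine Finset.sum_le_sum fun J hJ => ?_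
  set F := free H J (crossNbrs H π A x) with hF
  have hTN : ∀ T ∈ indepIn H F, T ⊆ crossNbrs H π A x := fun T hT =>
    (mem_indepIn.1 hT).1.trans (free_subset _ _)
  have e2 : ∀ T ∈ indepIn H F, lam ^ (J ∪ T).card * f (J ∪ T) =
      lam ^ J.card * f J * lam ^ T.card := by
    intro T hT
    rw [hfN J T (hTN T hT), Finset.card_union_of_disjoint (disjoint_of_mem_split hJ hT), pow_add]
    ring
  have e1 : ∀ T ∈ indepIn H F, T ≠ ∅ →
      lam ^ (J ∪ T).card * (B (J ∪ T) * f (J ∪ T)) = 0 := by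
    intro T hT hne
    rw [hB0, zero_mul, mul_zero]
    rintro ⟨h1, -⟩
    obtain ⟨t, ht⟩ := Finset.nonempty_of_ne_empty hne
    have : t ∈ (J ∪ T) ∩ crossNbrs H π A x :=
      Finset.mem_inter.2 ⟨Finset.mem_union_right _ ht, hTN T hT ht⟩
    rw [h1] at this
    exact Finset.notMem_empty t this
  rw [Finset.sum_eq_single_of_mem ∅ (empty_mem_indepIn F) e1, Finset.sum_congr rfl e2,
    ← Finset.mul_sum, Finset.union_empty]
  change _ ≤ q * (lam ^ J.card * f J * partFun H F lam)
  have h0 : 0 ≤ lam ^ J.card * f J := mul_nonneg (pow_nonneg hlam _) (hf J)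
  by_cases hc : l < 100 * F.card
  · have h1 := hZ F (free_subset _ _) hc
    calc lam ^ J.card * (B J * f J) = B J * (lam ^ J.card * f J) := by ring
      _ ≤ q * partFun H F lam * (lam ^ J.card * f J) :=
          mul_le_mul_of_nonneg_right ((hB1 J).trans h1) h0
      _ = _ := by ring
  · rw [hB0 J fun h => hc h.2, zero_mul, mul_zero]
    have := partFun_pos (Γ := H) F hlam
    positivity

variable {L : V → Finset X} [Fintype V] {G : SimpleGraph V} [DecidableRel G.Adj]

/-- An exponential Markov inequality: each colour x contributes e^{-1} if it is available and
e^{-b|T|} if the chosen set T among its cross neighbours is nonempty. On the event the product is at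
least exp(-l - b deg u), since at most deg u neighbouring colours are chosen in all. Its mean is at
most exp(-s|L(u)|) by `sum_mul_prod_le`. -/
theorem sum_fewColours_le (hC : IsCover G H π L) {A : Finset X} {l : ℕ} {u : V} {lam s b : ℝ}
    (hlam : 0 < lam) (hb : 0 ≤ b)
    (hZ : ∀ x ∈ L u, ∀ F ⊆ crossNbrs H π A x, partFun H F (lam * Real.exp (-b)) -
      (1 - Real.exp (-1)) ≤ Real.exp (-s) * partFun H F lam)
    (f : Finset X → ℝ) (hf : ∀ I, 0 ≤ f I)
    (hfN : ∀ x ∈ L u, ∀ J T : Finset X, T ⊆ crossNbrs H π A x → f (J ∪ T) = f J)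
    (B : Finset X → ℝ) (hB0 : ∀ I, ¬FewColours H π L A l u I → B I = 0) (hB1 : ∀ I, B I ≤ 1) :
    ∑ I ∈ indepIn H A, lam ^ I.card * (B I * f I) ≤
      Real.exp (l + b * G.degree u - s * (L u).card) * ∑ I ∈ indepIn H A, lam ^ I.card * f I := by
  let g : Finset X → ℝ := fun T => if T = ∅ then Real.exp (-1) else Real.exp (-(b * T.card))
  have hg0 : ∀ T, 0 ≤ g T := fun T => by
    simp only [g]
    split_ifs <;> positivity
  have hgN : ∀ x ∈ L u, ∀ F ⊆ crossNbrs H π A x,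
      ∑ T ∈ indepIn H F, lam ^ T.card * g T ≤ Real.exp (-s) * partFun H F lam := by
    intro x hx F hF
    refine le_trans (le_of_eq ?_) (hZ x hx F hF)
    -- The factor e^{-b|T|} changes the fugacity to lam·e^{-b}; only the empty set differs,
    -- contributing 1/e instead of 1.
    have e1 : ∀ T ∈ indepIn H F, lam ^ T.card * g T =
        (lam * Real.exp (-b)) ^ T.card - if T = ∅ then 1 - Real.exp (-1) else 0 := by
      intro T _
      simp only [g]
      split_ifs with h
      · subst h
        simp
      · rw [mul_pow, ← Real.exp_nat_mul]
        ring_nf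
    rw [Finset.sum_congr rfl e1, Finset.sum_sub_distrib, Finset.sum_ite_eq',
      if_pos (empty_mem_indepIn F)]
    rfl
  have hdisj : ∀ x ∈ L u, ∀ y ∈ L u, x ≠ y →
      Disjoint (crossNbrs H π A x) (crossNbrs H π A y) := fun x hx y hy hne =>
    hC.disjoint_crossNbrs (((hC.mem_iff u x).1 hx).trans ((hC.mem_iff u y).1 hy).symm) hne
  have hmom := sum_mul_prod_le (Γ := H) (A := A) hlam.le (Real.exp_pos (-s)).le (L u)
    (fun x => crossNbrs H π A x) (fun x _ y hy => (mem_crossNbrs.1 hy).1) hdisj f g hf hg0 hfN hgN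
  rw [← Real.exp_nat_mul] at hmom
  have hpt : ∀ I ∈ indepIn H A, lam ^ I.card * (B I * f I) ≤
      Real.exp (l + b * G.degree u) *
        (lam ^ I.card * (f I * ∏ x ∈ L u, g (I ∩ crossNbrs H π A x))) := by
    intro I hI
    have hprod0 : 0 ≤ ∏ x ∈ L u, g (I ∩ crossNbrs H π A x) := Finset.prod_nonneg fun x _ => hg0 _
    have hw : 0 ≤ lam ^ I.card * f I := mul_nonneg (pow_nonneg hlam.le _) (hf I)
    by_cases hc : FewColours H π L A l u I
    · have h1 : Real.exp (-(l + b * G.degree u)) ≤ ∏ x ∈ L u, g (I ∩ crossNbrs H π A x) := by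
        have h2 : ∀ x ∈ L u, Real.exp (-((if I ∩ crossNbrs H π A x = ∅ then 1 else 0) +
            b * (I ∩ crossNbrs H π A x).card)) ≤ g (I ∩ crossNbrs H π A x) := by
          intro x _
          simp only [g]
          split_ifs with h
          · simp [h]
          · simp
        refine le_trans ?_ (Finset.prod_le_prod (fun x _ => (Real.exp_pos _).le) h2)
        rw [← Real.exp_sum, Real.exp_le_exp, Finset.sum_neg_distrib, neg_le_neg_iff,
          Finset.sum_add_distrib, Finset.sum_boole, ← Finset.mul_sum]
        have h3 : (((L u).filter fun x => I ∩ crossNbrs H π A x = ∅).card : ℝ) ≤ l := by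
          exact_mod_cast hc.2.le
        have h4 : ∑ x ∈ L u, ((I ∩ crossNbrs H π A x).card : ℝ) ≤ G.degree u := by
          exact_mod_cast hC.sum_card_inter_crossNbrs_le (mem_indepIn.1 hI).2 u
        gcongr
      have h5 : 1 ≤ Real.exp (l + b * G.degree u) *
          ∏ x ∈ L u, g (I ∩ crossNbrs H π A x) := by
        calc (1 : ℝ) = Real.exp (l + b * G.degree u) * Real.exp (-(l + b * G.degree u)) := by
              rw [← Real.exp_add, add_neg_cancel, Real.exp_zero]
          _ ≤ _ := by gcongr
      calc lam ^ I.card * (B I * f I) = B I * (lam ^ I.card * f I) := by ring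
        _ ≤ (Real.exp (l + b * G.degree u) * ∏ x ∈ L u, g (I ∩ crossNbrs H π A x)) *
            (lam ^ I.card * f I) := mul_le_mul_of_nonneg_right ((hB1 I).trans h5) hw
        _ = _ := by ring
    · rw [hB0 I hc, zero_mul, mul_zero]
      calc (0 : ℝ) ≤ Real.exp (l + b * G.degree u) * ((lam ^ I.card * f I) *
            ∏ x ∈ L u, g (I ∩ crossNbrs H π A x)) := by positivity
        _ = _ := by ring
  refine (Finset.sum_le_sum hpt).trans ?_
  rw [← Finset.mul_sum]
  calc _ ≤ Real.exp (l + b * G.degree u) * (Real.exp ((L u).card * -s) *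
        ∑ I ∈ indepIn H A, lam ^ I.card * f I) :=
        mul_le_mul_of_nonneg_left hmom (Real.exp_pos _).le
    _ = _ := by
        rw [← mul_assoc, ← Real.exp_add]
        ring_nf

variable [DecidableEq V]

/-- The closed neighbourhood of a vertex. -/
def closedNbhd (G : SimpleGraph V) [DecidableRel G.Adj] (u : V) : Finset V :=
  insert u (G.neighborFinset u)

theorem mem_closedNbhd {u v : V} : v ∈ closedNbhd G u ↔ v = u ∨ G.Adj u v := by
  simp [closedNbhd]

/-- The vertices at distance at most `3`. -/
def ballThree (G : SimpleGraph V) [DecidableRel G.Adj] (u : V) : Finset V :=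
  (closedNbhd G u).biUnion fun w => (closedNbhd G w).biUnion fun z => closedNbhd G z

theorem mem_ballThree {u v w z : V} (h1 : w ∈ closedNbhd G u) (h2 : z ∈ closedNbhd G w)
    (h3 : v ∈ closedNbhd G z) : v ∈ ballThree G u :=
  Finset.mem_biUnion.2 ⟨w, h1, Finset.mem_biUnion.2 ⟨z, h2, h3⟩⟩

theorem card_ballThree_le {Δ : ℕ} (hΔ : ∀ u, G.degree u ≤ Δ) (u : V) :
    (ballThree G u).card ≤ (Δ + 1) ^ 3 := by
  have h1 : ∀ v, (closedNbhd G v).card ≤ Δ + 1 := fun v =>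
    (Finset.card_insert_le _ _).trans (by simpa using hΔ v)
  have h2 : ∀ v, ((closedNbhd G v).biUnion fun z => closedNbhd G z).card ≤ (Δ + 1) * (Δ + 1) :=
    fun v => (Finset.card_biUnion_le_card_mul _ _ _ fun z _ => h1 z).trans
      (Nat.mul_le_mul_right _ (h1 v))
  calc (ballThree G u).card ≤ (closedNbhd G u).card * ((Δ + 1) * (Δ + 1)) :=
        Finset.card_biUnion_le_card_mul _ _ _ fun w _ => h2 w
    _ ≤ (Δ + 1) * ((Δ + 1) * (Δ + 1)) := Nat.mul_le_mul_right _ (h1 u)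
    _ = _ := by ring

/-- The events of the local lemma. -/
def BadEvent (H : SimpleGraph X) (π : X → V) (L : V → Finset X) (A : Finset X) (l : ℕ) (u : V)
    (I : Finset X) : Prop :=
  FewColours H π L A l u I ∨ ∃ x ∈ L u, ManyConflicts H π A l x I

/-- The event at `v` does not depend on the colours of the neighbours of vertices far away. -/
theorem IsCover.badEvent_union_iff (hC : IsCover G H π L) {A : Finset X} {l : ℕ} {u v : V}
    (huv : v ∉ ballThree G u) {J T : Finset X} (hT : ∀ y ∈ T, π y ∈ closedNbhd G u) :
    BadEvent H π L A l v (J ∪ T) ↔ BadEvent H π L A l v J := by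
  have hself : ∀ w : V, w ∈ closedNbhd G w := fun w => mem_closedNbhd.2 (Or.inl rfl)
  have h1 : (J ∪ T) ∩ L v = J ∩ L v := by
    ext y
    simp only [Finset.mem_inter, Finset.mem_union]
    refine ⟨fun h => ⟨h.1.resolve_right fun hy => huv ?_, h.2⟩, fun h => ⟨Or.inl h.1, h.2⟩⟩
    have := hT y hy
    rw [(hC.mem_iff v y).1 h.2] at this
    exact mem_ballThree this (hself v) (hself v)
  have h2 : ∀ x ∈ L v, (J ∪ T) ∩ crossNbrs H π A x = J ∩ crossNbrs H π A x := by
    intro x hx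
    ext y
    simp only [Finset.mem_inter, Finset.mem_union]
    refine ⟨fun h => ⟨h.1.resolve_right fun hy => huv ?_, h.2⟩, fun h => ⟨Or.inl h.1, h.2⟩⟩
    have h3 := hC.adj_of_mem_crossNbrs h.2
    rw [(hC.mem_iff v x).1 hx] at h3
    exact mem_ballThree (hT y hy) (mem_closedNbhd.2 (Or.inr h3.symm)) (hself v)
  have h3 : ∀ x ∈ L v, free H (J ∪ T) (crossNbrs H π A x) = free H J (crossNbrs H π A x) := by
    intro x hx
    ext y
    rw [mem_free, mem_free]
    refine ⟨fun h => ⟨h.1, fun z hz => h.2 z (Finset.mem_union_left _ hz)⟩,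
      fun h => ⟨h.1, fun z hz hadj => ?_⟩⟩
    rcases Finset.mem_union.1 hz with hz | hz
    · exact h.2 z hz hadj
    · have h3 := hC.adj_of_mem_crossNbrs h.1
      rw [(hC.mem_iff v x).1 hx] at h3
      -- This dependence reaches furthest: the chosen colour z near u blocks y, which is a neighbour
      -- of a colour of v. Hence the radius 3.
      refine huv (mem_ballThree (hT z hz) (z := π y) ?_ (mem_closedNbhd.2 (Or.inr h3.symm)))
      rw [mem_closedNbhd]
      rcases hC.edges y z hadj with h4 | h4
      · exact Or.inl h4
      · exact Or.inr h4.symm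
  have h4 : FewColours H π L A l v (J ∪ T) ↔ FewColours H π L A l v J := by
    unfold FewColours
    rw [h1, Finset.filter_congr fun x hx => by rw [h2 x hx]]
  unfold BadEvent
  rw [h4]
  refine or_congr Iff.rfl (exists_congr fun x => and_congr_right fun hx => ?_)
  unfold ManyConflicts
  rw [h2 x hx, h3 x hx]

open Classical in
/-- The probability of a bad event, conditionally on the absence of bad events far away. -/
theorem IsCover.sum_badEvent_le (hC : IsCover G H π L) {A : Finset X} {l : ℕ} {u : V}
    {lam s b q : ℝ} {Δ : ℕ} (hlam : 0 < lam) (hb : 0 ≤ b) (hq : 0 ≤ q)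
    (hfew : ∀ x ∈ L u, ∀ F ⊆ crossNbrs H π A x, partFun H F (lam * Real.exp (-b)) -
      (1 - Real.exp (-1)) ≤ Real.exp (-s) * partFun H F lam)
    (hexp : Real.exp (l + b * G.degree u - s * (L u).card) ≤ q)
    (hmany : ∀ x ∈ L u, ∀ F ⊆ crossNbrs H π A x, l < 100 * F.card → 1 ≤ q * partFun H F lam)
    (hcard : (L u).card ≤ Δ) (S : Finset V) (hS : ∀ v ∈ S, v ∉ ballThree G u) :
    ∑ I ∈ (indepIn H A).filter
        (fun I => BadEvent H π L A l u I ∧ ∀ v ∈ S, ¬BadEvent H π L A l v I), lam ^ I.card ≤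
      ((Δ + 1) * q) * ∑ I ∈ (indepIn H A).filter
        (fun I => ∀ v ∈ S, ¬BadEvent H π L A l v I), lam ^ I.card := by
  let f : Finset X → ℝ := fun I => if ∀ v ∈ S, ¬BadEvent H π L A l v I then 1 else 0
  let B₁ : Finset X → ℝ := fun I => if FewColours H π L A l u I then 1 else 0
  let B₂ : X → Finset X → ℝ := fun x I => if ManyConflicts H π A l x I then 1 else 0
  have hf : ∀ I, 0 ≤ f I := fun I => by
    simp only [f]
    split_ifs <;> norm_num
  have hB₁0 : ∀ I, 0 ≤ B₁ I := fun I => by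
    simp only [B₁]
    split_ifs <;> norm_num
  have hB₂0 : ∀ x I, 0 ≤ B₂ x I := fun x I => by
    simp only [B₂]
    split_ifs <;> norm_num
  have hfN : ∀ x ∈ L u, ∀ J T : Finset X, T ⊆ crossNbrs H π A x → f (J ∪ T) = f J := by
    intro x hx J T hT
    have hT' : ∀ y ∈ T, π y ∈ closedNbhd G u := by
      intro y hy
      have := hC.adj_of_mem_crossNbrs (hT hy)
      rw [(hC.mem_iff u x).1 hx] at this
      exact mem_closedNbhd.2 (Or.inr this)
    simp only [f]
    refine if_congr (forall₂_congr fun v hv => ?_) rfl rfl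
    rw [hC.badEvent_union_iff (hS v hv) hT']
  have hsumf : ∑ I ∈ (indepIn H A).filter (fun I => ∀ v ∈ S, ¬BadEvent H π L A l v I),
      lam ^ I.card = ∑ I ∈ indepIn H A, lam ^ I.card * f I := by
    rw [Finset.sum_filter]
    refine Finset.sum_congr rfl fun I _ => ?_
    simp only [f]
    split_ifs <;> simp
  have h1 := sum_fewColours_le hC (A := A) (l := l) hlam hb hfew f hf hfN B₁
    (fun I h => if_neg h) (fun I => by simp only [B₁]; split_ifs <;> norm_num)
  have h2 : ∀ x ∈ L u, ∑ I ∈ indepIn H A, lam ^ I.card * (B₂ x I * f I) ≤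
      q * ∑ I ∈ indepIn H A, lam ^ I.card * f I := fun x hx =>
    sum_manyConflicts_le hlam.le hq (hmany x hx) f hf (hfN x hx) (B₂ x)
      (fun I h => if_neg h) (fun I => by simp only [B₂]; split_ifs <;> norm_num)
  have hM : 0 ≤ ∑ I ∈ indepIn H A, lam ^ I.card * f I :=
    Finset.sum_nonneg fun I _ => mul_nonneg (pow_nonneg hlam.le _) (hf I)
  have hpt : ∑ I ∈ (indepIn H A).filter
      (fun I => BadEvent H π L A l u I ∧ ∀ v ∈ S, ¬BadEvent H π L A l v I), lam ^ I.card ≤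
      ∑ I ∈ indepIn H A, (lam ^ I.card * (B₁ I * f I) +
        ∑ x ∈ L u, lam ^ I.card * (B₂ x I * f I)) := by
    rw [Finset.sum_filter]
    refine Finset.sum_le_sum fun I _ => ?_
    have hw : 0 ≤ lam ^ I.card := pow_nonneg hlam.le _
    have hs0 : 0 ≤ ∑ x ∈ L u, lam ^ I.card * (B₂ x I * f I) :=
      Finset.sum_nonneg fun x _ => mul_nonneg hw (mul_nonneg (hB₂0 x I) (hf I))
    have ht0 : 0 ≤ lam ^ I.card * (B₁ I * f I) := mul_nonneg hw (mul_nonneg (hB₁0 I) (hf I))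
    split_ifs with h
    · have hf1 : f I = 1 := if_pos h.2
      rcases h.1 with h3 | ⟨x, hx, h3⟩
      · have : B₁ I = 1 := if_pos h3
        rw [this, hf1, mul_one, mul_one]
        rw [hf1] at hs0
        linarith
      · have h4 : B₂ x I = 1 := if_pos h3
        have h5 := Finset.single_le_sum (f := fun x => lam ^ I.card * (B₂ x I * f I))
          (fun x _ => mul_nonneg hw (mul_nonneg (hB₂0 x I) (hf I))) hx
        simp only [h4, hf1, mul_one] at h5
        rw [hf1]
        simp only [mul_one]
        rw [hf1, mul_one] at ht0
        linarith
    · linarith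
  rw [hsumf]
  refine hpt.trans ?_
  rw [Finset.sum_add_distrib, Finset.sum_comm]
  have h3 : ∑ x ∈ L u, ∑ I ∈ indepIn H A, lam ^ I.card * (B₂ x I * f I) ≤
      Δ * (q * ∑ I ∈ indepIn H A, lam ^ I.card * f I) := by
    refine (Finset.sum_le_sum h2).trans ?_
    rw [Finset.sum_const, nsmul_eq_mul]
    have : ((L u).card : ℝ) ≤ Δ := by exact_mod_cast hcard
    gcongr
  have h4 := h1.trans (mul_le_mul_of_nonneg_right hexp hM)
  linarith

end BadEvents

/-! ### Completing a partial colouring -/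

section Completion

variable {V X : Type*} [DecidableEq X] [Fintype V] [DecidableEq V] {G : SimpleGraph V}
  {H : SimpleGraph X} {π : X → V} {L : V → Finset X}

/-- A partial colouring without bad events is completed by an independent transversal. -/
theorem IsCover.exists_completion (hC : IsCover G H π L) {l : ℕ} (hl : 2 ≤ l) (U : Finset V)
    {I : Finset X} (hI : I ∈ indepIn H (U.biUnion L))
    (hIB : ∀ u ∈ U, ¬BadEvent H π L (U.biUnion L) l u I) :
    ∃ I : Finset X, H.IsIndepSet (I : Set X) ∧ ∀ u ∈ U, ∃ x ∈ L u, x ∈ I := by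
  set A := U.biUnion L with hAdef
  have hA : ∀ u ∈ U, L u ⊆ A := fun u hu => Finset.subset_biUnion_of_mem L hu
  obtain ⟨hIA, hIind⟩ := mem_indepIn.1 hI
  let V' := {u : V // u ∈ U ∧ I ∩ L u = ∅}
  have hcompl : ∃ f : V' → X, (∀ u : V', f u ∈ (L u.1).filter fun x =>
      I ∩ crossNbrs H π A x = ∅) ∧ ∀ u v : V', u ≠ v → ¬H.Adj (f u) (f v) := by
    by_cases hne : Nonempty V'
    swap
    · exact ⟨fun u => (hne ⟨u⟩).elim, fun u => (hne ⟨u⟩).elim, fun u => (hne ⟨u⟩).elim⟩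
    obtain ⟨v₀⟩ := hne
    -- The value v₀ is a default for colours outside the uncoloured parts; it plays no role on the
    -- lists.
    let π' : X → V' := fun x => if h : π x ∈ U ∧ I ∩ L (π x) = ∅ then ⟨π x, h⟩ else v₀
    have hπ' : ∀ (u : V') (x : X), x ∈ L u.1 → π' x = u := by
      intro u x hx
      have e := (hC.mem_iff u.1 x).1 hx
      have h : π x ∈ U ∧ I ∩ L (π x) = ∅ := by
        rw [e]
        exact u.2
      simp only [π', dif_pos h]
      exact Subtype.ext e
    refine exists_indep_transversal H π' (fun u : V' => (L u.1).filter fun x =>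
      I ∩ crossNbrs H π A x = ∅) (fun u x hx => hπ' u x (Finset.mem_filter.1 hx).1) hl ?_ ?_
    · intro u
      by_contra hlt
      exact hIB u.1 u.2.1 (Or.inl ⟨u.2.2, not_le.1 hlt⟩)
    · intro u x hx T hT
      obtain ⟨hx1, hx2⟩ := Finset.mem_filter.1 hx
      have h1 : 100 * (free H I (crossNbrs H π A x)).card ≤ l := by
        by_contra hlt
        exact hIB u.1 u.2.1 (Or.inr ⟨x, hx1, hx2, not_le.1 hlt⟩)
      refine le_trans (Nat.mul_le_mul_left _ (Finset.card_le_card fun y hy => ?_)) h1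
      obtain ⟨⟨v, hv⟩, hne, hadj⟩ := hT y hy
      obtain ⟨hy1, hy2⟩ := Finset.mem_filter.1 hv
      have hyv := (hC.mem_iff v.1 y).1 hy1
      have hxu := (hC.mem_iff u.1 x).1 hx1
      have hvu : v ≠ u := by rwa [hπ' v y hy1] at hne
      refine mem_free.2 ⟨mem_crossNbrs.2 ⟨hA v.1 v.2.1 hy1, hadj, ?_⟩, fun z hz hyz => ?_⟩
      · rw [hyv, hxu]
        exact fun h => hvu (Subtype.ext h)
      -- An available colour y of an uncoloured part has no neighbour in I: none in its own part,
      -- which I misses, and none outside, by availability. So y counts among the free cross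
      -- neighbours of x.
      · by_cases hzπ : π z = π y
        · have : z ∈ I ∩ L v.1 :=
            Finset.mem_inter.2 ⟨hz, (hC.mem_iff v.1 z).2 (hzπ.trans hyv)⟩
          rw [v.2.2] at this
          exact Finset.notMem_empty z this
        · have : z ∈ I ∩ crossNbrs H π A y :=
            Finset.mem_inter.2 ⟨hz, mem_crossNbrs.2 ⟨hIA hz, hyz, hzπ⟩⟩
          rw [hy2] at this
          exact Finset.notMem_empty z this
  obtain ⟨f, hf1, hf2⟩ := hcompl
  have hfI : ∀ u : V', ∀ z ∈ I, ¬H.Adj (f u) z := by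
    intro u z hz hadj
    obtain ⟨h1, h2⟩ := Finset.mem_filter.1 (hf1 u)
    by_cases hzπ : π z = π (f u)
    · have : z ∈ I ∩ L u.1 :=
        Finset.mem_inter.2 ⟨hz, (hC.mem_iff u.1 z).2 (hzπ.trans ((hC.mem_iff u.1 _).1 h1))⟩
      rw [u.2.2] at this
      exact Finset.notMem_empty z this
    · have : z ∈ I ∩ crossNbrs H π A (f u) :=
        Finset.mem_inter.2 ⟨hz, mem_crossNbrs.2 ⟨hIA hz, hadj, hzπ⟩⟩
      rw [h2] at this
      exact Finset.notMem_empty z this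
  refine ⟨I ∪ Finset.univ.image f, ?_, ?_⟩
  · rw [isIndepSet_coe_iff] at hIind ⊢
    intro x hx y hy hadj
    rcases Finset.mem_union.1 hx with hx | hx <;> rcases Finset.mem_union.1 hy with hy | hy
    · exact hIind x hx y hy hadj
    · obtain ⟨v, -, rfl⟩ := Finset.mem_image.1 hy
      exact hfI v x hx hadj.symm
    · obtain ⟨v, -, rfl⟩ := Finset.mem_image.1 hx
      exact hfI v y hy hadj
    · obtain ⟨v, -, rfl⟩ := Finset.mem_image.1 hx
      obtain ⟨w, -, rfl⟩ := Finset.mem_image.1 hy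
      by_cases hvw : v = w
      · subst hvw
        exact hadj.ne rfl
      · exact hf2 v w hvw hadj
  · intro u hu
    by_cases hIu : I ∩ L u = ∅
    · refine ⟨f ⟨u, hu, hIu⟩, (Finset.mem_filter.1 (hf1 ⟨u, hu, hIu⟩)).1,
        Finset.mem_union_right _ (Finset.mem_image_of_mem f (Finset.mem_univ _))⟩
    · obtain ⟨x, hx⟩ := Finset.nonempty_of_ne_empty hIu
      obtain ⟨h1, h2⟩ := Finset.mem_inter.1 hx
      exact ⟨x, h2, Finset.mem_union_left _ h1⟩

end Completion

section LocalLemmaColouring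

variable {V X : Type*} [DecidableEq X] [Fintype V] [DecidableEq V] {G : SimpleGraph V}
  [DecidableRel G.Adj] {H : SimpleGraph X} {π : X → V} {L : V → Finset X}

/-- Colouring the parts in `U` by means of the local lemma: the hard-core model gives a partial
colouring without bad events, which is completed by an independent transversal. -/
theorem IsCover.exists_indep_of_bounds (hC : IsCover G H π L) {l Δ : ℕ} {lam : ℝ}
    (hlam : 0 < lam) (hl : 2 ≤ l) (hΔ : 2 ≤ Δ) (hdeg : ∀ u, G.degree u ≤ Δ) (U : Finset V)
    (hcard : ∀ u ∈ U, (L u).card ≤ Δ)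
    (hfew : ∀ u ∈ U, ∃ s b : ℝ, 0 ≤ b ∧
      l + b * G.degree u - s * (L u).card ≤ -(10 * Real.log Δ) ∧
      ∀ x ∈ L u, ∀ A : Finset X, ∀ F ⊆ crossNbrs H π A x, partFun H F (lam * Real.exp (-b)) -
        (1 - Real.exp (-1)) ≤ Real.exp (-s) * partFun H F lam)
    (hmany : ∀ u ∈ U, ∀ x ∈ L u, ∀ A : Finset X, ∀ F ⊆ crossNbrs H π A x, l < 100 * F.card →
      (Δ : ℝ) ^ 10 ≤ partFun H F lam) :
    ∃ I : Finset X, H.IsIndepSet (I : Set X) ∧ ∀ u ∈ U, ∃ x ∈ L u, x ∈ I := by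
  classical
  have hΔ' : (2 : ℝ) ≤ Δ := by exact_mod_cast hΔ
  let A : Finset X := U.biUnion L
  -- A vertex has at most Δ + 1 events to sum over and (Δ+1)³ vertices in its ball; the exponent 10
  -- covers both already for Δ = 2.
  set q : ℝ := ((Δ : ℝ) ^ 10)⁻¹ with hq
  have hq0 : 0 < q := by positivity
  have hΔ6 : (64 : ℝ) ≤ Δ ^ 6 := by
    calc (64 : ℝ) = 2 ^ 6 := by norm_num
      _ ≤ _ := by gcongr
  have hp : ((Δ : ℝ) + 1) * q ≤ 1 / 4 := by
    rw [hq, ← div_eq_mul_inv, div_le_div_iff₀ (by positivity) (by norm_num)]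
    have h2 : (Δ : ℝ) ^ 10 = Δ ^ 6 * Δ ^ 4 := by ring
    have h3 : (Δ : ℝ) ≤ Δ ^ 4 := le_self_pow₀ (by linarith) (by norm_num)
    rw [h2]
    nlinarith
  have hpd : 4 * (((Δ : ℝ) + 1) * q) * ((Δ : ℝ) + 1) ^ 3 ≤ 1 := by
    have h2 : (Δ : ℝ) + 1 ≤ 3 / 2 * Δ := by linarith
    have h3 : 4 * ((Δ : ℝ) + 1) ^ 4 ≤ (Δ : ℝ) ^ 10 := by
      calc 4 * ((Δ : ℝ) + 1) ^ 4 ≤ 4 * (3 / 2 * (Δ : ℝ)) ^ 4 := by gcongr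
        _ = 81 / 4 * (Δ : ℝ) ^ 4 := by ring
        _ ≤ (Δ : ℝ) ^ 6 * (Δ : ℝ) ^ 4 := by
            gcongr
            linarith
        _ = (Δ : ℝ) ^ 10 := by ring
    calc 4 * (((Δ : ℝ) + 1) * q) * ((Δ : ℝ) + 1) ^ 3 = 4 * ((Δ : ℝ) + 1) ^ 4 * q := by ring
      _ ≤ (Δ : ℝ) ^ 10 * q := by gcongr
      _ = 1 := mul_inv_cancel₀ (by positivity)
  have hqexp : Real.exp (-(10 * Real.log Δ)) = q := by
    rw [Real.exp_neg, hq, mul_comm, Real.exp_mul, Real.exp_log (by linarith)]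
    norm_cast
  choose t b hb hexp hF using hfew
  have hmany' : ∀ u ∈ U, ∀ x ∈ L u, ∀ F ⊆ crossNbrs H π A x, l < 100 * F.card →
      1 ≤ q * partFun H F lam := by
    intro u hu x hx F hF' hlF
    rw [hq, inv_mul_eq_div, one_le_div (by positivity)]
    exact hmany u hu x hx A F hF' hlF
  obtain ⟨I, hI, hIB⟩ := lovasz_local_lemma (indepIn H A) (fun I => lam ^ I.card)
    (fun I _ => pow_nonneg hlam.le _) (partFun_pos A hlam.le) U (BadEvent H π L A l)
    (ballThree G) (by positivity) hp hpd (fun u _ => by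
      exact_mod_cast card_ballThree_le hdeg u) fun u hu S _ hS => by
        convert hC.sum_badEvent_le hlam (hb u hu) hq0.le (fun x hx => hF u hu x hx A)
          ((Real.exp_le_exp.2 (hexp u hu)).trans hqexp.le) (hmany' u hu) (hcard u hu) S hS
  exact hC.exists_completion hl U hI hIB

end LocalLemmaColouring

/-- The choice of the parameters for the number of available colours. -/
theorem exists_parameters {ε η c Λ k κ r d D m l t : ℝ} (hε : 0 < ε) (hη : 0 < η)
    (hη2 : η < 1 / 2) (hηε : 1 + η ≤ (1 + ε / 2) * (1 - η) ^ 2) (hk : 0 < k) (hκ0 : 0 < κ)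
    (hκ : κ ≤ (1 + η) * k) (hr : 0 < r) (hΛ : 1 / η ≤ Λ) (hkD : k * D = r * Real.exp Λ)
    (hexp : 4 / ε * (c + 12) * Λ ≤ Real.exp (η * Λ)) (hD : 0 < D) (hd : d ≤ D)
    (hm : (1 + ε) * (k * D / Λ) ≤ m) (hl : l ≤ c * r + 1) (ht : 1 / 2 ≤ t) (htr : t ≤ r) :
    ∃ s θ b : ℝ, s = Real.exp (-((1 - η) * Λ)) / 2 ∧ θ = s / ((1 - η) * Λ) ∧ θ < 1 ∧
      b = κ * θ / (1 - θ) ∧ 0 ≤ b ∧ l + b * d - s * m ≤ -(10 * t) := by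
  have hΛ0 : 0 < Λ := lt_of_lt_of_le (by positivity) hΛ
  have h1η : 0 < 1 - η := by linarith
  have hLpos : 0 < (1 - η) * Λ := by positivity
  obtain ⟨s, hs⟩ : ∃ s, s = Real.exp (-((1 - η) * Λ)) / 2 := ⟨_, rfl⟩
  have hs0 : 0 < s := by
    rw [hs]
    positivity
  have hs1 : s ≤ 1 / 2 := by
    have : Real.exp (-((1 - η) * Λ)) ≤ 1 := Real.exp_le_one_iff.2 (by linarith)
    linarith
  obtain ⟨θ, hθ⟩ : ∃ θ, θ = s / ((1 - η) * Λ) := ⟨_, rfl⟩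
  have hθη : θ ≤ η := by
    rw [hθ, div_le_iff₀ hLpos]
    rw [div_le_iff₀ hη] at hΛ
    nlinarith
  have hθ0 : 0 < θ := by
    rw [hθ]
    positivity
  have hθ1 : 0 < 1 - θ := by linarith
  refine ⟨s, θ, κ * θ / (1 - θ), hs, hθ, by linarith, rfl, by positivity, ?_⟩
  -- The cost of b is s·κD/((1-η)Λ(1-θ)). Since θ ≤ η, the inequality `hηε` absorbs both
  -- denominators and the factor 1 + η in κ.
  have h1 : κ * θ / (1 - θ) * d ≤ s * ((1 + ε / 2) * (k * D / Λ)) := by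
    have e1 : κ * θ / (1 - θ) * D = s * (κ * D / ((1 - η) * Λ * (1 - θ))) := by
      rw [hθ]
      field_simp
    have e2 : κ * D / ((1 - η) * Λ * (1 - θ)) ≤ (1 + ε / 2) * (k * D / Λ) := by
      rw [div_le_iff₀ (by positivity)]
      have e3 : (1 + ε / 2) * (k * D / Λ) * ((1 - η) * Λ * (1 - θ)) =
          (1 + ε / 2) * ((1 - η) * (1 - θ)) * (k * D) := by
        field_simp
      rw [e3]
      calc κ * D ≤ (1 + η) * k * D := by gcongr
        _ ≤ (1 + ε / 2) * (1 - η) ^ 2 * k * D := by gcongr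
        _ ≤ (1 + ε / 2) * ((1 - η) * (1 - θ)) * (k * D) := by
            rw [pow_two, mul_assoc _ k D]
            gcongr
    calc κ * θ / (1 - θ) * d ≤ κ * θ / (1 - θ) * D := by gcongr
      _ ≤ _ := by
          rw [e1]
          gcongr
  have h2 : s * ((1 + ε) * (k * D / Λ)) ≤ s * m := by gcongr
  -- The remaining share ε/2 of s·m is a multiple of r·e^{ηΛ}/Λ. It covers l + 10t ≤ cr + 1 + 10t
  -- because 1 ≤ 2t ≤ 2r.
  have h3 : (c + 12) * r ≤ s * (ε / 2 * (k * D / Λ)) := by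
    have e1 : s * (ε / 2 * (k * D / Λ)) = ε / 4 * r * (Real.exp (η * Λ) / Λ) := by
      have e2 : Real.exp (-((1 - η) * Λ)) * Real.exp Λ = Real.exp (η * Λ) := by
        rw [← Real.exp_add]
        ring_nf
      rw [hkD, hs, ← e2]
      ring
    rw [e1]
    have h4 : 4 / ε * (c + 12) ≤ Real.exp (η * Λ) / Λ := by rwa [le_div_iff₀ hΛ0]
    calc (c + 12) * r = ε / 4 * r * (4 / ε * (c + 12)) := by field_simp
      _ ≤ _ := by gcongr
  linarith

/-- The Hall ratio gives log Z ≥ |F| log(1+lam)/ρ, and |F| > l/100 ≥ cρt/100; the constant 1000 is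
100·10. -/
theorem HallOn.pow_le_partFun {X : Type*} {Γ : SimpleGraph X} {F : Finset X}
    {ρ' ρ lam c t : ℝ} {l : ℕ} (h : HallOn Γ ρ' F) (hρ' : 1 ≤ ρ') (hρ : ρ' ≤ ρ) (hlam : 0 < lam)
    (ht : 0 < t) (hc : 1000 ≤ c * Real.log (1 + lam)) (hl : c * (ρ * t) ≤ l)
    (hlF : l < 100 * F.card) : Real.exp (10 * t) ≤ partFun Γ F lam := by
  have hl0 : 0 < Real.log (1 + lam) := Real.log_pos (by linarith)
  have h1 := h.card_mul_log_le hρ' hlam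
  have hZ1 := one_le_partFun (Γ := Γ) F hlam.le
  have hZ0 : 0 ≤ Real.log (partFun Γ F lam) := Real.log_nonneg hZ1
  have h2 : (l : ℝ) ≤ 100 * F.card := by exact_mod_cast hlF.le
  have h3 : ρ' * Real.log (partFun Γ F lam) ≤ ρ * Real.log (partFun Γ F lam) := by gcongr
  have hρ0 : 0 < ρ := by linarith
  have h5 : ρ * (10 * t) ≤ ρ * Real.log (partFun Γ F lam) := by
    have h6 : c * (ρ * t) * Real.log (1 + lam) ≤ 100 * F.card * Real.log (1 + lam) :=
      mul_le_mul_of_nonneg_right (hl.trans h2) hl0.le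
    have h7 : 1000 * (ρ * t) ≤ c * Real.log (1 + lam) * (ρ * t) := by gcongr
    linarith
  exact (Real.le_log_iff_exp_le (by linarith)).1 (le_of_mul_le_mul_left h5 hρ0)

/-- Correspondence colouring from local bounds on the Hall ratio; the sizes of the parts are
bounded in terms of upper bounds `D u` for the degrees. -/
theorem exists_indep_of_hallOn {ε : ℝ} (hε : 0 < ε) : ∃ δ₀ : ℝ, 1 < δ₀ ∧
    ∀ {V : Type u} {X : Type v} [Fintype V] [Fintype X] {G : SimpleGraph V} [DecidableRel G.Adj]
      {H : SimpleGraph X} {π : X → V} {L : V → Finset X}, IsCover G H π L →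
      ∀ (ρu : V → ℝ) (ρ : ℝ), (∀ u, 1 ≤ ρu u) → 1 ≤ ρ → (∀ u, ρu u ≤ ρ) →
      (∀ u, HallOn G (ρu u) (G.neighborFinset u)) →
      ∀ Δ : ℕ, 2 ≤ Δ → (∀ u, G.degree u ≤ Δ) →
      ∀ D : V → ℝ, (∀ u, (G.degree u : ℝ) ≤ D u) → (∀ u, δ₀ * ρ * Real.log Δ ≤ D u) →
      (∀ u, (1 + ε) * (K (ρu u) * D u / Real.log (K (ρu u) * D u / (ρ * Real.log Δ))) ≤
        (L u).card) →
      ∃ I : Finset X, H.IsIndepSet (I : Set X) ∧ ∀ u, ∃ x ∈ L u, x ∈ I := by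
  obtain ⟨η, lam, hη, hη2, hlam, hηε, hKle⟩ := exists_fugacity hε
  have hl0 : 0 < Real.log (1 + lam) := Real.log_pos (by linarith)
  -- The first term is what `HallOn.pow_le_partFun` needs; the 4 ensures l ≥ 2, as ρt ≥ 1/2.
  set c : ℝ := 1000 / Real.log (1 + lam) + 4 with hc
  have hc4 : 4 ≤ c := by
    have : 0 < 1000 / Real.log (1 + lam) := by positivity
    linarith
  obtain ⟨Λ₁, hΛ₁, hexpΛ⟩ := eventually_mul_le_exp (4 / ε * (c + 12)) hη
  set Λ₀ : ℝ := max Λ₁ (1 / η) with hΛ₀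
  have hΛ₀1 : 1 ≤ Λ₀ := hΛ₁.trans (le_max_left _ _)
  refine ⟨Real.exp Λ₀, Real.one_lt_exp_iff.2 (by linarith), ?_⟩
  intro V X _ _ G _ H π L hC ρu ρ hρu1 hρ1 hρu hHall Δ hΔ hdeg D hdegD hδD hL
  classical
  have hΔ' : (2 : ℝ) ≤ Δ := by exact_mod_cast hΔ
  set t : ℝ := Real.log Δ with ht
  have ht2 : 1 / 2 ≤ t := by
    have h1 := Real.log_le_log (by norm_num) hΔ'
    have h2 := Real.log_two_gt_d9
    linarith
  have ht0 : 0 < t := by linarith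
  have hρt : t ≤ ρ * t := le_mul_of_one_le_left ht0.le hρ1
  set l : ℕ := ⌈c * (ρ * t)⌉₊ with hl
  have hlle : (l : ℝ) ≤ c * (ρ * t) + 1 := (Nat.ceil_lt_add_one (by positivity)).le
  have hlge : c * (ρ * t) ≤ l := Nat.le_ceil _
  have hl2 : 2 ≤ l := by
    have h1 : (2 : ℝ) ≤ c * (ρ * t) := by nlinarith
    exact_mod_cast h1.trans hlge
  have hnbr : ∀ u, ∀ x ∈ L u, ∀ A : Finset X, ∀ F ⊆ crossNbrs H π A x, HallOn H (ρu u) F := by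
    intro u x hx A F hF
    refine (hC.hallOn_crossNbrs ?_).mono hF
    rw [(hC.mem_iff u x).1 hx]
    exact hHall u
  -- Restricting to lists no longer than the degree bounds their sizes by Δ, as the union bound over
  -- colours requires. Longer lists are coloured greedily afterwards, whatever their neighbours
  -- received.
  obtain ⟨I₀, hI₀, hI₀U⟩ := hC.exists_indep_of_bounds hlam hl2 hΔ hdeg
    (Finset.univ.filter fun u => (L u).card ≤ G.degree u)
    (fun u hu => (Finset.mem_filter.1 hu).2.trans (hdeg u)) (by
      intro u _
      have hK1 : 1 ≤ K (ρu u) := one_le_K (hρu1 u)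
      have hκ1 : 1 ≤ K ((1 + lam) * ρu u) := one_le_K (by nlinarith [hρu1 u])
      have hκ := hKle (ρu u) (hρu1 u)
      set k := K (ρu u) with hk
      set κ := K ((1 + lam) * ρu u) with hκdef
      have hD0 : 0 < D u := lt_of_lt_of_le (by positivity) (hδD u)
      have hz0 : 0 < k * D u / (ρ * t) := by positivity
      have hz : Real.exp Λ₀ ≤ k * D u / (ρ * t) := by
        rw [le_div_iff₀ (by positivity)]
        have := hδD u
        nlinarith
      have hLu := hL u
      set Λ := Real.log (k * D u / (ρ * t)) with hΛ
      have hΛΛ₀ : Λ₀ ≤ Λ := (Real.le_log_iff_exp_le hz0).2 hz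
      have hΛ0 : 0 < Λ := by linarith
      have hkD : k * D u = ρ * t * Real.exp Λ := by
        rw [hΛ, Real.exp_log hz0]
        field_simp
      obtain ⟨s, θ, b, hs, hθ, hθ1, hb, hb0, hle⟩ := exists_parameters hε hη hη2 hηε
        (by linarith : 0 < k) (by linarith : 0 < κ) hκ (by positivity : 0 < ρ * t)
        ((le_max_right _ _).trans hΛΛ₀) hkD (hexpΛ Λ ((le_max_left _ _).trans hΛΛ₀)) hD0 (hdegD u)
        hLu hlle ht2 hρt
      refine ⟨s, b, hb0, hle, fun x hx A F hF => ?_⟩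
      refine partFun_mul_exp_neg_le hlam (by linarith : 0 < κ)
        (mul_pos (by linarith) hΛ0 : 0 < (1 - η) * Λ) hs hθ hθ1 hb fun y hy hyx => ?_
      exact (hnbr u x hx A F hF).log_partFun_mul_le_of_fugacity (hρu1 u) hy hyx) (by
      intro u _ x hx A F hF hlF
      have h4 : 1000 ≤ c * Real.log (1 + lam) := by
        rw [hc, add_mul, div_mul_cancel₀ _ hl0.ne']
        linarith
      refine le_trans (le_of_eq ?_) ((hnbr u x hx A F hF).pow_le_partFun (hρu1 u) (hρu u) hlam ht0
        h4 hlge hlF)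
      rw [ht, mul_comm, Real.exp_mul, Real.exp_log (by linarith)]
      norm_cast)
  obtain ⟨I, hI₀I, hI, hIT⟩ := hC.exists_greedy_extension hI₀
    (Finset.univ.filter fun u => G.degree u < (L u).card) fun u hu => (Finset.mem_filter.1 hu).2
  refine ⟨I, hI, fun u => ?_⟩
  by_cases hu : (L u).card ≤ G.degree u
  · obtain ⟨x, hx, hxI⟩ := hI₀U u (Finset.mem_filter.2 ⟨Finset.mem_univ u, hu⟩)
    exact ⟨x, hx, hI₀I hxI⟩
  · exact hIT u (Finset.mem_filter.2 ⟨Finset.mem_univ u, not_le.1 hu⟩)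

/-! ### From covers to projections and back -/

section CoverConversion

variable {V : Type u} {G : SimpleGraph V} {W : Type v}

theorem Cover.exists_isCover (C : Cover G W) : ∃ π : W → V, IsCover G C.H π C.L := by
  choose π hπ hπu using C.partition
  have hmem : ∀ u x, x ∈ C.L u ↔ π x = u := fun u x =>
    ⟨fun h => (hπu x u h).symm, fun h => h ▸ hπ x⟩
  refine ⟨π, hmem, ?_, ?_, ?_⟩
  · intro x y hxy hne
    exact C.complete (π x) x (hπ x) y ((hmem _ y).2 hxy.symm) hne
  · intro x y hadj
    exact C.edges _ _ x (hπ x) y (hπ y) hadj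
  · intro x y z hxy hxz hne hyz
    have h := (C.edges _ _ x (hπ x) y (hπ y) hxy).resolve_left hne
    exact C.matching _ _ h x (hπ x) y (hπ y) z ((hmem _ z).2 hyz.symm) hxy hxz

theorem Cover.finite [Finite V] (C : Cover G W) : Finite W := by
  have h : (Set.univ : Set W) = ⋃ u, (C.L u : Set W) := by
    ext x
    obtain ⟨u, hu, -⟩ := C.partition x
    simpa using ⟨u, hu⟩
  rw [← Set.finite_univ_iff, h]
  exact Set.finite_iUnion fun u => (C.L u).finite_toSet

theorem Cover.colourable_of_hits [Fintype V] (C : Cover G W) {π : W → V}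
    (hC : IsCover G C.H π C.L) {I : Finset W} (hI : C.H.IsIndepSet (I : Set W))
    (h : ∀ u, ∃ x ∈ C.L u, x ∈ I) : C.Colourable := by
  classical
  refine ⟨I, hI, ?_⟩
  rw [isIndepSet_coe_iff] at hI
  rw [← Finset.card_univ]
  refine Finset.card_bij (fun x _ => π x) (fun _ _ => Finset.mem_univ _) ?_ ?_
  · intro x hx y hy hxy
    by_contra hne
    exact hI x hx y hy (hC.complete x y hxy hne)
  · intro u _
    obtain ⟨x, hx, hxI⟩ := h u
    exact ⟨x, hxI, (hC.mem_iff u x).1 hx⟩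

theorem corrChromaticNumber_le [Fintype V] {k : ℕ}
    (h : ∀ (W : Type u) (C : Cover G W), C.IsFold k → C.Colourable) :
    corrChromaticNumber G ≤ k := Nat.sInf_le h

end CoverConversion

theorem exists_local_correspondence_colouring (ε : ℝ) (hε : 0 < ε) : ∃ δ₀ : ℝ, 1 < δ₀ ∧
    ∃ Δ₀ : ℕ, 2 ≤ Δ₀ ∧
      ∀ (V : Type u) [Fintype V] (G : SimpleGraph V) [DecidableRel G.Adj] (ρu : V → ℝ) (ρ : ℝ),
        HasLocalHallRatioLE G ρu → IsGreatest (range ρu) ρ →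
        ∀ Δ : ℕ, G.maxDegree = Δ → Δ₀ ≤ Δ →
        ∀ δ : ℝ, δ = δ₀ * ρ * Real.log (Δ : ℝ) →
        ∀ (W : Type v) (C : Cover G W),
          (∀ u : V, (1 + ε) * max
              (K (ρu u) * (G.degree u : ℝ) /
                Real.log (K (ρu u) * (G.degree u : ℝ) / (ρ * Real.log (Δ : ℝ))))
              (K (ρu u) * δ / Real.log (K (ρu u) * δ / (ρ * Real.log (Δ : ℝ))))
            ≤ ((C.L u).card : ℝ)) →
          C.Colourable := by
  obtain ⟨δ₀, hδ₀, hmain⟩ := exists_indep_of_hallOn.{u, v} hε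
  refine ⟨δ₀, hδ₀, 2, le_rfl, ?_⟩
  intro V _ G _ ρu ρ h hρ Δ hΔ hΔ2 δ hδ W C hL
  have := C.finite
  have := Fintype.ofFinite W
  obtain ⟨π, hπ⟩ := C.exists_isCover
  obtain ⟨u₀, hu₀⟩ := hρ.1
  obtain ⟨I, hI, hIL⟩ := hmain hπ ρu ρ (fun u => (h u).1) (hu₀ ▸ (h u₀).1)
    (fun u => hρ.2 ⟨u, rfl⟩) h.hallOn Δ hΔ2 (fun u => hΔ ▸ G.degree_le_maxDegree u)
    (fun u => max (G.degree u : ℝ) δ) (fun u => le_max_left _ _)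
    (fun u => hδ ▸ le_max_right _ _) (by
      intro u
      refine le_trans (mul_le_mul_of_nonneg_left ?_ (by linarith)) (hL u)
      rcases max_choice (G.degree u : ℝ) δ with hm | hm
      · rw [hm]
        exact le_max_left _ _
      · rw [hm]
        exact le_max_right _ _)
  exact C.colourable_of_hits hπ hI hIL

/-- Write k = K(ρ) and T = log(kΔ/ρ). If log Δ ≤ 1 + 2 log ρ, then kΔ/T ≥ Δ and greedy colouring
suffices. Otherwise ρ ≤ √Δ and T ≥ (log Δ)/2, so the factor log Δ inside the logarithm is negligible
and D = Δ is admissible in `exists_indep_of_hallOn`. -/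
theorem exists_corrChromaticNumber_le (ε : ℝ) (hε : 0 < ε) : ∃ Δ₀ : ℕ,
    ∀ (V : Type u) [Fintype V] (G : SimpleGraph V) [DecidableRel G.Adj] (ρu : V → ℝ) (ρ : ℝ),
      HasLocalHallRatioLE G ρu → IsGreatest (range ρu) ρ →
      ∀ Δ : ℕ, G.maxDegree = Δ → Δ₀ ≤ Δ → 1 < K ρ * (Δ : ℝ) / ρ →
      (corrChromaticNumber G : ℝ) ≤
        (1 + ε) * (K ρ * (Δ : ℝ) / Real.log (K ρ * (Δ : ℝ) / ρ)) := by
  obtain ⟨δ₀, hδ₀, hmain⟩ := exists_indep_of_hallOn.{u, u} (ε := ε / 4) (by positivity)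
  -- Chosen so that (1 + ε/4)/(1-η) = 1 + ε/2; the other half of ε absorbs the rounding of (1+ε)x to
  -- an integer.
  set η : ℝ := ε / (4 + 2 * ε) with hη
  have hη0 : 0 < η := by positivity
  have hηε : (1 + ε / 2) * (1 - η) = 1 + ε / 4 := by
    rw [hη]
    field_simp
    ring
  have hη1 : η < 1 := by
    rw [hη, div_lt_one (by positivity)]
    linarith
  obtain ⟨a₁, ha₁, h₁⟩ := eventually_mul_le_exp δ₀ (η := 1 / 2) (by norm_num)
  obtain ⟨a₂, ha₂, h₂⟩ := eventually_mul_le_exp 1 (η := η / 2) (by positivity)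
  obtain ⟨a₃, ha₃, h₃⟩ := eventually_mul_le_exp (4 / ε) (η := 1) one_pos
  refine ⟨⌈Real.exp (max a₁ (max a₂ a₃))⌉₊, ?_⟩
  intro V _ G _ ρu ρ h hρ Δ hΔ hΔ₀ hz
  have hexpΔ : Real.exp (max a₁ (max a₂ a₃)) ≤ Δ := Nat.ceil_le.1 hΔ₀
  have hΔpos : (0 : ℝ) < Δ := (Real.exp_pos _).trans_le hexpΔ
  set t : ℝ := Real.log Δ with ht
  have hat : max a₁ (max a₂ a₃) ≤ t := (Real.le_log_iff_exp_le hΔpos).2 hexpΔ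
  have ht₁ : a₁ ≤ t := (le_max_left _ _).trans hat
  have ht₂ : a₂ ≤ t := (le_max_left _ _).trans ((le_max_right _ _).trans hat)
  have ht₃ : a₃ ≤ t := (le_max_right _ _).trans ((le_max_right _ _).trans hat)
  have ht1 : 1 ≤ t := ha₁.trans ht₁
  have hΔt : (Δ : ℝ) = Real.exp t := (Real.exp_log hΔpos).symm
  have hΔ2 : 2 ≤ Δ := by
    have h5 := Real.add_one_le_exp t
    have h6 : (2 : ℝ) ≤ Δ := by linarith
    exact_mod_cast h6
  obtain ⟨u₀, hu₀⟩ := hρ.1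
  have hρ1 : 1 ≤ ρ := hu₀ ▸ (h u₀).1
  have hρpos : 0 < ρ := by linarith
  obtain ⟨hK1, hKeq⟩ := K_spec hρ1
  set k := K ρ with hk
  have hkpos : 0 < k := by linarith
  have hT1 : Real.log (k * Δ / ρ) ≤ t + 1 := log_K_mul_div_le hρ1 hΔpos
  have hT0 : 0 < Real.log (k * Δ / ρ) := Real.log_pos hz
  have hTeq : Real.log (k * Δ / ρ) = Real.log k + t - Real.log ρ := by
    rw [Real.log_div (by positivity) hρpos.ne', Real.log_mul hkpos.ne' hΔpos.ne']
  set T := Real.log (k * Δ / ρ) with hT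
  set x : ℝ := k * Δ / T with hx
  have hx0 : 0 < x := by positivity
  have hΔε : 4 / ε * t ≤ Δ := by
    rw [hΔt]
    simpa using h₃ t ht₃
  have hx2 : 2 / ε ≤ x := by
    rw [hx, le_div_iff₀ hT0]
    calc 2 / ε * T ≤ 2 / ε * (t + t) := by
          gcongr
          linarith
      _ = 4 / ε * t := by ring
      _ ≤ Δ := hΔε
      _ ≤ k * Δ := le_mul_of_one_le_left hΔpos.le hK1
  have hεx : 2 ≤ ε * x := by
    rw [div_le_iff₀ hε] at hx2
    linarith
  refine le_trans ?_ (Nat.floor_le (by positivity : 0 ≤ (1 + ε) * x))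
  have hfloor : (1 + ε) * x - 1 ≤ (⌊(1 + ε) * x⌋₊ : ℝ) := (Nat.sub_one_lt_floor _).le
  refine Nat.cast_le.2 (corrChromaticNumber_le fun W C hCk => ?_)
  have := C.finite
  have := Fintype.ofFinite W
  obtain ⟨π, hπ⟩ := C.exists_isCover
  have hdeg : ∀ u, G.degree u ≤ Δ := fun u => hΔ ▸ G.degree_le_maxDegree u
  by_cases hcase : t ≤ 1 + 2 * Real.log ρ
  · have hxΔ : (Δ : ℝ) ≤ x := by
      rw [hx, le_div_iff₀ hT0, mul_comm]
      -- T = log k + t - log ρ ≤ log k + 1 + log ρ = k, by `hcase` and the equation for `K`.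
      have : T ≤ k := by linarith
      gcongr
    have hlt : (Δ : ℝ) < ⌊(1 + ε) * x⌋₊ := by linarith
    have hlt' : Δ < ⌊(1 + ε) * x⌋₊ := by exact_mod_cast hlt
    obtain ⟨I, -, hI, hIL⟩ := hπ.exists_greedy_extension (I₀ := ∅)
      (by simp [SimpleGraph.IsIndepSet]) Finset.univ fun u _ => by
        rw [hCk u]
        exact (hdeg u).trans_lt hlt'
    exact C.colourable_of_hits hπ hI fun u => hIL u (Finset.mem_univ u)
  · have hρt : Real.log ρ ≤ t / 2 := by linarith
    have hρexp : ρ ≤ Real.exp (1 / 2 * t) := by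
      rw [← Real.log_le_iff_le_exp hρpos]
      linarith
    have hTt : t / 2 ≤ T := by
      have := Real.log_nonneg hK1
      linarith
    have hlogt : Real.log t ≤ η * T := by
      have h5 := h₂ t ht₂
      rw [one_mul, ← Real.log_le_iff_le_exp (by linarith)] at h5
      nlinarith
    have hδD : δ₀ * ρ * t ≤ Δ := by
      rw [hΔt]
      calc δ₀ * ρ * t = ρ * (δ₀ * t) := by ring
        _ ≤ Real.exp (1 / 2 * t) * Real.exp (1 / 2 * t) := by
            gcongr
            exact h₁ t ht₁
        _ = Real.exp t := by
            rw [← Real.exp_add]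
            ring_nf
    obtain ⟨I, hI, hIL⟩ := hmain hπ (fun _ => ρ) ρ (fun _ => hρ1) hρ1 (fun _ => le_rfl)
      (fun u => (h.hallOn u).mono_right (hρ.2 ⟨u, rfl⟩)) Δ hΔ2 hdeg (fun _ => (Δ : ℝ))
      (fun u => by exact_mod_cast hdeg u) (fun _ => hδD) (by
        intro u
        rw [hCk u, ← hk, ← ht]
        refine le_trans ?_ hfloor
        have h5 : Real.log (k * Δ / (ρ * t)) = T - Real.log t := by
          rw [← div_div, Real.log_div (by positivity) (by positivity)]
        have h6 : (1 - η) * T ≤ Real.log (k * Δ / (ρ * t)) := by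
          rw [h5]
          linarith
        have h1η : 0 < 1 - η := by linarith
        have h7 : k * Δ / Real.log (k * Δ / (ρ * t)) ≤ x / (1 - η) := by
          calc k * Δ / Real.log (k * Δ / (ρ * t)) ≤ k * Δ / ((1 - η) * T) := by gcongr
            _ = x / (1 - η) := by
                rw [hx]
                field_simp
        calc (1 + ε / 4) * (k * Δ / Real.log (k * Δ / (ρ * t)))
            ≤ (1 + ε / 4) * (x / (1 - η)) := by gcongr
          _ = (1 + ε / 2) * x := by
              rw [← hηε]
              field_simp
          _ ≤ (1 + ε) * x - 1 := by linarith)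
    exact C.colourable_of_hits hπ hI hIL

end LocalHall

theorem theorem6p1 :
    -- the function `K : [1, ∞) → [1, ∞)` and its growth
    (MapsTo LocalHall.K (Ici 1) (Ici 1) ∧
      Asymptotics.IsEquivalent atTop LocalHall.K Real.log) ∧
    -- occupancy fraction
    (∀ (V : Type u) [Fintype V] (G : SimpleGraph V) [DecidableRel G.Adj] (ρu : V → ℝ) (ρ : ℝ),
      LocalHall.HasLocalHallRatioLE G ρu → IsGreatest (range ρu) ρ → 1 ≤ G.maxDegree →
      ∀ lam : ℝ, 0 < lam →
        LocalHall.occupancyFraction G lam =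
          1 / (Fintype.card V : ℝ) *
            (lam * deriv (LocalHall.partitionFunction G) lam /
              LocalHall.partitionFunction G lam) ∧
        ∃ m : ℝ,
          IsGreatest (LocalHall.occupancyBound ρ (G.maxDegree : ℝ) '' Icc 0 lam) m ∧
          m ≤ LocalHall.occupancyFraction G lam) ∧
    -- local fractional colouring
    (∀ ε : ℝ, 0 < ε → ∃ δ₀ : ℝ, 1 < δ₀ ∧
      ∀ (V : Type u) [Fintype V] (G : SimpleGraph V) [DecidableRel G.Adj] (ρu : V → ℝ),
        LocalHall.HasLocalHallRatioLE G ρu →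
        ∃ (k : ℝ) (w : Finset V → Set ℝ), LocalHall.IsFractionalColouring G k w ∧
          ∀ u : V, LocalHall.colourSet G w u ⊆
            Ico 0 ((1 + ε) * max
              (LocalHall.K (ρu u) * (G.degree u : ℝ) /
                Real.log (LocalHall.K (ρu u) * (G.degree u : ℝ)))
              (LocalHall.K (ρu u) * δ₀ / Real.log (LocalHall.K (ρu u) * δ₀)))) ∧
    -- local correspondence colouring
    (∀ ε : ℝ, 0 < ε → ∃ δ₀ : ℝ, 1 < δ₀ ∧ ∃ Δ₀ : ℕ, 2 ≤ Δ₀ ∧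
      ∀ (V : Type u) [Fintype V] (G : SimpleGraph V) [DecidableRel G.Adj] (ρu : V → ℝ) (ρ : ℝ),
        LocalHall.HasLocalHallRatioLE G ρu → IsGreatest (range ρu) ρ →
        ∀ Δ : ℕ, G.maxDegree = Δ → Δ₀ ≤ Δ →
        ∀ δ : ℝ, δ = δ₀ * ρ * Real.log (Δ : ℝ) →
        ∀ (W : Type v) (C : LocalHall.Cover G W),
          (∀ u : V, (1 + ε) * max
              (LocalHall.K (ρu u) * (G.degree u : ℝ) /
                Real.log (LocalHall.K (ρu u) * (G.degree u : ℝ) / (ρ * Real.log (Δ : ℝ))))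
              (LocalHall.K (ρu u) * δ /
                Real.log (LocalHall.K (ρu u) * δ / (ρ * Real.log (Δ : ℝ))))
            ≤ ((C.L u).card : ℝ)) →
          C.Colourable) ∧
    -- the correspondence chromatic number; the error term is uniform in `ρ`
    (∀ ε : ℝ, 0 < ε → ∃ Δ₀ : ℕ,
      ∀ (V : Type u) [Fintype V] (G : SimpleGraph V) [DecidableRel G.Adj] (ρu : V → ℝ) (ρ : ℝ),
        LocalHall.HasLocalHallRatioLE G ρu → IsGreatest (range ρu) ρ →
        ∀ Δ : ℕ, G.maxDegree = Δ → Δ₀ ≤ Δ →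
        1 < LocalHall.K ρ * (Δ : ℝ) / ρ →
        (LocalHall.corrChromaticNumber G : ℝ) ≤
          (1 + ε) * (LocalHall.K ρ * (Δ : ℝ) / Real.log (LocalHall.K ρ * (Δ : ℝ) / ρ))) := by
  exact ⟨⟨fun _ hy => LocalHall.one_le_K hy, LocalHall.K_isEquivalent_log⟩,
    fun _ _ _ _ ρu ρ h hρ hΔ lam hlam =>
      LocalHall.occupancyFraction_bound ρu ρ h hρ hΔ lam hlam,
    LocalHall.exists_local_fractional_colouring,
    LocalHall.exists_local_correspondence_colouring,
    LocalHall.exists_corrChromaticNumber_le⟩
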